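/- Let $n\ge 1$ and let $Y_i=\theta_i+\epsilon_i$, $i=1,\dots,n$, where $\theta\in\mathbb{R}^n$ and $\epsilon_1,\dots,\epsilon_n$ are independent mean-zero random variables with $\mathbb{E}[e^{t\epsilon_i}]\le e^{t^2/2}$ for all $t\in\mathbb{R}$. Notation. A change-point vector is a finite (possibly empty) sequence of integers $\tau=(\tau_1<\dots<\tau_m)$ in $\{2,\dots,n\}$; we write $|\tau|=m$, $\{\tau\}$ for its set of entries, and use the conventions $\tau_0=1$, $\tau_{m+1}=n+1$. Let $\Pi_\tau$ be the orthogonal projector of $\mathbb{R}^n$ onto the vectors that are constant on each $\{\tau_i,\dots,\tau_{i+1}-1\}$, $0\le i\le m$. For $L>1$ and $q>0$, a penalized least-squares estimator $\widehat\tau$ is any minimizer over all change-point vectors $\tau$ of $$\|Y-\Pi_\tau Y\|^2+L\Big[q|\tau|+2\sum_{i=1}^{|\tau|+1}\log\Big(\frac{n}{\tau_i-\tau_{i-1}}\Big)\Big].$$ Let $\tau^*=(\tau^*_1<\dots<\tau^*_K)$ be the positions $t\in\{2,\dots,n\}$ with $\theta_{t-1}\ne\theta_t$ (with $\tau^*_0=1$,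 $\tau^*_{K+1}=n+1$), and $\Delta_k=\theta_{\tau^*_k}-\theta_{\tau^*_k-1}$. For integers $1\le t_1<t_2<t_3\le n+1$ put $$E(t_1,t_2,t_3)=\Big|\frac{\sum_{i=t_2}^{t_3-1}\theta_i}{t_3-t_2}-\frac{\sum_{i=t_1}^{t_2-1}\theta_i}{t_2-t_1}\Big|\sqrt{\frac{(t_2-t_1)(t_3-t_2)}{t_3-t_1}}.$$ An entry $\tau_l$ of $\tau$ is a $(\kappa,q,\tau)$-high-energy change-point if $$E(\tau_{l-1},\tau_l,\tau_{l+1})>\kappa\sqrt{2\log\Big(\frac{n(\tau_{l+1}-\tau_{l-1})}{(\tau_{l+1}-\tau_l)(\tau_l-\tau_{l-1})}\Big)+q};$$ $(\kappa,q)$-high-energy means $(\kappa,q,\tau^*)$-high-energy. Let $\widehat\tau^{(k)}$ be $\widehat\tau$ with the entry $\tau^*_k$ inserted, and $d_{H,1}(\tau,t)=\min_i|\tau_i-t|$ ($=+\infty$ if $\tau$ is empty). Proposition. There are universal constants $q'_0,c_1,c_2>0$ and, for every $L>1$, constants $\kappa_L>1$ and $\eta_L\in(0,1)$ depending only on $L$,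 such that the following holds for every $L>1$, every $q>q'_0+c_1\log[((L\wedge 2)-1)^{-1}]$, every $n\ge 1$ and every noise vector $\epsilon$ as above. There is an event $\mathcal{A}_{L,q}$, not depending on $\theta$, of probability at least $1-c_1e^{-c_2q}$, on which, for every $\theta\in\mathbb{R}^n$, every penalized least-squares estimator $\widehat\tau$ satisfies: (a) for all $k=0,\dots,K$, $\ |\{\widehat\tau\}\cap[\tau^*_k,\tau^*_{k+1})|\le 2$, $\ |\{\widehat\tau\}\cap[\tau^*_k,\tau^*_k+\eta_L(\tau^*_{k+1}-\tau^*_k)]|\le 1$ and $|\{\widehat\tau\}\cap[\tau^*_{k+1}-\eta_L(\tau^*_{k+1}-\tau^*_k),\tau^*_{k+1}]|\le 1$; (b) for all $k\in\{1,\dots,K\}$ such that $\tau^*_k$ is a $(\kappa_L,q)$-high-energy change-point, $$d_{H,1}(\widehat\tau,\tau^*_k)\le\min\Big\{\frac{\tau^*_{k+1}-\tau^*_k}{2},\ \frac{\tau^*_k-\tau^*_{k-1}}{2},\ \kappa_L\frac{\log(n\Delta_k^2)+q}{\Delta_k^2}\Big\};$$ (c) for all $k\in\{1,\dots,K\}$,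 either $\tau^*_k\in\{\widehat\tau\}$ or $\tau^*_k$ is not a $(1.1\sqrt L+0.9,\,q,\,\widehat\tau^{(k)})$-high-energy change-point. -/

import Mathlib

open MeasureTheory ProbabilityTheory

noncomputable section

namespace ChangePoint

/-- The coordinate `v_i` of a vector of `ℝⁿ`, with coordinates numbered `1, …, n`. -/
def coord {n : ℕ} (v : EuclideanSpace ℝ (Fin n)) (i : ℕ) : ℝ :=
  if h : 1 ≤ i ∧ i ≤ n then v ⟨i - 1, by omega⟩ else 0

/-- A change-point vector `2 ≤ τ_1 < ⋯ < τ_m ≤ n` is encoded by the finite set `T` of its entries.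
`IsCPVector n T` says that all the entries are admissible positions. -/
def IsCPVector (n : ℕ) (T : Finset ℕ) : Prop := T ⊆ Finset.Icc 2 n

/-- The entry that precedes the position `t` in the change-point vector `T`, with the convention
`τ_0 = 1`. It is used for `2 ≤ t`. -/
def prevPt (T : Finset ℕ) (t : ℕ) : ℕ := sSup {s : ℕ | s < t ∧ (s = 1 ∨ s ∈ T)}

/-- The entry that follows the position `t` in the change-point vector `T`, with the convention
`τ_{m+1} = n + 1`. It is used for `t ≤ n`. -/
def nextPt (n : ℕ) (T : Finset ℕ) (t : ℕ) : ℕ := sInf {s : ℕ | t < s ∧ (s ∈ T ∨ s = n + 1)}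

/-- The space of the vectors that are constant on each segment `{τ_i, …, τ_{i+1} - 1}` of the
change-point vector `T`: two positions lie in the same segment if and only if they have the same
entries of `T` on their left (the coordinate `i : Fin n` is at the position `i + 1`). -/
def piecewiseConst (n : ℕ) (T : Finset ℕ) : Submodule ℝ (EuclideanSpace ℝ (Fin n)) where
  carrier := {v | ∀ i j : Fin n,
    (∀ t ∈ T, t ≤ (i : ℕ) + 1 ↔ t ≤ (j : ℕ) + 1) → v i = v j}
  add_mem' := by
    intro a b ha hb i j h
    simp [ha i j h, hb i j h]
  zero_mem' := by
    intro i j _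
    simp
  smul_mem' := by
    intro c a ha i j h
    simp [ha i j h]

/-- The multiscale penalty `q |τ| + 2 ∑_{i=1}^{|τ|+1} log (n / (τ_i - τ_{i-1}))`. -/
def pen (n : ℕ) (q : ℝ) (T : Finset ℕ) : ℝ :=
  q * (T.card : ℝ)
    + 2 * ∑ t ∈ insert (n + 1) T, Real.log ((n : ℝ) / ((t : ℝ) - (prevPt T t : ℝ)))

/-- The penalized least-squares criterion `‖Y - Π_τ Y‖² + L pen(τ, q)`. -/
def crit {n : ℕ} (L q : ℝ) (Y : EuclideanSpace ℝ (Fin n)) (T : Finset ℕ) : ℝ :=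
  ‖Y - (piecewiseConst n T).starProjection Y‖ ^ 2 + L * pen n q T

/-- `T` is a penalized least-squares estimator: any minimizer of the criterion over all the
change-point vectors. -/
def IsPLSE {n : ℕ} (L q : ℝ) (Y : EuclideanSpace ℝ (Fin n)) (T : Finset ℕ) : Prop :=
  IsCPVector n T ∧ ∀ S : Finset ℕ, IsCPVector n S → crit L q Y T ≤ crit L q Y S

/-- The change-point vector `τ*` of `θ`. -/
def trueCP {n : ℕ} (θ : EuclideanSpace ℝ (Fin n)) : Finset ℕ :=
  (Finset.Icc 2 n).filter (fun t => coord θ (t - 1) ≠ coord θ t)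

/-- The height `Δ_k = μ_{k+1} - μ_k` of the change-point of `θ` at the position `t = τ*_k`. -/
def height {n : ℕ} (θ : EuclideanSpace ℝ (Fin n)) (t : ℕ) : ℝ := coord θ t - coord θ (t - 1)

/-- The mean of `θ` on `[a, b)`. -/
def segMean {n : ℕ} (θ : EuclideanSpace ℝ (Fin n)) (a b : ℕ) : ℝ :=
  (∑ i ∈ Finset.Ico a b, coord θ i) / ((b : ℝ) - (a : ℝ))

/-- The energy `E(θ, (t₁, t₂, t₃))`. -/
def energy {n : ℕ} (θ : EuclideanSpace ℝ (Fin n)) (t₁ t₂ t₃ : ℕ) : ℝ :=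
  |segMean θ t₂ t₃ - segMean θ t₁ t₂|
    * Real.sqrt ((((t₂ : ℝ) - t₁) * ((t₃ : ℝ) - t₂)) / ((t₃ : ℝ) - t₁))

/-- The threshold `√(2 log (n (t₃ - t₁) / ((t₃ - t₂) (t₂ - t₁))) + q)`. -/
def threshold (n : ℕ) (q : ℝ) (t₁ t₂ t₃ : ℕ) : ℝ :=
  Real.sqrt (2 * Real.log (((n : ℝ) * ((t₃ : ℝ) - t₁))
    / (((t₃ : ℝ) - t₂) * ((t₂ : ℝ) - t₁))) + q)

/-- The entry `t = τ_l` of the change-point vector `T` is a `(κ, q, T)`-high-energy change-point of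
`θ`; for `T = τ*` this is a `(κ, q)`-high-energy change-point. -/
def IsHighEnergy {n : ℕ} (θ : EuclideanSpace ℝ (Fin n)) (κ q : ℝ) (T : Finset ℕ) (t : ℕ) : Prop :=
  t ∈ T ∧ κ * threshold n q (prevPt T t) t (nextPt n T t)
    < energy θ (prevPt T t) t (nextPt n T t)

/-- The distance `d_{H,1}(τ, t) = min_i |τ_i - t|` of `t` to the closest entry of the change-point
vector `T`; it is infinite when `T` is empty. -/
def distH1 (T : Finset ℕ) (t : ℕ) : EReal :=
  T.inf (fun s => ((|(s : ℝ) - (t : ℝ)| : ℝ) : EReal))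

/-- The entries of a change-point vector that lie in a set of reals. -/
def entriesIn (T : Finset ℕ) (I : Set ℝ) : Set ℕ := {t : ℕ | t ∈ T ∧ (t : ℝ) ∈ I}

/-- The noise vector: independent, centred, sub-Gaussian random variables with
`E[exp (s ε_i)] ≤ exp (s² / 2)` for all real `s`. -/
structure IsNoise {Ω : Type*} [MeasurableSpace Ω] {n : ℕ} (ε : Fin n → Ω → ℝ) (P : Measure Ω) :
    Prop where
  measurable : ∀ i, Measurable (ε i)
  indep : iIndepFun ε P
  mean_zero : ∀ i, ∫ ω, ε i ω ∂P = 0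
  subgaussian : ∀ i, HasSubgaussianMGF (ε i) 1 P

/-- The observation `Y = θ + ε`. -/
def observation {Ω : Type*} {n : ℕ} (θ : EuclideanSpace ℝ (Fin n)) (ε : Fin n → Ω → ℝ) (ω : Ω) :
    EuclideanSpace ℝ (Fin n) :=
  θ + WithLp.toLp 2 (fun i => ε i ω)

/-- At most two estimated change-points in each `[τ*_k, τ*_{k+1})` and at most one near each end of
it, for `k = 0, …, K` (`s = τ*_k` runs over `τ*_0 = 1` and the true change-points). -/
def FewChangePoints {n : ℕ} (θ : EuclideanSpace ℝ (Fin n)) (η : ℝ) (T : Finset ℕ) : Prop :=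
  ∀ s ∈ insert 1 (trueCP θ), ∀ s' : ℕ, s' = nextPt n (trueCP θ) s →
    (entriesIn T (Set.Ico (s : ℝ) s')).ncard ≤ 2 ∧
    (entriesIn T (Set.Icc (s : ℝ) (s + η * ((s' : ℝ) - s)))).ncard ≤ 1 ∧
    (entriesIn T (Set.Icc ((s' : ℝ) - η * ((s' : ℝ) - s)) s')).ncard ≤ 1

/-- The property **Detec[κ, q, c]** of the estimate `T`: every `(κ, q)`-high-energy change-point is
detected and localized. -/
def Detec {n : ℕ} (θ : EuclideanSpace ℝ (Fin n)) (κ q c : ℝ) (T : Finset ℕ) : Prop :=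
  ∀ t ∈ trueCP θ, IsHighEnergy θ κ q (trueCP θ) t →
    distH1 T t ≤
      ((min (((nextPt n (trueCP θ) t : ℝ) - t) / 2)
        (min (((t : ℝ) - prevPt (trueCP θ) t) / 2)
          (c * ((Real.log (n * height θ t ^ 2) + q) / height θ t ^ 2))) : ℝ) : EReal)

/-- Every true change-point `t` either belongs to `T` or is not `(κ, q, T^{(k)})`-high-energy,
where `T^{(k)}` is `T` with the entry `t = τ*_k` inserted. -/
def UnselectedLowEnergy {n : ℕ} (θ : EuclideanSpace ℝ (Fin n)) (κ q : ℝ) (T : Finset ℕ) : Prop :=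
  ∀ t ∈ trueCP θ, t ∈ T ∨ ¬ IsHighEnergy θ κ q (insert t T) t

end ChangePoint

end

open ChangePoint

/-! Inserting a position `t` between its neighbours `a` and `c` adds a single unit direction,
`splitVec`, to the space of piecewise constant vectors. The residual sum of squares drops by the
squared contrast of `Y`, and the penalty grows by exactly `sqThreshold`, the squared threshold of
the definition of high energy (`crit_insert`). Hence a minimizer obeys local inequalities: the
squared contrast is at most `L * sqThreshold` at unselected positions (`IsPLSE.contrast_sq_le`) and
at least that at selected ones (`IsPLSE.le_contrast_sq`).

The only probabilistic input is the event `ContrastsBounded`, on which every squared noise contrast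
is at most `M * sqThreshold`. Put B = 0.1√L + 0.9, so that 1 < B < √L; the event chosen has 1 < M ≤
B². On it everything is deterministic. (c) At an unselected position the triangle inequality bounds
the energy by √L + B = 1.1√L + 0.9 thresholds. (a) A selected point whose neighbours enclose no true
change-point has a pure noise contrast, below √L thresholds, so deleting it would pay. Two selected
points near one end of a constant segment are excluded by comparing three adjacent segments
(`not_le_contrast_of_short`). (b) If no selected point lies within distance m of a jump Δ, then
inserting that jump and at most two points shielding it costs O(L(q + log(n/m))) and gains order Δ²m
up to noise. Minimality bounds Δ²m (`IsPLSE.jump_sq_mul_le`), which contradicts high energy when m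
is the detection radius (`detection_radius_bound`).

For the probability, a union bound over all triples is too expensive because M may be close to 1.
Triples are rounded to a multiscale grid. At smaller scale 2^m there are about n/2^m middle points,
and the tail exp(-sqThreshold/2) supplies the matching factor 2^m/n; the surplus factor 1 + ξ in
front of the threshold makes the sum over pairs of scales converge
(`IsNoise.measureReal_not_gridBounded_le`). The rounding error is controlled by dyadic chaining
(`DyadicBounded.sq_sub_le`) and is absorbed in a second ξ (`GridBounded.splitGain_le`). -/

namespace ChangePoint

/-! ### Neighbours of a position in a change-point vector -/

section Neighbours

variable {n : ℕ} {T : Finset ℕ} {s t : ℕ}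

lemma IsCPVector.two_le (hT : IsCPVector n T) (ht : t ∈ T) : 2 ≤ t :=
  (Finset.mem_Icc.1 (hT ht)).1

lemma IsCPVector.le (hT : IsCPVector n T) (ht : t ∈ T) : t ≤ n :=
  (Finset.mem_Icc.1 (hT ht)).2

lemma IsCPVector.insert (hT : IsCPVector n T) (h2 : 2 ≤ t) (hn : t ≤ n) :
    IsCPVector n (insert t T) := by
  intro s hs
  rcases Finset.mem_insert.1 hs with rfl | hs
  · exact Finset.mem_Icc.2 ⟨h2, hn⟩
  · exact hT hs

lemma IsCPVector.erase (hT : IsCPVector n T) (t : ℕ) : IsCPVector n (T.erase t) :=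
  (Finset.erase_subset t T).trans hT

lemma prevPt_mem (T : Finset ℕ) (ht : 2 ≤ t) :
    prevPt T t < t ∧ (prevPt T t = 1 ∨ prevPt T t ∈ T) :=
  Nat.sSup_mem (s := {s : ℕ | s < t ∧ (s = 1 ∨ s ∈ T)}) ⟨1, by omega, Or.inl rfl⟩
    ⟨t, fun _ hs => hs.1.le⟩

lemma prevPt_lt (T : Finset ℕ) (ht : 2 ≤ t) : prevPt T t < t := (prevPt_mem T ht).1

lemma le_prevPt (hst : s < t) (hs : s = 1 ∨ s ∈ T) : s ≤ prevPt T t :=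
  le_csSup (⟨t, fun _ hs => hs.1.le⟩ : BddAbove {s : ℕ | s < t ∧ (s = 1 ∨ s ∈ T)}) ⟨hst, hs⟩

lemma one_le_prevPt (T : Finset ℕ) (ht : 2 ≤ t) : 1 ≤ prevPt T t :=
  le_prevPt (by omega) (Or.inl rfl)

lemma prevPt_eq {a : ℕ} (hat : a < t) (ha : a = 1 ∨ a ∈ T) (ha1 : 1 ≤ a)
    (h : ∀ s ∈ T, s < t → s ≤ a) : prevPt T t = a := by
  refine le_antisymm ?_ (le_prevPt hat ha)
  obtain ⟨h1, h2 | h2⟩ := prevPt_mem T (show 2 ≤ t by omega)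
  · omega
  · exact h _ h2 h1

lemma nextPt_mem (T : Finset ℕ) (ht : t ≤ n) :
    t < nextPt n T t ∧ (nextPt n T t ∈ T ∨ nextPt n T t = n + 1) :=
  Nat.sInf_mem (s := {s : ℕ | t < s ∧ (s ∈ T ∨ s = n + 1)}) ⟨n + 1, by omega, Or.inr rfl⟩

lemma lt_nextPt (T : Finset ℕ) (ht : t ≤ n) : t < nextPt n T t := (nextPt_mem T ht).1

lemma nextPt_le (hst : t < s) (hs : s ∈ T ∨ s = n + 1) : nextPt n T t ≤ s :=
  Nat.sInf_le (s := {s : ℕ | t < s ∧ (s ∈ T ∨ s = n + 1)}) ⟨hst, hs⟩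

lemma nextPt_le_succ (T : Finset ℕ) (ht : t ≤ n) : nextPt n T t ≤ n + 1 :=
  nextPt_le (by omega) (Or.inr rfl)

lemma nextPt_eq {c : ℕ} (htc : t < c) (hc : c ∈ T ∨ c = n + 1) (hcn : c ≤ n + 1)
    (h : ∀ s ∈ T, t < s → c ≤ s) : nextPt n T t = c := by
  refine le_antisymm (nextPt_le htc hc) ?_
  obtain ⟨h1, h2 | h2⟩ := nextPt_mem T (show t ≤ n by omega)
  · exact h _ h2 h1
  · omega

lemma prevPt_insert_self (T : Finset ℕ) (t : ℕ) : prevPt (insert t T) t = prevPt T t := by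
  unfold prevPt
  congr 1
  ext s
  simp only [Set.mem_ofPred_eq, Finset.mem_insert]
  constructor
  · rintro ⟨h, rfl | rfl | h'⟩
    · exact ⟨h, Or.inl rfl⟩
    · omega
    · exact ⟨h, Or.inr h'⟩
  · rintro ⟨h, rfl | h'⟩
    · exact ⟨h, Or.inl rfl⟩
    · exact ⟨h, Or.inr (Or.inr h')⟩

lemma nextPt_insert_self (n : ℕ) (T : Finset ℕ) (t : ℕ) :
    nextPt n (insert t T) t = nextPt n T t := by
  unfold nextPt
  congr 1
  ext s
  simp only [Set.mem_ofPred_eq, Finset.mem_insert]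
  constructor
  · rintro ⟨h, (rfl | h') | rfl⟩
    · omega
    · exact ⟨h, Or.inl h'⟩
    · exact ⟨h, Or.inr rfl⟩
  · rintro ⟨h, h' | rfl⟩
    · exact ⟨h, Or.inl (Or.inr h')⟩
    · exact ⟨h, Or.inr rfl⟩

lemma prevPt_erase_self (ht : t ∈ T) : prevPt (T.erase t) t = prevPt T t := by
  rw [← prevPt_insert_self, Finset.insert_erase ht]

lemma nextPt_erase_self (ht : t ∈ T) : nextPt n (T.erase t) t = nextPt n T t := by
  rw [← nextPt_insert_self, Finset.insert_erase ht]

lemma prevPt_insert_nextPt (T : Finset ℕ) (h2 : 2 ≤ t) (hn : t ≤ n) :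
    prevPt (insert t T) (nextPt n T t) = t := by
  refine prevPt_eq (lt_nextPt T hn) (Or.inr (Finset.mem_insert_self _ _)) (by omega) ?_
  intro s hs hlt
  rcases Finset.mem_insert.1 hs with rfl | hs
  · exact le_rfl
  · by_contra! hts
    have := nextPt_le (n := n) hts (Or.inl hs)
    omega

lemma prevPt_nextPt (T : Finset ℕ) (h2 : 2 ≤ t) (hn : t ≤ n) (ht : t ∉ T) :
    prevPt T (nextPt n T t) = prevPt T t := by
  have h := prevPt_mem T h2
  have h1 := one_le_prevPt T h2
  have h3 := lt_nextPt T hn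
  refine prevPt_eq (by omega) h.2 h1 ?_
  intro s hs hlt
  refine le_prevPt ?_ (Or.inr hs)
  by_contra! hts
  have hne : t ≠ s := fun h => ht (h ▸ hs)
  have := nextPt_le (n := n) (lt_of_le_of_ne hts hne) (Or.inl hs)
  omega

/-- In the penalty sum only the terms at `t` and at its successor are affected by the insertion of
`t`. -/
lemma prevPt_insert_of_ne (hT : IsCPVector n T) (h2 : 2 ≤ t) (hn : t ≤ n)
    (hs : s ∈ insert (n + 1) T) (hst : s ≠ t) (hsc : s ≠ nextPt n T t) :
    prevPt (insert t T) s = prevPt T s := by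
  have hs2 : 2 ≤ s := by
    rcases Finset.mem_insert.1 hs with rfl | h
    · omega
    · exact hT.two_le h
  have h := prevPt_mem T hs2
  have h1 := one_le_prevPt T hs2
  refine prevPt_eq h.1 (h.2.imp_right (Finset.mem_insert_of_mem)) h1 ?_
  intro u hu hus
  rcases Finset.mem_insert.1 hu with rfl | hu
  · have h4 := nextPt_mem T hn
    have h5 : nextPt n T u ≤ s := by
      refine nextPt_le hus ?_
      rcases Finset.mem_insert.1 hs with h | h
      · exact Or.inr h
      · exact Or.inl h
    have h6 : nextPt n T u ≤ prevPt T s := by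
      refine le_prevPt (by omega) ?_
      rcases h4.2 with h7 | h7
      · exact Or.inr h7
      · exfalso
        rcases Finset.mem_insert.1 hs with h | h
        · omega
        · have := hT.le h
          omega
    omega
  · exact le_prevPt hus (Or.inr hu)

end Neighbours

/-! ### Contrasts and the effect of an insertion on the criterion -/

/-- The signed version of the energy: the normalized difference of the means of `v` on `[b, c)` and
on `[a, b)`. -/
noncomputable def contrast {n : ℕ} (v : EuclideanSpace ℝ (Fin n)) (a b c : ℕ) : ℝ :=
  (segMean v b c - segMean v a b)
    * Real.sqrt ((((b : ℝ) - a) * ((c : ℝ) - b)) / ((c : ℝ) - a))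

section Contrast

variable {n : ℕ}

lemma energy_eq_abs_contrast (v : EuclideanSpace ℝ (Fin n)) (a b c : ℕ) :
    energy v a b c = |contrast v a b c| := by
  rw [contrast, abs_mul, abs_of_nonneg (Real.sqrt_nonneg _), energy]

lemma coord_add (v w : EuclideanSpace ℝ (Fin n)) (i : ℕ) :
    coord (v + w) i = coord v i + coord w i := by
  unfold coord
  split_ifs <;> simp

lemma segMean_add (v w : EuclideanSpace ℝ (Fin n)) (a b : ℕ) :
    segMean (v + w) a b = segMean v a b + segMean w a b := by
  simp only [segMean, coord_add, Finset.sum_add_distrib, add_div]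

lemma contrast_add (v w : EuclideanSpace ℝ (Fin n)) (a b c : ℕ) :
    contrast (v + w) a b c = contrast v a b c + contrast w a b c := by
  simp only [contrast, segMean_add]
  ring

/-- The square of the threshold, without the square root. -/
noncomputable def sqThreshold (n : ℕ) (q : ℝ) (a b c : ℕ) : ℝ :=
  2 * Real.log (((n : ℝ) * ((c : ℝ) - a)) / (((c : ℝ) - b) * ((b : ℝ) - a))) + q

lemma one_le_threshold_arg {a b c : ℕ} (hab : a < b) (hbc : b < c)
    (ha : 1 ≤ a) (hc : c ≤ n + 1) :
    1 ≤ ((n : ℝ) * ((c : ℝ) - a)) / (((c : ℝ) - b) * ((b : ℝ) - a)) := by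
  have h1 : (a : ℝ) < b := by exact_mod_cast hab
  have h2 : (b : ℝ) < c := by exact_mod_cast hbc
  have h3 : (c : ℝ) - a ≤ n := by
    have : (1 : ℝ) ≤ a := by exact_mod_cast ha
    have : (c : ℝ) ≤ n + 1 := by exact_mod_cast hc
    linarith
  rw [le_div_iff₀ (mul_pos (by linarith) (by linarith)), one_mul]
  exact mul_le_mul (by linarith) (by linarith) (by linarith) (by linarith)

lemma le_sqThreshold (q : ℝ) {a b c : ℕ} (hab : a < b) (hbc : b < c)
    (ha : 1 ≤ a) (hc : c ≤ n + 1) : q ≤ sqThreshold n q a b c := by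
  have := Real.log_nonneg (one_le_threshold_arg hab hbc ha hc)
  unfold sqThreshold
  linarith

lemma threshold_sq {q : ℝ} (hq : 0 ≤ q) {a b c : ℕ} (hab : a < b) (hbc : b < c)
    (ha : 1 ≤ a) (hc : c ≤ n + 1) : threshold n q a b c ^ 2 = sqThreshold n q a b c :=
  Real.sq_sqrt (hq.trans (le_sqThreshold q hab hbc ha hc))

/-- The segment `[a, c)` is replaced by `[a, t)` and `[t, c)`; the three logarithms combine into the
one in the threshold, and `q` pays for the new entry. -/
lemma pen_insert (q : ℝ) {T : Finset ℕ} {t : ℕ} (hT : IsCPVector n T) (h2 : 2 ≤ t)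
    (hn : t ≤ n) (ht : t ∉ T) :
    pen n q (insert t T) = pen n q T + sqThreshold n q (prevPt T t) t (nextPt n T t) := by
  set a := prevPt T t with ha
  set c := nextPt n T t with hc
  have hat : a < t := prevPt_lt T h2
  have htc : t < c := lt_nextPt T hn
  have hcn : c ≤ n + 1 := nextPt_le_succ T hn
  have hcm : c ∈ insert (n + 1) T := by
    rcases (nextPt_mem T hn).2 with h | h
    · exact Finset.mem_insert_of_mem h
    · rw [hc, h]; exact Finset.mem_insert_self _ _
  have htm : t ∉ insert (n + 1) T := by
    simp only [Finset.mem_insert, not_or]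
    exact ⟨by omega, ht⟩
  have hsum : ∑ s ∈ insert (n + 1) (insert t T),
        Real.log ((n : ℝ) / ((s : ℝ) - (prevPt (insert t T) s : ℝ)))
      = Real.log (n / ((t : ℝ) - a)) + (Real.log (n / ((c : ℝ) - t))
        + ∑ s ∈ (insert (n + 1) T).erase c, Real.log ((n : ℝ) / ((s : ℝ) - (prevPt T s : ℝ)))) := by
    rw [Finset.insert_comm, Finset.sum_insert htm, prevPt_insert_self,
      ← Finset.add_sum_erase _ _ hcm, prevPt_insert_nextPt T h2 hn]
    congr 2
    refine Finset.sum_congr rfl fun s hs => ?_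
    rw [Finset.mem_erase] at hs
    rw [prevPt_insert_of_ne hT h2 hn hs.2 (fun h => htm (h ▸ hs.2)) hs.1]
  have hsum' : ∑ s ∈ insert (n + 1) T, Real.log ((n : ℝ) / ((s : ℝ) - (prevPt T s : ℝ)))
      = Real.log (n / ((c : ℝ) - a)) + ∑ s ∈ (insert (n + 1) T).erase c,
          Real.log ((n : ℝ) / ((s : ℝ) - (prevPt T s : ℝ))) := by
    rw [← Finset.add_sum_erase _ _ hcm, prevPt_nextPt T h2 hn ht]
  have h1 : (0 : ℝ) < (t : ℝ) - a := sub_pos.2 (by exact_mod_cast hat)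
  have h3 : (0 : ℝ) < (c : ℝ) - t := sub_pos.2 (by exact_mod_cast htc)
  have h4 : (0 : ℝ) < (c : ℝ) - a := by linarith
  have h5 : (0 : ℝ) < n := by exact_mod_cast (show 0 < n by omega)
  unfold pen sqThreshold
  rw [hsum, hsum', Finset.card_insert_of_notMem ht, Real.log_div h5.ne' h1.ne',
    Real.log_div h5.ne' h3.ne', Real.log_div h5.ne' h4.ne', Real.log_div (by positivity)
    (by positivity), Real.log_mul h5.ne' h4.ne', Real.log_mul h3.ne' h1.ne']
  push_cast
  ring

end Contrast

/-! ### Rank-one update of the projector, and local optimality of the minimizer. -/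

section Split

variable {n : ℕ}

lemma sum_Ico_coord (v : EuclideanSpace ℝ (Fin n)) {a b : ℕ} (ha : 1 ≤ a) (hb : b ≤ n + 1) :
    ∑ k ∈ Finset.Ico a b, coord v k
      = ∑ i : Fin n, if a ≤ (i : ℕ) + 1 ∧ (i : ℕ) + 1 < b then v i else 0 := by
  have h1 : ∀ i : Fin n, (if a ≤ (i : ℕ) + 1 ∧ (i : ℕ) + 1 < b then v i else 0)
      = (fun k : ℕ => if a ≤ k + 1 ∧ k + 1 < b then coord v (k + 1) else 0) i := by
    intro i
    have : coord v ((i : ℕ) + 1) = v i := by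
      unfold coord
      rw [dif_pos ⟨by omega, by omega⟩]
      simp
    simp only [this]
  rw [Finset.sum_congr rfl fun i _ => h1 i,
    Fin.sum_univ_eq_sum_range (fun k : ℕ => if a ≤ k + 1 ∧ k + 1 < b then coord v (k + 1) else 0) n,
    ← Finset.sum_filter]
  symm
  refine Finset.sum_bij (fun k _ => k + 1) ?_ ?_ ?_ ?_
  · intro k hk
    simp only [Finset.mem_filter] at hk
    exact Finset.mem_Ico.2 hk.2
  · intro k _ l _ h
    omega
  · intro k hk
    rw [Finset.mem_Ico] at hk
    refine ⟨k - 1, ?_, by omega⟩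
    simp only [Finset.mem_filter, Finset.mem_range]
    omega
  · intro k _
    rfl

/-- The unit vector that is orthogonal to the constants on `[a, c)` and constant on `[a, b)` and on
`[b, c)`. -/
noncomputable def splitVec (n a b c : ℕ) : EuclideanSpace ℝ (Fin n) :=
  WithLp.toLp 2 fun i =>
    Real.sqrt ((((b : ℝ) - a) * ((c : ℝ) - b)) / ((c : ℝ) - a)) *
      ((if b ≤ (i : ℕ) + 1 ∧ (i : ℕ) + 1 < c then ((c : ℝ) - b)⁻¹ else 0)
        - (if a ≤ (i : ℕ) + 1 ∧ (i : ℕ) + 1 < b then ((b : ℝ) - a)⁻¹ else 0))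

/-- Contrasts become linear forms with a unit coefficient vector; both the projector update and the
noise tails rest on this. -/
lemma inner_splitVec (v : EuclideanSpace ℝ (Fin n)) {a b c : ℕ} (ha : 1 ≤ a) (hab : a < b)
    (hbc : b < c) (hc : c ≤ n + 1) : inner ℝ (splitVec n a b c) v = contrast v a b c := by
  rw [contrast, segMean, segMean, sum_Ico_coord v (by omega) hc, sum_Ico_coord v ha (by omega),
    PiLp.inner_apply, div_eq_inv_mul, div_eq_inv_mul, Finset.mul_sum, Finset.mul_sum,
    ← Finset.sum_sub_distrib, Finset.sum_mul]
  refine Finset.sum_congr rfl fun i _ => ?_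
  simp only [splitVec, RCLike.inner_apply, conj_trivial]
  split_ifs <;> ring

lemma segMean_eq_of_forall (v : EuclideanSpace ℝ (Fin n)) {s t : ℕ} {x : ℝ} (hst : s < t)
    (h : ∀ k, s ≤ k → k < t → coord v k = x) : segMean v s t = x := by
  have h1 : (0 : ℝ) < (t : ℝ) - s := sub_pos.2 (by exact_mod_cast hst)
  rw [segMean, Finset.sum_congr rfl fun k hk => h k (Finset.mem_Ico.1 hk).1
    (Finset.mem_Ico.1 hk).2, Finset.sum_const, Nat.card_Ico, nsmul_eq_mul, Nat.cast_sub hst.le]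
  field_simp

lemma contrast_eq_zero (v : EuclideanSpace ℝ (Fin n)) {a b c : ℕ} {x : ℝ} (hab : a < b)
    (hbc : b < c) (h : ∀ k, a ≤ k → k < c → coord v k = x) : contrast v a b c = 0 := by
  rw [contrast, segMean_eq_of_forall v hab fun k h1 h2 => h k h1 (by omega),
    segMean_eq_of_forall v hbc fun k h1 h2 => h k (by omega) h2]
  simp

lemma coord_splitVec_left {a b c k : ℕ} (hak : a ≤ k) (hkb : k < b) (hk1 : 1 ≤ k) (hkn : k ≤ n) :
    coord (splitVec n a b c) k
      = - (Real.sqrt ((((b : ℝ) - a) * ((c : ℝ) - b)) / ((c : ℝ) - a)) * ((b : ℝ) - a)⁻¹) := by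
  unfold coord
  rw [dif_pos ⟨hk1, hkn⟩]
  simp only [splitVec]
  rw [if_neg (by omega), if_pos (by omega)]
  ring

lemma coord_splitVec_right {a b c k : ℕ} (hak : b ≤ k) (hkb : k < c) (hk1 : 1 ≤ k)
    (hkn : k ≤ n) : coord (splitVec n a b c) k
      = Real.sqrt ((((b : ℝ) - a) * ((c : ℝ) - b)) / ((c : ℝ) - a)) * ((c : ℝ) - b)⁻¹ := by
  unfold coord
  rw [dif_pos ⟨hk1, hkn⟩]
  simp only [splitVec]
  rw [if_pos (by omega), if_neg (by omega)]
  ring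

lemma norm_splitVec_sq {a b c : ℕ} (ha : 1 ≤ a) (hab : a < b) (hbc : b < c) (hc : c ≤ n + 1) :
    ‖splitVec n a b c‖ ^ 2 = 1 := by
  have h1 : (0 : ℝ) < (b : ℝ) - a := sub_pos.2 (by exact_mod_cast hab)
  have h2 : (0 : ℝ) < (c : ℝ) - b := sub_pos.2 (by exact_mod_cast hbc)
  have h3 : (0 : ℝ) < (c : ℝ) - a := by linarith
  rw [← real_inner_self_eq_norm_sq, inner_splitVec _ ha hab hbc hc, contrast, segMean, segMean,
    Finset.sum_congr rfl fun k hk => coord_splitVec_right (n := n) (a := a) (b := b) (c := c)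
      (by rw [Finset.mem_Ico] at hk; omega) (by rw [Finset.mem_Ico] at hk; omega)
      (by rw [Finset.mem_Ico] at hk; omega) (by rw [Finset.mem_Ico] at hk; omega),
    Finset.sum_congr rfl fun k hk => coord_splitVec_left (n := n) (a := a) (b := b) (c := c)
      (by rw [Finset.mem_Ico] at hk; omega) (by rw [Finset.mem_Ico] at hk; omega)
      (by rw [Finset.mem_Ico] at hk; omega) (by rw [Finset.mem_Ico] at hk; omega),
    Finset.sum_const, Finset.sum_const, Nat.card_Ico, Nat.card_Ico, nsmul_eq_mul, nsmul_eq_mul,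
    Nat.cast_sub hab.le, Nat.cast_sub hbc.le]
  set ρ := Real.sqrt ((((b : ℝ) - a) * ((c : ℝ) - b)) / ((c : ℝ) - a)) with hρ
  have h4 : ρ ^ 2 = (((b : ℝ) - a) * ((c : ℝ) - b)) / ((c : ℝ) - a) :=
    Real.sq_sqrt (by positivity)
  have h5 : (((c : ℝ) - b) * (ρ * ((c : ℝ) - b)⁻¹) / ((c : ℝ) - b)
      - ((b : ℝ) - a) * -(ρ * ((b : ℝ) - a)⁻¹) / ((b : ℝ) - a)) * ρ
      = ρ ^ 2 * (((c : ℝ) - b)⁻¹ + ((b : ℝ) - a)⁻¹) := by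
    field_simp
    ring
  rw [h5, h4]
  field_simp
  ring

variable {T : Finset ℕ} {t : ℕ}

lemma splitVec_mem (T : Finset ℕ) (h2 : 2 ≤ t) (hn : t ≤ n) :
    splitVec n (prevPt T t) t (nextPt n T t) ∈ piecewiseConst n (insert t T) := by
  intro i j hij
  have ha := prevPt_mem T h2
  have hc := nextPt_mem T hn
  have e1 := hij t (Finset.mem_insert_self _ _)
  have e2 : prevPt T t ≤ (i : ℕ) + 1 ↔ prevPt T t ≤ (j : ℕ) + 1 := by
    rcases ha.2 with h | h
    · omega
    · exact hij _ (Finset.mem_insert_of_mem h)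
  have e3 : nextPt n T t ≤ (i : ℕ) + 1 ↔ nextPt n T t ≤ (j : ℕ) + 1 := by
    rcases hc.2 with h | h
    · exact hij _ (Finset.mem_insert_of_mem h)
    · omega
  simp only [splitVec, e1, e2, ← not_le, e3]

lemma piecewiseConst_le (T : Finset ℕ) (t : ℕ) :
    piecewiseConst n T ≤ piecewiseConst n (insert t T) :=
  fun _ hv i j hij => hv i j fun s hs => hij s (Finset.mem_insert_of_mem hs)

lemma coord_eq_of_mem {v : EuclideanSpace ℝ (Fin n)} (hv : v ∈ piecewiseConst n T) {k l : ℕ}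
    (hk : 1 ≤ k) (hkn : k ≤ n) (hl : 1 ≤ l) (hln : l ≤ n) (h : ∀ s ∈ T, s ≤ k ↔ s ≤ l) :
    coord v k = coord v l := by
  unfold coord
  rw [dif_pos ⟨hk, hkn⟩, dif_pos ⟨hl, hln⟩]
  refine hv _ _ fun s hs => ?_
  have := h s hs
  simp only
  rwa [Nat.sub_add_cancel hk, Nat.sub_add_cancel hl]

lemma le_iff_of_prevPt_nextPt (ht : t ∉ T)
    {k l : ℕ} (hk : prevPt T t ≤ k) (hkc : k < nextPt n T t) (hl : prevPt T t ≤ l)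
    (hlc : l < nextPt n T t) : ∀ s ∈ T, s ≤ k ↔ s ≤ l := by
  intro s hs
  rcases lt_trichotomy s t with h | h | h
  · have := le_prevPt h (Or.inr hs)
    omega
  · exact absurd (h ▸ hs) ht
  · have := nextPt_le (n := n) h (Or.inl hs)
    omega

lemma inner_splitVec_eq_zero (h2 : 2 ≤ t) (hn : t ≤ n) (ht : t ∉ T)
    {w : EuclideanSpace ℝ (Fin n)} (hw : w ∈ piecewiseConst n T) :
    inner ℝ (splitVec n (prevPt T t) t (nextPt n T t)) w = 0 := by
  have h1 := one_le_prevPt T h2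
  have h3 := prevPt_lt T h2
  have h4 := lt_nextPt T hn
  have h5 := nextPt_le_succ T hn
  rw [inner_splitVec w h1 h3 h4 h5]
  exact contrast_eq_zero w (x := coord w t) h3 h4 fun k hk hkc =>
    coord_eq_of_mem hw (by omega) (by omega) (by omega) hn
      (le_iff_of_prevPt_nextPt ht hk hkc h3.le h4)

lemma coord_val_succ (v : EuclideanSpace ℝ (Fin n)) (i : Fin n) :
    coord v ((i : ℕ) + 1) = v i := by
  unfold coord
  rw [dif_pos ⟨by omega, by omega⟩]
  simp

/-- The enlarged space is the old one plus the line of `splitVec`: removing the right multiple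
cancels the jump at `t`. -/
lemma exists_sub_smul_splitVec_mem (h2 : 2 ≤ t) (hn : t ≤ n) (ht : t ∉ T)
    {w : EuclideanSpace ℝ (Fin n)} (hw : w ∈ piecewiseConst n (insert t T)) :
    ∃ μ : ℝ, w - μ • splitVec n (prevPt T t) t (nextPt n T t) ∈ piecewiseConst n T := by
  have ha := prevPt_mem T h2
  have hc := nextPt_mem T hn
  have ha1 := one_le_prevPt T h2
  have hcn := nextPt_le_succ T hn
  set a := prevPt T t with hadef
  set c := nextPt n T t with hcdef
  have h1 : (0 : ℝ) < (t : ℝ) - a := sub_pos.2 (by exact_mod_cast ha.1)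
  have h3 : (0 : ℝ) < (c : ℝ) - t := sub_pos.2 (by exact_mod_cast hc.1)
  set ρ := Real.sqrt ((((t : ℝ) - a) * ((c : ℝ) - t)) / ((c : ℝ) - a)) with hρ
  have hρ0 : 0 < ρ := Real.sqrt_pos.2 (div_pos (mul_pos h1 h3) (by linarith))
  have hden : 0 < ρ * ((c : ℝ) - t)⁻¹ + ρ * ((t : ℝ) - a)⁻¹ := by positivity
  -- The denominator is the jump of `splitVec` at `t`.
  set μ := (coord w t - coord w (t - 1)) / (ρ * ((c : ℝ) - t)⁻¹ + ρ * ((t : ℝ) - a)⁻¹) with hμ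
  have hμ' : μ * (ρ * ((c : ℝ) - t)⁻¹) + μ * (ρ * ((t : ℝ) - a)⁻¹)
      = coord w t - coord w (t - 1) := by
    rw [← mul_add, hμ, div_mul_cancel₀ _ hden.ne']
  have hin : ∀ i : Fin n, a ≤ (i : ℕ) + 1 → (i : ℕ) + 1 < c →
      w i - μ * splitVec n a t c i = coord w t - μ * (ρ * ((c : ℝ) - t)⁻¹) := by
    intro i hi1 hi2
    rw [← coord_val_succ w i, ← coord_val_succ (splitVec n a t c) i]
    by_cases hit : (i : ℕ) + 1 < t
    · rw [coord_splitVec_left hi1 hit (by omega) (by omega),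
        coord_eq_of_mem hw (k := (i : ℕ) + 1) (l := t - 1) (by omega) (by omega) (by omega)
          (by omega)]
      · linarith
      · intro s hs
        rcases Finset.mem_insert.1 hs with rfl | hs
        · omega
        · exact le_iff_of_prevPt_nextPt ht hi1 hi2 (by omega) (by omega) s hs
    · rw [coord_splitVec_right (by omega) hi2 (by omega) (by omega),
        coord_eq_of_mem hw (k := (i : ℕ) + 1) (l := t) (by omega) (by omega) (by omega)
          (by omega)]
      intro s hs
      rcases Finset.mem_insert.1 hs with rfl | hs
      · omega
      · exact le_iff_of_prevPt_nextPt ht hi1 hi2 (by omega) (by omega) s hs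
  refine ⟨μ, fun i j hij => ?_⟩
  have e2 : a ≤ (i : ℕ) + 1 ↔ a ≤ (j : ℕ) + 1 := by
    rcases ha.2 with h | h
    · omega
    · exact hij _ h
  have e3 : c ≤ (i : ℕ) + 1 ↔ c ≤ (j : ℕ) + 1 := by
    rcases hc.2 with h | h
    · exact hij _ h
    · omega
  simp only [PiLp.sub_apply, PiLp.smul_apply, smul_eq_mul]
  by_cases hi : a ≤ (i : ℕ) + 1 ∧ (i : ℕ) + 1 < c
  · rw [hin i hi.1 hi.2, hin j (e2.1 hi.1) (by omega)]
  · have hz : ∀ k : Fin n, ¬ (a ≤ (k : ℕ) + 1 ∧ (k : ℕ) + 1 < c) → splitVec n a t c k = 0 := by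
      intro k hk
      simp only [splitVec]
      rw [if_neg (by omega), if_neg (by omega)]
      simp
    rw [hz i hi, hz j (by omega)]
    have : w i = w j := by
      refine hw i j fun s hs => ?_
      rcases Finset.mem_insert.1 hs with rfl | hs
      · omega
      · exact hij s hs
    rw [this]

lemma starProjection_insert (Y : EuclideanSpace ℝ (Fin n)) (h2 : 2 ≤ t)
    (hn : t ≤ n) (ht : t ∉ T) :
    (piecewiseConst n (insert t T)).starProjection Y
      = (piecewiseConst n T).starProjection Y + contrast Y (prevPt T t) t (nextPt n T t) •
          splitVec n (prevPt T t) t (nextPt n T t) := by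
  have h1 := one_le_prevPt T h2
  have h3 := prevPt_lt T h2
  have h4 := lt_nextPt T hn
  have h5 := nextPt_le_succ T hn
  set v := splitVec n (prevPt T t) t (nextPt n T t) with hv
  have hvY : inner ℝ v Y = contrast Y (prevPt T t) t (nextPt n T t) :=
    inner_splitVec Y h1 h3 h4 h5
  have hvv : inner ℝ v v = 1 := by
    rw [real_inner_self_eq_norm_sq, norm_splitVec_sq h1 h3 h4 h5]
  symm
  refine (Submodule.eq_starProjection_of_mem_of_inner_eq_zero ?_ ?_).symm
  · exact Submodule.add_mem _
      (piecewiseConst_le T t (Submodule.starProjection_apply_mem _ _))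
      (Submodule.smul_mem _ _ (splitVec_mem T h2 hn))
  · intro w hw
    obtain ⟨μ, hμ⟩ := exists_sub_smul_splitVec_mem h2 hn ht hw
    rw [← hv] at hμ
    have hw' : w = (w - μ • v) + μ • v := by abel
    have e1 : inner ℝ (Y - (piecewiseConst n T).starProjection Y) (w - μ • v) = 0 :=
      Submodule.starProjection_inner_eq_zero _ _ hμ
    have e2 : inner ℝ v (w - μ • v) = 0 := inner_splitVec_eq_zero h2 hn ht hμ
    have e3 : inner ℝ v ((piecewiseConst n T).starProjection Y) = 0 :=
      inner_splitVec_eq_zero h2 hn ht (Submodule.starProjection_apply_mem _ _)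
    rw [hw', inner_add_right, inner_smul_right, ← sub_sub, inner_sub_left, e1, inner_smul_left, e2,
      inner_sub_left, inner_sub_left, inner_smul_left, hvv, real_inner_comm, hvY,
      real_inner_comm, e3]
    simp

lemma norm_sub_starProjection_insert (Y : EuclideanSpace ℝ (Fin n)) (h2 : 2 ≤ t) (hn : t ≤ n) (ht : t ∉ T) :
    ‖Y - (piecewiseConst n (insert t T)).starProjection Y‖ ^ 2
      = ‖Y - (piecewiseConst n T).starProjection Y‖ ^ 2
        - contrast Y (prevPt T t) t (nextPt n T t) ^ 2 := by
  have h1 := one_le_prevPt T h2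
  have h3 := prevPt_lt T h2
  have h4 := lt_nextPt T hn
  have h5 := nextPt_le_succ T hn
  have e3 : inner ℝ (splitVec n (prevPt T t) t (nextPt n T t))
      ((piecewiseConst n T).starProjection Y) = 0 :=
    inner_splitVec_eq_zero h2 hn ht (Submodule.starProjection_apply_mem _ _)
  rw [starProjection_insert Y h2 hn ht, ← sub_sub, norm_sub_sq_real, inner_smul_right,
    real_inner_comm, inner_sub_right, e3, inner_splitVec Y h1 h3 h4 h5, norm_smul, mul_pow,
    norm_splitVec_sq h1 h3 h4 h5, Real.norm_eq_abs, sq_abs]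
  ring

lemma crit_insert (L q : ℝ) (Y : EuclideanSpace ℝ (Fin n)) (hT : IsCPVector n T) (h2 : 2 ≤ t)
    (hn : t ≤ n) (ht : t ∉ T) :
    crit L q Y (insert t T) = crit L q Y T - contrast Y (prevPt T t) t (nextPt n T t) ^ 2
      + L * sqThreshold n q (prevPt T t) t (nextPt n T t) := by
  unfold crit
  rw [norm_sub_starProjection_insert Y h2 hn ht, pen_insert q hT h2 hn ht]
  ring

variable {L q : ℝ} {Y : EuclideanSpace ℝ (Fin n)}

lemma IsPLSE.contrast_sq_le (h : IsPLSE L q Y T) (h2 : 2 ≤ t) (hn : t ≤ n) (ht : t ∉ T) :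
    contrast Y (prevPt T t) t (nextPt n T t) ^ 2
      ≤ L * sqThreshold n q (prevPt T t) t (nextPt n T t) := by
  have h1 := h.2 _ (h.1.insert h2 hn)
  rw [crit_insert L q Y h.1 h2 hn ht] at h1
  linarith

/-- Compare `T` with `T.erase t`; erasing `t` does not move its neighbours, so `crit_insert` applies
backwards. -/
lemma IsPLSE.le_contrast_sq (h : IsPLSE L q Y T) (ht : t ∈ T) :
    L * sqThreshold n q (prevPt T t) t (nextPt n T t)
      ≤ contrast Y (prevPt T t) t (nextPt n T t) ^ 2 := by
  have h1 := h.2 _ (h.1.erase t)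
  have h3 := crit_insert L q Y (h.1.erase t) (h.1.two_le ht) (h.1.le ht)
    (Finset.notMem_erase t T)
  rw [Finset.insert_erase ht, prevPt_erase_self ht, nextPt_erase_self ht] at h3
  linarith

end Split

/-! ### Real inequalities: three adjacent segments, and the detection radius. -/

section RealInequalities

/-- All thresholds are compared with the single level q + 2 log(n/h) of the short segment. The
second threshold blows up when `e` is tiny, which is why it is weighted by w = e/(d+e): w log(1/w) ≤
1. -/
lemma sq_threshold_bounds {q n h d e : ℝ} (hq : 1 ≤ q) (hh : 0 < h) (hhd : h ≤ d) (he : 0 < e)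
    (hn : h + d + e ≤ n) :
    1 ≤ q + 2 * Real.log (n / h) ∧
    2 * Real.log (n * (h + d) / (h * d)) + q ≤ (q + 2 * Real.log (n / h)) * (1 + 2 * (h / d)) ∧
    e / (d + e) * (2 * Real.log (n * (d + e) / (d * e)) + q) ≤ 3 * (q + 2 * Real.log (n / h)) ∧
    q + 2 * Real.log (n / h) ≤ 2 * Real.log (n * (h + d + e) / (h * (d + e))) + q := by
  have hd : 0 < d := by linarith
  have hn0 : 0 < n := by linarith
  have hζ0 : 0 < h / d := div_pos hh hd
  have hT1 : 0 ≤ Real.log (n / h) := Real.log_nonneg (by rw [le_div_iff₀ hh]; linarith)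
  refine ⟨by linarith, ?_, ?_, ?_⟩
  · have : n * (h + d) / (h * d) = n / h * (1 + h / d) := by
      field_simp; ring
    rw [this, Real.log_mul (by positivity) (by positivity)]
    have h2 : Real.log (1 + h / d) ≤ h / d := by
      have := Real.log_le_sub_one_of_pos (show 0 < 1 + h / d by linarith)
      linarith
    nlinarith
  · set w := e / (d + e) with hw
    have hw0 : 0 < w := by positivity
    have hw1 : w ≤ 1 := by rw [hw, div_le_one (by linarith)]; linarith
    have : n * (d + e) / (d * e) = n / d * w⁻¹ := by
      rw [hw]; field_simp
    rw [this, Real.log_mul (by positivity) (by positivity)]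
    have h2 : Real.log w⁻¹ ≤ w⁻¹ - 1 := Real.log_le_sub_one_of_pos (by positivity)
    have h3 : Real.log (n / d) ≤ Real.log (n / h) := by gcongr
    have h4 : 0 ≤ Real.log (n / d) := Real.log_nonneg (by rw [le_div_iff₀ hd]; linarith)
    have h5 : w * Real.log w⁻¹ ≤ 1 := by
      calc w * Real.log w⁻¹ ≤ w * (w⁻¹ - 1) := by gcongr
        _ = 1 - w := by field_simp
        _ ≤ 1 := by linarith
    nlinarith
  · have : Real.log (n / h) ≤ Real.log (n * (h + d + e) / (h * (d + e))) := by
      apply Real.log_le_log (by positivity)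
      rw [div_le_div_iff₀ hh (by positivity)]
      have : 0 ≤ n * h * h := by positivity
      nlinarith
    linarith

/-- With the far mean written as a weighted average, its difference to `m₁` is (m₂ - m₁) + e/(d+e)
(m₃ - m₂). Multiplied by √h, the first term is at most about B√T, and the second is small because
h/d ≤ σ². -/
lemma sq_contrast_lt_of_short {B s σ t₁ t₂ T h d e m₁ m₂ m₃ : ℝ} (hB : 0 ≤ B) (hs : 0 ≤ s)
    (hσ : 0 ≤ σ) (hh : 0 < h) (hd : 0 < d) (he : 0 < e) (hT : 0 < T) (hζσ : h / d ≤ σ ^ 2)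
    (hBs : B * (1 + 2 * σ ^ 2) + 2 * s * σ < s)
    (H1 : (m₂ - m₁) ^ 2 * (h * d / (h + d)) ≤ B ^ 2 * t₁)
    (H2 : (m₃ - m₂) ^ 2 * (d * e / (d + e)) ≤ s ^ 2 * t₂)
    (ht₁ : t₁ ≤ T * (1 + 2 * (h / d))) (ht₂ : e / (d + e) * t₂ ≤ 3 * T) :
    ((d * m₂ + e * m₃) / (d + e) - m₁) ^ 2 * (h * (d + e) / (h + d + e)) < s ^ 2 * T := by
  have hζ0 : 0 < h / d := div_pos hh hd
  have hτ0 : 0 < √T := Real.sqrt_pos.2 hT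
  have hτT : √T ^ 2 = T := Real.sq_sqrt hT.le
  have hrh : √h ^ 2 = h := Real.sq_sqrt hh.le
  have u1 : |(m₂ - m₁) * √h| ≤ B * (1 + 2 * (h / d)) * √T := by
    apply abs_le_of_sq_le_sq _ (by positivity)
    have e1 : ((m₂ - m₁) * √h) ^ 2 = (m₂ - m₁) ^ 2 * (h * d / (h + d)) * (1 + h / d) := by
      rw [mul_pow, hrh]; field_simp; ring
    rw [e1, mul_pow, hτT]
    calc _ ≤ B ^ 2 * (T * (1 + 2 * (h / d))) * (1 + h / d) := by
            refine mul_le_mul_of_nonneg_right (H1.trans ?_) (by linarith)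
            exact mul_le_mul_of_nonneg_left ht₁ (sq_nonneg B)
      _ ≤ B ^ 2 * (T * (1 + 2 * (h / d))) * (1 + 2 * (h / d)) :=
          mul_le_mul_of_nonneg_left (by linarith) (by positivity)
      _ = _ := by ring
  have u2 : |e / (d + e) * (m₃ - m₂) * √h| ≤ 2 * s * σ * √T := by
    apply abs_le_of_sq_le_sq _ (by positivity)
    have e1 : (e / (d + e) * (m₃ - m₂) * √h) ^ 2
        = (m₃ - m₂) ^ 2 * (d * e / (d + e)) * (e / (d + e) * (h / d)) := by
      rw [mul_pow, hrh]; field_simp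
    rw [e1, mul_pow, hτT]
    calc _ ≤ s ^ 2 * t₂ * (e / (d + e) * (h / d)) :=
          mul_le_mul_of_nonneg_right H2 (by positivity)
      _ = s ^ 2 * (h / d) * (e / (d + e) * t₂) := by ring
      _ ≤ s ^ 2 * (h / d) * (3 * T) := mul_le_mul_of_nonneg_left ht₂ (by positivity)
      _ ≤ s ^ 2 * σ ^ 2 * (3 * T) := by
          have := mul_le_mul_of_nonneg_left hζσ (sq_nonneg s)
          exact mul_le_mul_of_nonneg_right this (by linarith)
      _ ≤ (2 * s * σ) ^ 2 * T := by
          have : 0 ≤ s ^ 2 * σ ^ 2 * T := by positivity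
          linarith
  have u3 : ((d * m₂ + e * m₃) / (d + e) - m₁) ^ 2 * (h * (d + e) / (h + d + e))
      ≤ ((m₂ - m₁) * √h + e / (d + e) * (m₃ - m₂) * √h) ^ 2 := by
    have e1 : (d * m₂ + e * m₃) / (d + e) - m₁ = (m₂ - m₁) + e / (d + e) * (m₃ - m₂) := by
      field_simp; ring
    rw [e1, ← add_mul, mul_pow _ (√h), hrh]
    refine mul_le_mul_of_nonneg_left ?_ (sq_nonneg _)
    rw [div_le_iff₀ (by linarith)]
    nlinarith
  have u4 : |(m₂ - m₁) * √h + e / (d + e) * (m₃ - m₂) * √h| < s * √T := by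
    refine (abs_add_le _ _).trans_lt ((add_le_add u1 u2).trans_lt ?_)
    rw [← add_mul]
    refine mul_lt_mul_of_pos_right (lt_of_le_of_lt ?_ hBs) hτ0
    have := mul_le_mul_of_nonneg_left hζσ hB
    linarith
  refine u3.trans_lt ?_
  rw [← sq_abs, show s ^ 2 * T = (s * √T) ^ 2 by rw [mul_pow, hτT]]
  exact pow_lt_pow_left₀ u4 (abs_nonneg _) two_ne_zero

/-- Three adjacent segments of lengths `h`, `d`, `e` with means `m₁`, `m₂`, `m₃`, the first one being
much shorter than the second one: the contrast between the first segment and the union of the other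
two cannot be large if the contrasts between neighbouring segments are small. -/
lemma not_le_contrast_of_short {L q n h d e m₁ m₂ m₃ : ℝ} (hL : 1 < L) (hq : 1 ≤ q) (hh : 0 < h)
    (hd : 0 < d) (he : 0 < e) (hn : h + d + e ≤ n)
    (hσ : h ≤ ((√L - 1) / (5 * √L)) ^ 2 * d)
    (H1 : (m₂ - m₁) ^ 2 * (h * d / (h + d))
      ≤ (1.1 * √L + 0.9 - √L) ^ 2 * (2 * Real.log (n * (h + d) / (h * d)) + q))
    (H2 : (m₃ - m₂) ^ 2 * (d * e / (d + e)) ≤ L * (2 * Real.log (n * (d + e) / (d * e)) + q)) :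
    ((d * m₂ + e * m₃) / (d + e) - m₁) ^ 2 * (h * (d + e) / (h + d + e))
      < L * (2 * Real.log (n * (h + d + e) / (h * (d + e))) + q) := by
  have hs1 : 1 < √L := Real.lt_sqrt_of_sq_lt (by simpa using hL)
  have hsL : √L ^ 2 = L := Real.sq_sqrt (by linarith)
  generalize √L = s at *
  obtain ⟨σ, hσdef⟩ : ∃ σ, σ = (s - 1) / (5 * s) := ⟨_, rfl⟩
  rw [← hσdef] at hσ
  have hσ0 : 0 < σ := hσdef ▸ div_pos (by linarith) (by linarith)
  have hσ5 : σ ≤ 1 / 5 := by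
    rw [hσdef, div_le_div_iff₀ (by linarith) (by norm_num)]; linarith
  have hσs : s * σ = (s - 1) / 5 := by
    rw [hσdef]; field_simp
  have hζσ : h / d ≤ σ ^ 2 := by rwa [div_le_iff₀ hd]
  have hσ1 : σ ^ 2 ≤ 1 := by nlinarith
  have hhd : h ≤ d := hσ.trans (mul_le_of_le_one_left hd.le hσ1)
  obtain ⟨hT1, t1, t2, t3⟩ := sq_threshold_bounds hq hh hhd he hn
  rw [← hsL] at H2 ⊢
  refine (sq_contrast_lt_of_short (by linarith) (by linarith) hσ0.le hh hd he (by linarith) hζσ ?_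
    H1 H2 t1 t2).trans_le (mul_le_mul_of_nonneg_left t3 (sq_nonneg s))
  -- With B = 0.1s + 0.9 the room is s - B = 0.9(s - 1); the corrections are 2sσ = 0.4(s - 1) and
  -- 2Bσ² ≤ 0.08(s - 1).
  have : (1.1 * s + 0.9 - s) * σ ^ 2 ≤ s * σ * (1 / 5) := by
    rw [sq, ← mul_assoc]
    gcongr
    linarith
  linarith

/-- High energy forces D·uv/(u+v) ≥ 1, and uv/(u+v) ≤ n, so nD ≥ 1 and the logarithm in the radius
is nonnegative. -/
lemma detection_radius_pos {κ q n D u v : ℝ} (hκ : 1 ≤ κ) (hq : 1 ≤ q) (hu : 0 < u) (hv : 0 < v)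
    (hn : u + v ≤ n) (hD : 0 < D)
    (hE : κ ^ 2 * (2 * Real.log (n * (u + v) / (v * u)) + q) < D * (u * v / (u + v))) :
    0 ≤ Real.log (n * D)
      ∧ 0 < min (v / 2) (min (u / 2) (κ * ((Real.log (n * D) + q) / D))) := by
  have h1 : 0 ≤ Real.log (n * (u + v) / (v * u)) := by
    apply Real.log_nonneg
    rw [le_div_iff₀ (by positivity), one_mul]
    nlinarith
  have h2 : 1 ≤ κ ^ 2 * (2 * Real.log (n * (u + v) / (v * u)) + q) := by nlinarith
  have h3 : u * v / (u + v) ≤ n := by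
    rw [div_le_iff₀ (by linarith)]
    nlinarith
  have h4 : 1 ≤ n * D := by
    have : D * (u * v / (u + v)) ≤ D * n := by gcongr
    linarith
  have h5 := Real.log_nonneg h4
  refine ⟨h5, ?_⟩
  refine lt_min (by linarith) (lt_min (by linarith) ?_)
  have : 0 < Real.log (n * D) + q := by linarith
  positivity

/-- This lower bound on Dρ is what contradicts minimality in `IsPLSE.detec`. If ρ is half a side, it
follows from high energy, since uv/(u+v) ≤ 2ρ. Otherwise Dρ equals 64L(log(nD) + q) ≥ 1, whence n/ρ
≤ nD. -/
lemma detection_radius_bound {L q n D u v ρ : ℝ} (hL : 1 < L) (hq : 3 ≤ q) (hu : 0 < u)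
    (hv : 0 < v) (hn : u + v ≤ n) (hD : 0 < D)
    (hE : (64 * L) ^ 2 * (2 * Real.log (n * (u + v) / (v * u)) + q) < D * (u * v / (u + v)))
    (hρ : ρ = min (v / 2) (min (u / 2) (64 * L * ((Real.log (n * D) + q) / D)))) :
    64 * L * (q + Real.log (n / ρ)) ≤ D * ρ := by
  obtain ⟨h5, hpos⟩ := detection_radius_pos (by linarith) (by linarith) hu hv hn hD hE
  rw [← hρ] at hpos
  have hn0 : 0 < n := by linarith
  have hcase : ρ = v / 2 ∨ ρ = u / 2 ∨ ρ = 64 * L * ((Real.log (n * D) + q) / D) := by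
    rw [hρ]
    rcases min_choice (v / 2) (min (u / 2) (64 * L * ((Real.log (n * D) + q) / D))) with h | h
    · exact Or.inl h
    · rw [h]
      exact Or.inr (min_choice _ _)
  have key : ∀ x : ℝ, 0 < x → x ≤ n → ρ = x / 2 → u * v / (u + v) ≤ x →
      64 * L * (q + Real.log (n / ρ)) ≤ D * ρ := by
    intro x hx hxn hρx hm
    have e1 : Real.log (n / ρ) = Real.log (n / x) + Real.log 2 := by
      rw [← Real.log_mul (by positivity) (by norm_num), hρx]
      congr 1; field_simp
    have e2 : Real.log (n / x) ≤ Real.log (n * (u + v) / (v * u)) := by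
      apply Real.log_le_log (by positivity)
      rw [div_le_iff₀ (by positivity)] at hm
      rw [div_le_div_iff₀ hx (by positivity)]
      nlinarith
    have e3 : 0 ≤ Real.log (n / x) := Real.log_nonneg (by rwa [le_div_iff₀ hx, one_mul])
    have e4 : Real.log 2 ≤ 1 := by
      have := Real.log_le_sub_one_of_pos (show (0 : ℝ) < 2 by norm_num)
      linarith
    have e5 : D * (u * v / (u + v)) ≤ D * (2 * ρ) := by
      rw [hρx]; gcongr; linarith
    have e6 : q + Real.log (n / ρ) ≤ 2 * (2 * Real.log (n * (u + v) / (v * u)) + q) := by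
      rw [e1]; linarith
    have e7 : 0 ≤ 2 * Real.log (n * (u + v) / (v * u)) + q := by linarith
    nlinarith [mul_le_mul_of_nonneg_left e6 (show 0 ≤ 64 * L by linarith),
      mul_nonneg (show 0 ≤ 64 * L * (64 * L - 4) by nlinarith) e7]
  rcases hcase with h | h | h
  · refine key v hv (by linarith) h ?_
    rw [div_le_iff₀ (by linarith)]; nlinarith
  · refine key u hu (by linarith) h ?_
    rw [div_le_iff₀ (by linarith)]; nlinarith
  · have e1 : D * ρ = 64 * L * (Real.log (n * D) + q) := by
      rw [h]; field_simp
    have e2 : Real.log (n / ρ) ≤ Real.log (n * D) := by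
      apply Real.log_le_log (by positivity)
      rw [div_le_iff₀ hpos, mul_assoc, e1]
      exact le_mul_of_one_le_right hn0.le (by nlinarith)
    rw [e1]
    exact mul_le_mul_of_nonneg_left (by linarith) (by linarith)

end RealInequalities

/-! ### The noise event, and selected points near an end of a constant segment. -/

section Deterministic

variable {n : ℕ} {L q : ℝ} {θ e : EuclideanSpace ℝ (Fin n)} {T : Finset ℕ}

/-- All the contrasts of the vector `e` are within a factor `√M` of the threshold. -/
def ContrastsBounded (M q : ℝ) {n : ℕ} (e : EuclideanSpace ℝ (Fin n)) : Prop :=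
  ∀ a b c : ℕ, 1 ≤ a → a < b → b < c → c ≤ n + 1 →
    contrast e a b c ^ 2 ≤ M * sqThreshold n q a b c

lemma coord_eq_of_forall_notMem_trueCP {a c : ℕ} (ha : 1 ≤ a) (hc : c ≤ n + 1)
    (h : ∀ j, a < j → j < c → j ∉ trueCP θ) : ∀ k, a ≤ k → k < c → coord θ k = coord θ a := by
  intro k hk
  induction k, hk using Nat.le_induction with
  | base => intro _; rfl
  | succ k hak ih =>
    intro hkc
    rw [← ih (by omega)]
    by_contra hne
    refine h (k + 1) (by omega) hkc ?_
    simp only [trueCP, Finset.mem_filter, Finset.mem_Icc, Nat.add_sub_cancel]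
    exact ⟨by omega, fun h => hne h.symm⟩

lemma isCPVector_trueCP (θ : EuclideanSpace ℝ (Fin n)) : IsCPVector n (trueCP θ) :=
  Finset.filter_subset _ _

lemma contrast_sq (v : EuclideanSpace ℝ (Fin n)) {a b c : ℕ} (hab : a < b) (hbc : b < c) :
    contrast v a b c ^ 2 = (segMean v b c - segMean v a b) ^ 2
      * ((((b : ℝ) - a) * ((c : ℝ) - b)) / ((c : ℝ) - a)) := by
  have h1 : (0 : ℝ) < (b : ℝ) - a := sub_pos.2 (by exact_mod_cast hab)
  have h2 : (0 : ℝ) < (c : ℝ) - b := sub_pos.2 (by exact_mod_cast hbc)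
  have h3 : (0 : ℝ) < (c : ℝ) - a := by linarith
  rw [contrast, mul_pow, Real.sq_sqrt (by positivity)]

lemma segMean_split (v : EuclideanSpace ℝ (Fin n)) {a b c : ℕ} (hab : a < b) (hbc : b < c) :
    segMean v a c = (((b : ℝ) - a) * segMean v a b + ((c : ℝ) - b) * segMean v b c)
      / ((c : ℝ) - a) := by
  have h1 : (0 : ℝ) < (b : ℝ) - a := sub_pos.2 (by exact_mod_cast hab)
  have h2 : (0 : ℝ) < (c : ℝ) - b := sub_pos.2 (by exact_mod_cast hbc)
  rw [segMean, segMean, segMean, mul_div_cancel₀ _ h1.ne', mul_div_cancel₀ _ h2.ne',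
    Finset.sum_Ico_consecutive _ hab.le hbc.le]

/-- An estimated change-point and its two estimated neighbours cannot lie in the closure of a
segment on which the signal is constant. -/
lemma IsPLSE.exists_trueCP_between {M : ℝ} (h : IsPLSE L q (θ + e) T) (hM : M < L) (hq : 0 < q)
    (he : ContrastsBounded M q e) {y : ℕ} (hy : y ∈ T) :
    ∃ j ∈ trueCP θ, prevPt T y < j ∧ j < nextPt n T y := by
  by_contra! hcon
  have h2 := h.1.two_le hy
  have hn := h.1.le hy
  have h1 := one_le_prevPt T h2
  have h3 := prevPt_lt T h2
  have h4 := lt_nextPt T hn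
  have h5 := nextPt_le_succ T hn
  have hθ : contrast θ (prevPt T y) y (nextPt n T y) = 0 :=
    contrast_eq_zero θ h3 h4 (coord_eq_of_forall_notMem_trueCP h1 h5 fun j hj1 hj2 hj =>
      absurd (hcon j hj hj1) (by omega))
  have h6 := h.le_contrast_sq hy
  rw [contrast_add, hθ, zero_add] at h6
  have h7 := he _ _ _ h1 h3 h4 h5
  have h8 := le_sqThreshold q h3 h4 h1 h5
  nlinarith

/-- The localization constant near the ends of a segment. -/
noncomputable def endRatio (L : ℝ) : ℝ := ((√L - 1) / (5 * √L)) ^ 2 / 2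

lemma endRatio_pos (hL : 1 < L) : 0 < endRatio L := by
  have hs1 : 1 < √L := Real.lt_sqrt_of_sq_lt (by simpa using hL)
  have : 0 < √L - 1 := by linarith
  unfold endRatio
  positivity

lemma endRatio_le (hL : 1 < L) : endRatio L ≤ 1 / 2 := by
  have hs1 : 1 < √L := Real.lt_sqrt_of_sq_lt (by simpa using hL)
  have h1 : 0 ≤ (√L - 1) / (5 * √L) := div_nonneg (by linarith) (by linarith)
  have h2 : (√L - 1) / (5 * √L) ≤ 1 := by
    rw [div_le_one (by linarith)]; linarith
  unfold endRatio
  nlinarith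

lemma le_of_le_endRatio_mul {h d D : ℝ} (hL : 1 < L) (hD : 0 ≤ D)
    (h1 : h ≤ endRatio L * D) (h2 : (1 - endRatio L) * D ≤ d) :
    h ≤ ((√L - 1) / (5 * √L)) ^ 2 * d := by
  have h3 := endRatio_le hL
  have h4 := endRatio_pos hL
  have h5 : ((√L - 1) / (5 * √L)) ^ 2 = 2 * endRatio L := by unfold endRatio; ring
  rw [h5]
  nlinarith [mul_nonneg h4.le (sub_nonneg.2 h2), mul_nonneg (mul_nonneg h4.le hD)
    (show 0 ≤ 1 - 2 * endRatio L by linarith)]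

/-- Apply `not_le_contrast_of_short` to `[x, y)`, `[y, s')`, `[s', z)`, with `z` the successor of
`y`. The first contrast is pure noise, the second is bounded because `s'` is not selected, and the
conclusion contradicts the selection of `y`. -/
lemma IsPLSE.not_both_near_left (h : IsPLSE L q (θ + e) T) (hL : 1 < L) (hq : 1 ≤ q)
    (he : ContrastsBounded ((1.1 * √L + 0.9 - √L) ^ 2) q e) {s s' x y : ℕ}
    (hs : s ∈ insert 1 (trueCP θ)) (hs' : s' = nextPt n (trueCP θ) s) (hy : y ∈ T)
    (hx : prevPt T y = x) (hsx : s ≤ x) (hys' : y < s')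
    (hyη : (y : ℝ) ≤ s + endRatio L * ((s' : ℝ) - s)) (hz : s' < nextPt n T y) : False := by
  have hy2 := h.1.two_le hy
  have hyn := h.1.le hy
  have h3 := prevPt_lt T hy2
  have h4 := lt_nextPt T hyn
  have h5 := nextPt_le_succ T hyn
  have h1x := one_le_prevPt T hy2
  set z := nextPt n T y with hzdef
  rw [hx] at h3 h1x
  have hs1 : 1 ≤ s := by
    rcases Finset.mem_insert.1 hs with rfl | hs
    · exact le_rfl
    · exact (by norm_num : 1 ≤ 2).trans ((isCPVector_trueCP θ).two_le hs)
  have hs'T : s' ∉ T := fun hmem => by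
    have := nextPt_le (n := n) hys' (Or.inl hmem)
    omega
  have hprev : prevPt T s' = y := by
    refine prevPt_eq hys' (Or.inr hy) (by omega) fun u hu hus => ?_
    by_contra! hyu
    have := nextPt_le (n := n) hyu (Or.inl hu)
    omega
  have hnext : nextPt n T s' = z := by
    refine nextPt_eq hz ((nextPt_mem T hyn).2) h5 fun u hu hsu => ?_
    exact nextPt_le (by omega) (Or.inl hu)
  have hc : contrast θ x y s' = 0 :=
    contrast_eq_zero θ h3 hys' (coord_eq_of_forall_notMem_trueCP h1x (by omega)
      fun j hj1 hj2 hj => by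
        have := nextPt_le (n := n) (t := s) (by omega) (Or.inl hj)
        omega)
  have k1 := he x y s' h1x h3 hys' (by omega)
  have k1' : contrast e x y s' = contrast (θ + e) x y s' := by rw [contrast_add, hc, zero_add]
  have k2 := h.contrast_sq_le (t := s') (by omega) (by omega) hs'T
  have k3 := h.le_contrast_sq hy
  rw [hprev, hnext] at k2
  rw [hx] at k3
  rw [k1'] at k1
  rw [contrast_sq _ (by assumption) (by assumption)] at k1 k2 k3
  unfold sqThreshold at k1 k2 k3
  rw [segMean_split (θ + e) hys' hz] at k3
  have c1 : (x : ℝ) < y := by exact_mod_cast h3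
  have c2 : (y : ℝ) < s' := by exact_mod_cast hys'
  have c3 : (s' : ℝ) < z := by exact_mod_cast hz
  have c4 : (z : ℝ) ≤ n + 1 := by exact_mod_cast h5
  have c5 : (1 : ℝ) ≤ x := by exact_mod_cast h1x
  have c6 : (s : ℝ) ≤ x := by exact_mod_cast hsx
  have b1 : ((y : ℝ) - x) + ((s' : ℝ) - y) + ((z : ℝ) - s') = z - x := by ring
  have b2 : ((s' : ℝ) - y) + ((z : ℝ) - s') = z - y := by ring
  have b3 : ((y : ℝ) - x) + ((s' : ℝ) - y) = s' - x := by ring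
  have key := not_le_contrast_of_short (L := L) (q := q) (n := n) (h := (y : ℝ) - x)
    (d := (s' : ℝ) - y) (e := (z : ℝ) - s') (m₁ := segMean (θ + e) x y)
    (m₂ := segMean (θ + e) y s') (m₃ := segMean (θ + e) s' z) hL hq (by linarith) (by linarith)
    (by linarith) (by linarith)
    (le_of_le_endRatio_mul (D := (s' : ℝ) - s) hL (by linarith) (by linarith) (by linarith))
    (by rw [b3]; simpa only [mul_comm] using k1) (by rw [b2]; simpa only [mul_comm] using k2)
  rw [b1, b2, mul_comm ((y : ℝ) - x) (z - y)] at key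
  rw [← hzdef, mul_comm ((y : ℝ) - x) (z - y)] at k3
  exact absurd k3 (not_le.2 key)

/-- Mirror image of `IsPLSE.not_both_near_left`, with segments `[x, y)`, `[s, x)`, `[w, s)`: the
short one is now on the right. -/
lemma IsPLSE.not_both_near_right (h : IsPLSE L q (θ + e) T) (hL : 1 < L) (hq : 1 ≤ q)
    (he : ContrastsBounded ((1.1 * √L + 0.9 - √L) ^ 2) q e) {s s' x y : ℕ}
    (hs1 : 1 ≤ s) (hs' : s' = nextPt n (trueCP θ) s) (hx : x ∈ T)
    (hy : nextPt n T x = y) (hys' : y ≤ s') (hsx : s < x)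
    (hxη : (s' : ℝ) - endRatio L * ((s' : ℝ) - s) ≤ x) (hz : prevPt T x < s) : False := by
  have hx2 := h.1.two_le hx
  have hxn := h.1.le hx
  have h3 := prevPt_lt T hx2
  have h4 := lt_nextPt T hxn
  have h5 := nextPt_le_succ T hxn
  have h1w := one_le_prevPt T hx2
  set w := prevPt T x with hwdef
  rw [hy] at h4 h5
  have hsT : s ∉ T := fun hmem => by
    have := le_prevPt hsx (Or.inr hmem)
    omega
  have hprev : prevPt T s = w := by
    refine prevPt_eq hz ((prevPt_mem T hx2).2) h1w fun u hu hus => ?_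
    exact le_prevPt (by omega) (Or.inr hu)
  have hnext : nextPt n T s = x := by
    refine nextPt_eq hsx (Or.inl hx) (by omega) fun u hu hsu => ?_
    by_contra! hux
    have := le_prevPt hux (Or.inr hu)
    omega
  have hc : contrast θ s x y = 0 :=
    contrast_eq_zero θ hsx h4 (coord_eq_of_forall_notMem_trueCP hs1 (by omega)
      fun j hj1 hj2 hj => by
        have := nextPt_le (n := n) (t := s) (by omega) (Or.inl hj)
        omega)
  have k1 := he s x y hs1 hsx h4 (by omega)
  have k1' : contrast e s x y = contrast (θ + e) s x y := by rw [contrast_add, hc, zero_add]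
  have k2 := h.contrast_sq_le (t := s) (by omega) (by omega) hsT
  have k3 := h.le_contrast_sq hx
  rw [hprev, hnext] at k2
  rw [hy] at k3
  rw [k1'] at k1
  rw [contrast_sq _ (by assumption) (by assumption)] at k1 k2 k3
  unfold sqThreshold at k1 k2 k3
  rw [segMean_split (θ + e) hz hsx] at k3
  have c1 : (w : ℝ) < s := by exact_mod_cast hz
  have c2 : (s : ℝ) < x := by exact_mod_cast hsx
  have c3 : (x : ℝ) < y := by exact_mod_cast h4
  have c4 : (y : ℝ) ≤ n + 1 := by exact_mod_cast h5
  have c5 : (1 : ℝ) ≤ w := by exact_mod_cast h1w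
  have c6 : (y : ℝ) ≤ s' := by exact_mod_cast hys'
  have b1 : ((y : ℝ) - x) + ((x : ℝ) - s) + ((s : ℝ) - w) = y - w := by ring
  have b2 : ((x : ℝ) - s) + ((s : ℝ) - w) = x - w := by ring
  have b3 : ((y : ℝ) - x) + ((x : ℝ) - s) = y - s := by ring
  rw [sub_sq_comm] at k1 k2
  rw [← hwdef, sub_sq_comm, add_comm (((s : ℝ) - w) * _), mul_comm ((x : ℝ) - w)] at k3
  have key := not_le_contrast_of_short (L := L) (q := q) (n := n) (h := (y : ℝ) - x)
    (d := (x : ℝ) - s) (e := (s : ℝ) - w) (m₁ := segMean (θ + e) x y)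
    (m₂ := segMean (θ + e) s x) (m₃ := segMean (θ + e) w s) hL hq (by linarith) (by linarith)
    (by linarith) (by linarith)
    (le_of_le_endRatio_mul (D := (s' : ℝ) - s) hL (by linarith) (by linarith) (by linarith))
    (by rw [b3]; simpa only [mul_comm] using k1) (by rw [b2]; simpa only [mul_comm] using k2)
  rw [b1, b2] at key
  exact absurd k3 (not_le.2 key)

end Deterministic

/-! ### Parts (a) and (c) on the noise event. -/

section FewChangePoints

variable {n : ℕ} {L q : ℝ} {θ e : EuclideanSpace ℝ (Fin n)} {T : Finset ℕ}

lemma finite_entriesIn (T : Finset ℕ) (I : Set ℝ) : (entriesIn T I).Finite :=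
  T.finite_toSet.subset fun _ h => h.1

lemma exists_lt_lt_of_two_lt_ncard {S : Set ℕ} (hS : S.Finite) (h : 2 < S.ncard) :
    ∃ x ∈ S, ∃ y ∈ S, ∃ z ∈ S, x < y ∧ y < z := by
  obtain ⟨a, b, c, ha, hb, hc, hab, hac, hbc⟩ := (Set.two_lt_ncard_iff hS).1 h
  rcases lt_or_gt_of_ne hab with h1 | h1 <;> rcases lt_or_gt_of_ne hac with h2 | h2 <;>
    rcases lt_or_gt_of_ne hbc with h3 | h3
  · exact ⟨a, ha, b, hb, c, hc, h1, h3⟩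
  · exact ⟨a, ha, c, hc, b, hb, h2, h3⟩
  · omega
  · exact ⟨c, hc, a, ha, b, hb, h2, h1⟩
  · exact ⟨b, hb, a, ha, c, hc, h1, h2⟩
  · omega
  · exact ⟨b, hb, c, hc, a, ha, h3, h2⟩
  · exact ⟨c, hc, b, hb, a, ha, h3, h1⟩

lemma exists_lt_of_one_lt_ncard {S : Set ℕ} (hS : S.Finite) (h : 1 < S.ncard) :
    ∃ x ∈ S, ∃ y ∈ S, x < y := by
  obtain ⟨a, b, ha, hb, hab⟩ := (Set.one_lt_ncard_iff hS).1 h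
  rcases lt_or_gt_of_ne hab with h1 | h1
  · exact ⟨a, ha, b, hb, h1⟩
  · exact ⟨b, hb, a, ha, h1⟩

lemma IsPLSE.fewChangePoints (h : IsPLSE L q (θ + e) T) (hn : 1 ≤ n) (hL : 1 < L) (hq : 1 ≤ q)
    (he : ContrastsBounded ((1.1 * √L + 0.9 - √L) ^ 2) q e) :
    FewChangePoints θ (endRatio L) T := by
  intro s hs s' hs'
  have hs1 : 1 ≤ s ∧ s ≤ n := by
    rcases Finset.mem_insert.1 hs with rfl | hs
    · exact ⟨le_rfl, hn⟩
    · have h1 := (isCPVector_trueCP θ).two_le hs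
      exact ⟨by omega, (isCPVector_trueCP θ).le hs⟩
  have hss' : s < s' := hs' ▸ lt_nextPt _ hs1.2
  have hη0 := endRatio_pos hL
  have hη1 := endRatio_le hL
  have hD : (1 : ℝ) ≤ (s' : ℝ) - s := by
    have : (s : ℝ) + 1 ≤ s' := by exact_mod_cast hss'
    linarith
  have hηD : endRatio L * ((s' : ℝ) - s) < (s' : ℝ) - s := by nlinarith
  have hM : (1.1 * √L + 0.9 - √L) ^ 2 < L := by
    have h1 : 1 < √L := Real.lt_sqrt_of_sq_lt (by simpa using hL)
    have h2 : √L ^ 2 = L := Real.sq_sqrt (by linarith)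
    nlinarith
  -- No true change-point lies strictly between `s` and `s'`, so no selected point can have both
  -- neighbours in `[s, s']`. This kills the middle one of three selected points; for two points
  -- near one end it forces the other neighbour to lie beyond the opposite end.
  have hout : ∀ y ∈ T, s ≤ prevPt T y → nextPt n T y ≤ s' → False := by
    intro y hy h1 h2
    obtain ⟨j, hj, hj1, hj2⟩ := h.exists_trueCP_between hM (by linarith) he hy
    have := nextPt_le (n := n) (t := s) (by omega) (Or.inl hj)
    omega
  refine ⟨?_, ?_, ?_⟩
  · by_contra! hcon
    obtain ⟨x, hx, y, hy, z, hz, hxy, hyz⟩ :=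
      exists_lt_lt_of_two_lt_ncard (finite_entriesIn _ _) hcon
    have h1 : s ≤ x := by exact_mod_cast hx.2.1
    have h2 : z < s' := by exact_mod_cast hz.2.2
    have h3 := le_prevPt hxy (Or.inr hx.1)
    have h4 := nextPt_le (n := n) hyz (Or.inl hz.1)
    exact hout y hy.1 (by omega) (by omega)
  · by_contra! hcon
    obtain ⟨x, hx, y, hy, hxy⟩ := exists_lt_of_one_lt_ncard (finite_entriesIn _ _) hcon
    have h1 : s ≤ x := by exact_mod_cast hx.2.1
    have h2 : y < s' := by
      have := hy.2.2
      have : (y : ℝ) < s' := by linarith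
      exact_mod_cast this
    have h3 := le_prevPt hxy (Or.inr hx.1)
    have h4 : s' < nextPt n T y := by
      by_contra! h4
      exact hout y hy.1 (by omega) h4
    exact h.not_both_near_left hL hq he hs hs' hy.1 rfl (by omega) h2 hy.2.2 h4
  · by_contra! hcon
    obtain ⟨x, hx, y, hy, hxy⟩ := exists_lt_of_one_lt_ncard (finite_entriesIn _ _) hcon
    have h1 : y ≤ s' := by exact_mod_cast hy.2.2
    have h2 : s < x := by
      have := hx.2.1
      have : (s : ℝ) < x := by linarith
      exact_mod_cast this
    have h3 := nextPt_le (n := n) hxy (Or.inl hy.1)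
    have h4 : prevPt T x < s := by
      by_contra! h4
      exact hout x hx.1 h4 (by omega)
    exact h.not_both_near_right hL hq he hs1.1 hs' hx.1 rfl (by omega) h2 hx.2.1 h4

lemma threshold_nonneg (n : ℕ) (q : ℝ) (a b c : ℕ) : 0 ≤ threshold n q a b c :=
  Real.sqrt_nonneg _

lemma ContrastsBounded.abs_le {B : ℝ} (he : ContrastsBounded (B ^ 2) q e) (hB : 0 ≤ B)
    (hq : 0 ≤ q) {a b c : ℕ} (ha : 1 ≤ a) (hab : a < b) (hbc : b < c) (hc : c ≤ n + 1) :
    |contrast e a b c| ≤ B * threshold n q a b c := by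
  apply abs_le_of_sq_le_sq _ (mul_nonneg hB (threshold_nonneg _ _ _ _ _))
  rw [mul_pow, threshold_sq hq hab hbc ha hc]
  exact he a b c ha hab hbc hc

/-- Triangle inequality: the contrast of `Y` is at most √L thresholds by minimality and that of the
noise at most 0.1√L + 0.9 thresholds. -/
lemma IsPLSE.unselectedLowEnergy (h : IsPLSE L q (θ + e) T) (hL : 1 < L) (hq : 0 ≤ q)
    (he : ContrastsBounded ((1.1 * √L + 0.9 - √L) ^ 2) q e) :
    UnselectedLowEnergy θ (1.1 * √L + 0.9) q T := by
  intro t ht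
  by_contra! hcon
  obtain ⟨htT, -, hE⟩ := hcon
  rw [prevPt_insert_self, nextPt_insert_self, energy_eq_abs_contrast] at hE
  have h2 := (isCPVector_trueCP θ).two_le ht
  have hn := (isCPVector_trueCP θ).le ht
  have h1 := one_le_prevPt T h2
  have h3 := prevPt_lt T h2
  have h4 := lt_nextPt T hn
  have h5 := nextPt_le_succ T hn
  have hs1 : 1 < √L := Real.lt_sqrt_of_sq_lt (by simpa using hL)
  have k1 := he.abs_le (by linarith) hq h1 h3 h4 h5
  have k2 : |contrast (θ + e) (prevPt T t) t (nextPt n T t)|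
      ≤ √L * threshold n q (prevPt T t) t (nextPt n T t) := by
    apply abs_le_of_sq_le_sq _ (mul_nonneg (Real.sqrt_nonneg _) (threshold_nonneg _ _ _ _ _))
    rw [mul_pow, threshold_sq hq h3 h4 h1 h5, Real.sq_sqrt (by linarith)]
    exact h.contrast_sq_le h2 hn htT
  have k3 : |contrast θ (prevPt T t) t (nextPt n T t)|
      ≤ |contrast (θ + e) (prevPt T t) t (nextPt n T t)|
        + |contrast e (prevPt T t) t (nextPt n T t)| := by
    rw [contrast_add]
    have := abs_sub (contrast θ (prevPt T t) t (nextPt n T t)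
      + contrast e (prevPt T t) t (nextPt n T t)) (contrast e (prevPt T t) t (nextPt n T t))
    rwa [add_sub_cancel_right] at this
  linarith

end FewChangePoints

/-! ### Part (b): detection and localization. -/

section Detection

variable {n : ℕ} {L q : ℝ} {θ e Y : EuclideanSpace ℝ (Fin n)} {T : Finset ℕ} {t m : ℕ}

/-- The two hypotheses say, without division, that both gaps are at least m/2; the argument of the
logarithm is n/(b-a) + n/(c-b). -/
lemma sqThreshold_le (q : ℝ) (hn : 1 ≤ n) {a b c : ℕ} (hab : a < b) (hbc : b < c) (hm : 1 ≤ m)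
    (h1 : 2 * a + m ≤ 2 * b) (h2 : 2 * b + m ≤ 2 * c) :
    sqThreshold n q a b c ≤ q + 2 * Real.log (4 * n / m) := by
  have e1 : (0 : ℝ) < (b : ℝ) - a := sub_pos.2 (by exact_mod_cast hab)
  have e2 : (0 : ℝ) < (c : ℝ) - b := sub_pos.2 (by exact_mod_cast hbc)
  have e3 : (0 : ℝ) < (c : ℝ) - a := by linarith
  have e4 : (m : ℝ) ≤ 2 * ((b : ℝ) - a) := by
    have : (2 * a + m : ℝ) ≤ 2 * b := by exact_mod_cast h1
    linarith
  have e5 : (m : ℝ) ≤ 2 * ((c : ℝ) - b) := by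
    have : (2 * b + m : ℝ) ≤ 2 * c := by exact_mod_cast h2
    linarith
  have e6 : (0 : ℝ) < m := by exact_mod_cast hm
  have e7 : (0 : ℝ) < n := by exact_mod_cast hn
  have : Real.log (((n : ℝ) * ((c : ℝ) - a)) / (((c : ℝ) - b) * ((b : ℝ) - a)))
      ≤ Real.log (4 * n / m) := by
    apply Real.log_le_log (by positivity)
    have : ((n : ℝ) * ((c : ℝ) - a)) / (((c : ℝ) - b) * ((b : ℝ) - a))
        = n / ((b : ℝ) - a) + n / ((c : ℝ) - b) := by
      field_simp; ring
    rw [this]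
    calc (n : ℝ) / ((b : ℝ) - a) + n / ((c : ℝ) - b) ≤ n / (m / 2) + n / (m / 2) := by
          gcongr <;> linarith
      _ = 4 * n / m := by field_simp; ring
  unfold sqThreshold
  linarith

lemma le_add_of_sqThreshold (L q : ℝ) (hL : 0 ≤ L) (Y : EuclideanSpace ℝ (Fin n))
    (hT : IsCPVector n T) {x : ℕ} (h2 : 2 ≤ x) (hn : x ≤ n) (hx : x ∉ T) (hm : 1 ≤ m)
    (h3 : 2 * prevPt T x + m ≤ 2 * x) (h4 : 2 * x + m ≤ 2 * nextPt n T x) :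
    crit L q Y (insert x T) + contrast Y (prevPt T x) x (nextPt n T x) ^ 2
      ≤ crit L q Y T + L * (q + 2 * Real.log (4 * n / m)) := by
  rw [crit_insert L q Y hT h2 hn hx]
  have := mul_le_mul_of_nonneg_left
    (sqThreshold_le (n := n) q (by omega) (prevPt_lt T h2) (lt_nextPt T hn) hm h3 h4) hL
  linarith

/-- Shields `t` on the left: afterwards its predecessor lies in the stretch starting at `p` where
the signal will be constant, yet at distance at least m/2. One insertion suffices, and its gain in
residual sum of squares is discarded. -/
lemma exists_insert_left (q : ℝ) (hL : 0 ≤ L) (hQ : 0 ≤ q + 2 * Real.log (4 * n / m))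
    (Y : EuclideanSpace ℝ (Fin n)) (hT : IsCPVector n T) (ht : t ∉ T) (h2 : 2 ≤ t) (hn : t ≤ n)
    (hm : 1 ≤ m) {p : ℕ} (hprev : prevPt T t + m ≤ t) (hnext : 2 * t + m ≤ 2 * nextPt n T t)
    (hp : p + m ≤ t) :
    ∃ T', IsCPVector n T' ∧ t ∉ T' ∧ nextPt n T' t = nextPt n T t ∧ p ≤ prevPt T' t ∧
      2 * prevPt T' t + m ≤ 2 * t ∧
      crit L q Y T' ≤ crit L q Y T + L * (q + 2 * Real.log (4 * n / m)) := by
  by_cases hap : p ≤ prevPt T t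
  · refine ⟨T, hT, ht, rfl, hap, by omega, ?_⟩
    have := mul_nonneg hL hQ
    linarith
  · push Not at hap
    have ha := prevPt_mem T h2
    have ha1 := one_le_prevPt T h2
    have hc := nextPt_mem T hn
    -- Distance ⌈m/2⌉ from `t`. The old predecessor is below `p ≤ t - m`, so it too is at distance
    -- at least m/2 from `x`.
    obtain ⟨x, hx⟩ : ∃ x, x = t - (m + 1) / 2 := ⟨_, rfl⟩
    have hxT : x ∉ T := fun hmem => by
      have := le_prevPt (show x < t by omega) (Or.inr hmem)
      omega
    have e1 : prevPt T x = prevPt T t := by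
      refine prevPt_eq (by omega) ha.2 ha1 fun s hs hsx => ?_
      exact le_prevPt (by omega) (Or.inr hs)
    have e2 : nextPt n T x = nextPt n T t := by
      refine nextPt_eq (by omega) hc.2 (nextPt_le_succ T hn) fun s hs hxs => ?_
      rcases lt_trichotomy s t with h | h | h
      · have := le_prevPt h (Or.inr hs)
        omega
      · exact absurd (h ▸ hs) ht
      · exact nextPt_le h (Or.inl hs)
    have e3 : prevPt (insert x T) t = x := by
      refine prevPt_eq (by omega) (Or.inr (Finset.mem_insert_self _ _)) (by omega)
        fun s hs hst => ?_
      rcases Finset.mem_insert.1 hs with rfl | hs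
      · exact le_rfl
      · have := le_prevPt hst (Or.inr hs)
        omega
    have e4 : nextPt n (insert x T) t = nextPt n T t := by
      refine nextPt_eq hc.1 (hc.2.imp_left Finset.mem_insert_of_mem) (nextPt_le_succ T hn)
        fun s hs hts => ?_
      rcases Finset.mem_insert.1 hs with rfl | hs
      · omega
      · exact nextPt_le hts (Or.inl hs)
    have key := le_add_of_sqThreshold L q hL Y hT (x := x) (m := m) (by omega) (by omega) hxT hm
      (by omega) (by omega)
    refine ⟨insert x T, hT.insert (by omega) (by omega), ?_, e4, by omega, by omega, ?_⟩
    · rw [Finset.mem_insert, not_or]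
      exact ⟨by omega, ht⟩
    · have := sq_nonneg (contrast Y (prevPt T x) x (nextPt n T x))
      linarith

/-- Mirror image of `exists_insert_left`. -/
lemma exists_insert_right (q : ℝ) (hL : 0 ≤ L) (hQ : 0 ≤ q + 2 * Real.log (4 * n / m))
    (Y : EuclideanSpace ℝ (Fin n)) (hT : IsCPVector n T) (ht : t ∉ T) (h2 : 2 ≤ t) (hn : t ≤ n)
    (hm : 1 ≤ m) {r : ℕ} (hprev : 2 * prevPt T t + m ≤ 2 * t) (hnext : t + m ≤ nextPt n T t)
    (hr : t + m ≤ r) :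
    ∃ T', IsCPVector n T' ∧ t ∉ T' ∧ prevPt T' t = prevPt T t ∧ nextPt n T' t ≤ r ∧
      2 * t + m ≤ 2 * nextPt n T' t ∧
      crit L q Y T' ≤ crit L q Y T + L * (q + 2 * Real.log (4 * n / m)) := by
  by_cases hap : nextPt n T t ≤ r
  · refine ⟨T, hT, ht, rfl, hap, by omega, ?_⟩
    have := mul_nonneg hL hQ
    linarith
  · push Not at hap
    have ha := prevPt_mem T h2
    have ha1 := one_le_prevPt T h2
    have hc := nextPt_mem T hn
    have hcn := nextPt_le_succ T hn
    obtain ⟨x, hx⟩ : ∃ x, x = t + (m + 1) / 2 := ⟨_, rfl⟩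
    have hxT : x ∉ T := fun hmem => by
      have := nextPt_le (n := n) (show t < x by omega) (Or.inl hmem)
      omega
    have e1 : prevPt T x = prevPt T t := by
      refine prevPt_eq (by omega) ha.2 ha1 fun s hs hsx => ?_
      rcases lt_trichotomy s t with h | h | h
      · exact le_prevPt h (Or.inr hs)
      · exact absurd (h ▸ hs) ht
      · have := nextPt_le (n := n) h (Or.inl hs)
        omega
    have e2 : nextPt n T x = nextPt n T t := by
      refine nextPt_eq (by omega) hc.2 hcn fun s hs hxs => ?_
      exact nextPt_le (by omega) (Or.inl hs)
    have e3 : prevPt (insert x T) t = prevPt T t := by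
      refine prevPt_eq ha.1 (ha.2.imp_right Finset.mem_insert_of_mem) ha1 fun s hs hst => ?_
      rcases Finset.mem_insert.1 hs with rfl | hs
      · omega
      · exact le_prevPt hst (Or.inr hs)
    have e4 : nextPt n (insert x T) t = x := by
      refine nextPt_eq (by omega) (Or.inl (Finset.mem_insert_self _ _)) (by omega)
        fun s hs hts => ?_
      rcases Finset.mem_insert.1 hs with rfl | hs
      · exact le_rfl
      · have := nextPt_le (n := n) hts (Or.inl hs)
        omega
    have key := le_add_of_sqThreshold L q hL Y hT (x := x) (m := m) (by omega) (by omega) hxT hm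
      (by omega) (by omega)
    refine ⟨insert x T, hT.insert (by omega) (by omega), ?_, e3, by omega, by omega, ?_⟩
    · rw [Finset.mem_insert, not_or]
      exact ⟨by omega, ht⟩
    · have := sq_nonneg (contrast Y (prevPt T x) x (nextPt n T x))
      linarith

/-- If the signal has a jump at `t`, is constant at distance `m` on both sides of `t`, and no
estimated change-point is at distance less than `m`, then the jump is small. -/
lemma IsPLSE.jump_sq_mul_le (h : IsPLSE L q (θ + e) T) (hL : 1 ≤ L) (hq : 0 ≤ q)
    (he : ContrastsBounded L q e) (ht : t ∉ T) (h2 : 2 ≤ t) (hn : t ≤ n) (hm : 1 ≤ m) {p r : ℕ}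
    (hp1 : 1 ≤ p) (hrn : r ≤ n + 1)
    (hp : p + m ≤ t) (hr : t + m ≤ r) (hprev : prevPt T t + m ≤ t) (hnext : t + m ≤ nextPt n T t)
    (hθl : ∀ j, p < j → j < t → j ∉ trueCP θ) (hθr : ∀ j, t < j → j < r → j ∉ trueCP θ) :
    height θ t ^ 2 * m ≤ 32 * L * (q + 2 * Real.log (4 * n / m)) := by
  have hm0 : (0 : ℝ) < m := by exact_mod_cast hm
  have hQ : 0 ≤ q + 2 * Real.log (4 * n / m) := by
    have : 0 ≤ Real.log (4 * n / m) := by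
      apply Real.log_nonneg
      rw [le_div_iff₀ hm0, one_mul]
      have : m ≤ n := by omega
      have : (m : ℝ) ≤ n := by exact_mod_cast this
      linarith
    linarith
  have hL0 : 0 ≤ L := by linarith
  obtain ⟨T₁, hT₁, ht₁, hn₁, hp₁, hg₁, hc₁⟩ :=
    exists_insert_left q hL0 hQ (θ + e) h.1 ht h2 hn hm hprev (by omega) hp
  obtain ⟨T₂, hT₂, ht₂, hn₂, hr₂, hg₂, hc₂⟩ :=
    exists_insert_right q hL0 hQ (θ + e) hT₁ ht₁ h2 hn hm hg₁ (by omega) hr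
  have hc₃ := le_add_of_sqThreshold L q hL0 (θ + e) hT₂ h2 hn ht₂ hm (by omega) hg₂
  have hmin := h.2 _ (hT₂.insert h2 hn)
  obtain ⟨a, ha⟩ : ∃ a, a = prevPt T₂ t := ⟨_, rfl⟩
  obtain ⟨c, hc⟩ : ∃ c, c = nextPt n T₂ t := ⟨_, rfl⟩
  have hca := he a t c (by omega) (by omega) (by omega) (by omega)
  have hthr := sqThreshold_le (m := m) (n := n) q (by omega) (a := a) (b := t) (c := c) (by omega)
    (by omega) hm (by omega) (by omega)
  rw [← ha, ← hc] at hc₃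
  -- At most three insertions are made, each costing at most LQ with Q = q + 2 log(4n/m); only the
  -- gain of the last one is kept.
  have k1 : contrast (θ + e) a t c ^ 2 ≤ 3 * (L * (q + 2 * Real.log (4 * n / m))) := by linarith
  have k2 : contrast e a t c ^ 2 ≤ L * (q + 2 * Real.log (4 * n / m)) :=
    hca.trans (mul_le_mul_of_nonneg_left hthr hL0)
  have k3 : contrast θ a t c ^ 2 ≤ 8 * (L * (q + 2 * Real.log (4 * n / m))) := by
    have e1 : contrast θ a t c = contrast (θ + e) a t c - contrast e a t c := by
      rw [contrast_add]; ring
    rw [e1]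
    -- (x - y)² ≤ 2x² + 2y² gives 2(3 + 1) = 8.
    nlinarith [sq_nonneg (contrast (θ + e) a t c + contrast e a t c)]
  have hat : a < t := by omega
  have htc : t < c := by omega
  have e1 : (0 : ℝ) < (t : ℝ) - a := sub_pos.2 (by exact_mod_cast hat)
  have e2 : (0 : ℝ) < (c : ℝ) - t := sub_pos.2 (by exact_mod_cast htc)
  have e4 : (m : ℝ) ≤ 2 * ((t : ℝ) - a) := by
    have h1 : 2 * a + m ≤ 2 * t := by omega
    have : (2 * a + m : ℝ) ≤ 2 * t := by exact_mod_cast h1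
    linarith
  have e5 : (m : ℝ) ≤ 2 * ((c : ℝ) - t) := by
    have h1 : 2 * t + m ≤ 2 * c := by omega
    have : (2 * t + m : ℝ) ≤ 2 * c := by exact_mod_cast h1
    linarith
  have m1 : segMean θ t c = coord θ t :=
    segMean_eq_of_forall θ htc (coord_eq_of_forall_notMem_trueCP (by omega) (by omega)
      fun j hj1 hj2 => hθr j hj1 (by omega))
  have hl := coord_eq_of_forall_notMem_trueCP (θ := θ) (a := a) (c := t) (by omega) (by omega)
      fun j hj1 hj2 => hθl j (by omega) hj2
  have m2 : segMean θ a t = coord θ (t - 1) :=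
    segMean_eq_of_forall θ hat fun k hk1 hk2 => (hl k hk1 hk2).trans (hl (t - 1) (by omega) (by omega)).symm
  rw [contrast_sq θ hat htc, m1, m2] at k3
  -- Both gaps are at least m/2, so their product over their sum is at least m/4; with the 8 above
  -- this gives the constant 32.
  have k4 : (m : ℝ) / 4 ≤ ((t : ℝ) - a) * ((c : ℝ) - t) / ((c : ℝ) - a) := by
    rw [le_div_iff₀ (by linarith)]
    nlinarith
  have k5 := mul_le_mul_of_nonneg_left k4 (sq_nonneg (coord θ t - coord θ (t - 1)))
  unfold height
  linarith

/-- By contradiction: if every selected point is farther than ρ from `t`, then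
`IsPLSE.jump_sq_mul_le` with m = ⌊ρ⌋ + 1 gives an upper bound on the jump that
`detection_radius_bound` violates. -/
lemma IsPLSE.detec (h : IsPLSE L q (θ + e) T) (hL : 1 < L) (hq : 3 ≤ q)
    (he : ContrastsBounded L q e) : Detec θ (64 * L) q (64 * L) T := by
  intro t ht hE
  replace hE := hE.2
  have hcp := isCPVector_trueCP θ
  have h2 := hcp.two_le ht
  have hn := hcp.le ht
  have hp1 := one_le_prevPt (trueCP θ) h2
  have hpt := prevPt_lt (trueCP θ) h2
  have htr := lt_nextPt (trueCP θ) hn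
  have hrn := nextPt_le_succ (trueCP θ) hn
  have hθl : ∀ j, prevPt (trueCP θ) t < j → j < t → j ∉ trueCP θ := fun j hj1 hj2 hj => by
    have := le_prevPt hj2 (Or.inr hj)
    omega
  have hθr : ∀ j, t < j → j < nextPt n (trueCP θ) t → j ∉ trueCP θ := fun j hj1 hj2 hj => by
    have := nextPt_le (n := n) hj1 (Or.inl hj)
    omega
  generalize prevPt (trueCP θ) t = p at *
  generalize nextPt n (trueCP θ) t = r at *
  have hD : 0 < height θ t ^ 2 := by
    have h1 := (Finset.mem_filter.1 ht).2
    have : height θ t ≠ 0 := sub_ne_zero.2 h1.symm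
    positivity
  have u0 : (0 : ℝ) < (t : ℝ) - p := sub_pos.2 (by exact_mod_cast hpt)
  have v0 : (0 : ℝ) < (r : ℝ) - t := sub_pos.2 (by exact_mod_cast htr)
  have huv : ((t : ℝ) - p) + ((r : ℝ) - t) ≤ n := by
    have h1 : (r : ℝ) ≤ n + 1 := by exact_mod_cast hrn
    have h2 : (1 : ℝ) ≤ p := by exact_mod_cast hp1
    linarith
  have hE' : (64 * L) ^ 2 * (2 * Real.log (n * (((t : ℝ) - p) + ((r : ℝ) - t))
        / (((r : ℝ) - t) * ((t : ℝ) - p))) + q)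
      < height θ t ^ 2 * (((t : ℝ) - p) * ((r : ℝ) - t) / (((t : ℝ) - p) + ((r : ℝ) - t))) := by
    rw [show ((t : ℝ) - p) + ((r : ℝ) - t) = r - p by ring]
    have e1 := threshold_sq (n := n) (q := q) (by linarith) hpt htr hp1 hrn
    have e2 : energy θ p t r ^ 2
        = height θ t ^ 2 * (((t : ℝ) - p) * ((r : ℝ) - t) / ((r : ℝ) - p)) := by
      have hl := coord_eq_of_forall_notMem_trueCP (θ := θ) (a := p) (c := t) hp1 (by omega) hθl
      have hr := coord_eq_of_forall_notMem_trueCP (θ := θ) (a := t) (c := r) (by omega) hrn hθr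
      rw [energy_eq_abs_contrast, sq_abs, contrast_sq θ hpt htr, segMean_eq_of_forall θ htr hr,
        segMean_eq_of_forall θ (x := coord θ (t - 1)) hpt fun k hk1 hk2 =>
          (hl k hk1 hk2).trans (hl (t - 1) (by omega) (by omega)).symm, height]
    rw [← e2]
    have e3 := pow_lt_pow_left₀ hE (mul_nonneg (by linarith) (Real.sqrt_nonneg _)) two_ne_zero
    rwa [mul_pow, e1] at e3
  obtain ⟨ρ, hρ⟩ : ∃ ρ, ρ = min (((r : ℝ) - t) / 2) (min (((t : ℝ) - p) / 2)
    (64 * L * ((Real.log (n * height θ t ^ 2) + q) / height θ t ^ 2))) := ⟨_, rfl⟩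
  have hρ0 : 0 < ρ := by
    rw [hρ]
    exact (detection_radius_pos (by linarith) (by linarith) u0 v0 huv hD hE').2
  have hbound := detection_radius_bound hL hq u0 v0 huv hD hE' hρ
  rw [← hρ]
  by_contra! hcon
  have hfar : ∀ s ∈ T, ρ < |(s : ℝ) - t| := fun s hs => by
    have h1 := lt_of_lt_of_le hcon (Finset.inf_le hs)
    exact_mod_cast h1
  have htT : t ∉ T := fun hmem => by
    have := hfar t hmem
    simp at this
    linarith
  -- Integer distances larger than ρ are at least ⌊ρ⌋ + 1; the strict inequality ρ < ⌊ρ⌋ + 1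
  -- provides the final contradiction.
  have hfl := Nat.floor_le hρ0.le
  have hfl' := Nat.lt_floor_add_one ρ
  generalize ⌊ρ⌋₊ = f at hfl hfl'
  -- Since 2f ≤ t - p, this holds for f ≥ 1; for f = 0 it is p < t.
  have hl1 : p + (f + 1) ≤ t := by
    have h1 : ρ ≤ ((t : ℝ) - p) / 2 := by
      rw [hρ]; exact (min_le_right _ _).trans (min_le_left _ _)
    have h3 : (2 * f + p : ℝ) ≤ t := by linarith
    have h4 : 2 * f + p ≤ t := by exact_mod_cast h3
    omega
  have hr1 : t + (f + 1) ≤ r := by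
    have h1 : ρ ≤ ((r : ℝ) - t) / 2 := by
      rw [hρ]; exact min_le_left _ _
    have h3 : (2 * f + t : ℝ) ≤ r := by linarith
    have h4 : 2 * f + t ≤ r := by exact_mod_cast h3
    omega
  have hprev : prevPt T t + (f + 1) ≤ t := by
    have h1 := prevPt_mem T h2
    rcases h1.2 with h3 | h3
    · omega
    · have h4 := hfar _ h3
      have h5 : (prevPt T t : ℝ) < t := by exact_mod_cast h1.1
      rw [abs_sub_comm, abs_of_pos (by linarith)] at h4
      have h6 : (prevPt T t + f : ℝ) < t := by linarith
      have h7 : prevPt T t + f < t := by exact_mod_cast h6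
      omega
  have hnext : t + (f + 1) ≤ nextPt n T t := by
    have h1 := nextPt_mem T hn
    rcases h1.2 with h3 | h3
    · have h4 := hfar _ h3
      have h5 : (t : ℝ) < nextPt n T t := by exact_mod_cast h1.1
      rw [abs_of_pos (by linarith)] at h4
      have h6 : (t + f : ℝ) < nextPt n T t := by linarith
      have h7 : t + f < nextPt n T t := by exact_mod_cast h6
      omega
    · omega
  have key := h.jump_sq_mul_le hL.le (by linarith) he htT h2 hn (m := f + 1) (by omega) hp1 hrn hl1
    hr1 hprev hnext hθl hθr
  push_cast at key
  have hn0 : (0 : ℝ) < n := by linarith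
  have k1 : height θ t ^ 2 * ρ < height θ t ^ 2 * ((f : ℝ) + 1) := by gcongr
  have k2 : Real.log (4 * n / ((f : ℝ) + 1)) ≤ Real.log 4 + Real.log (n / ρ) := by
    rw [← Real.log_mul (by norm_num) (by positivity), ← mul_div_assoc]
    gcongr
  have k3 : Real.log 4 ≤ 3 / 2 := by
    rw [show (4 : ℝ) = 2 ^ 2 by norm_num, Real.log_pow]
    have := Real.log_two_lt_d9
    push_cast
    linarith
  -- Here q ≥ 3 absorbs 2 log 4, and 32 · 2 = 64 is the origin of the constant `64 * L`.
  have k4 : 32 * L * (q + 2 * Real.log (4 * n / ((f : ℝ) + 1)))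
      ≤ 32 * L * (2 * (q + Real.log (n / ρ))) :=
    mul_le_mul_of_nonneg_left (by linarith) (by linarith)
  linarith

end Detection

/-! ### Dyadic chaining and rounding to a multiscale grid; no probability here. -/

section Chaining

/-- The scale `x (q + log (n / x))` of the square of a sum of `x` noise variables. -/
noncomputable def logScale (n q x : ℝ) : ℝ := x * (q + Real.log (n / x))

lemma logScale_nonneg {n q x : ℝ} (hq : 0 ≤ q) (hx : 0 < x) (hxn : x ≤ n) :
    0 ≤ logScale n q x := by
  have : 0 ≤ Real.log (n / x) := Real.log_nonneg (by rwa [le_div_iff₀ hx, one_mul])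
  unfold logScale
  positivity

/-- The derivative of x(q + log(n/x)) is q - 1 + log(n/x), nonnegative for q ≥ 1 and x ≤ n. -/
lemma logScale_mono {n q x y : ℝ} (hq : 1 ≤ q) (hx : 0 < x) (hxy : x ≤ y) (hyn : y ≤ n) :
    logScale n q x ≤ logScale n q y := by
  have hy : 0 < y := hx.trans_le hxy
  have h1 : 0 ≤ Real.log (n / y) := Real.log_nonneg (by rwa [le_div_iff₀ hy, one_mul])
  have h2 : Real.log (n / x) = Real.log (n / y) + Real.log (y / x) := by
    rw [← Real.log_mul (div_pos (hy.trans_le hyn) hy).ne' (div_pos hy hx).ne']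
    congr 1
    field_simp
  have h3 : Real.log (y / x) ≤ y / x - 1 := Real.log_le_sub_one_of_pos (div_pos hy hx)
  have h4 : x * Real.log (y / x) ≤ y - x := by
    have := mul_le_mul_of_nonneg_left h3 hx.le
    have h5 : x * (y / x - 1) = y - x := by field_simp
    linarith
  unfold logScale
  rw [h2]
  nlinarith [mul_nonneg (sub_nonneg.2 hxy) h1, mul_nonneg (sub_nonneg.2 hxy) (sub_nonneg.2 hq)]

variable {S : ℕ → ℝ} {n : ℕ} {q : ℝ}

/-- The sums over the dyadic blocks are controlled. -/
def DyadicBounded (S : ℕ → ℝ) (n : ℕ) (q : ℝ) : Prop :=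
  ∀ j β : ℕ, (β + 1) * 2 ^ j ≤ n →
    |S ((β + 1) * 2 ^ j) - S (β * 2 ^ j)| ≤ 2 * √(logScale n q (2 ^ j))

/-- Rounding down bit by bit crosses at most one block per scale, and the scales grow geometrically,
so the largest dominates. -/
lemma DyadicBounded.abs_sub_floor_le (h : DyadicBounded S n q) (hq : 3 ≤ q) {x : ℕ} (hx : x ≤ n)
    (j : ℕ) (hj : 2 ^ j ≤ n) :
    |S x - S (x / 2 ^ j * 2 ^ j)| ≤ 8 * √(logScale n q (2 ^ j)) := by
  induction j with
  | zero => simp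
  | succ j ih =>
    have hj' : 2 ^ j ≤ n := (Nat.pow_le_pow_right (by norm_num) (Nat.le_succ j)).trans hj
    have hjR : (2 : ℝ) ^ (j + 1) ≤ n := by exact_mod_cast hj
    -- The induction needs (8 + 2)r_j ≤ 8r_{j+1}, where r_j = √(logScale n q (2^j)). After squaring
    -- this amounts to 25 log 2 ≤ 7(q + X), true because q ≥ 3.
    have hgrow : 5 * √(logScale n q (2 ^ j)) ≤ 4 * √(logScale n q (2 ^ (j + 1))) := by
      have e1 : Real.log ((n : ℝ) / 2 ^ j) = Real.log ((n : ℝ) / 2 ^ (j + 1)) + Real.log 2 := by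
        have : (0 : ℝ) < n := lt_of_lt_of_le (by positivity) hjR
        rw [← Real.log_mul (by positivity) (by norm_num)]
        congr 1
        field_simp
        ring
      have e2 : 0 ≤ Real.log ((n : ℝ) / 2 ^ (j + 1)) :=
        Real.log_nonneg (by rwa [le_div_iff₀ (by positivity), one_mul])
      have e3 := Real.log_two_lt_d9
      have e4 : 5 ^ 2 * logScale n q (2 ^ j) ≤ 4 ^ 2 * logScale n q (2 ^ (j + 1)) := by
        unfold logScale
        rw [e1]
        generalize Real.log ((n : ℝ) / 2 ^ (j + 1)) = X at e2 ⊢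
        have e5 : 25 * (q + (X + Real.log 2)) ≤ 32 * (q + X) := by linarith
        have e6 := mul_le_mul_of_nonneg_left e5 (show (0 : ℝ) ≤ 2 ^ j by positivity)
        rw [pow_succ (2 : ℝ) j]
        linarith
      have e5 := Real.sqrt_le_sqrt e4
      rwa [Real.sqrt_mul (by norm_num), Real.sqrt_mul (by norm_num), Real.sqrt_sq (by norm_num),
        Real.sqrt_sq (by norm_num)] at e5
    have hstep : |S (x / 2 ^ j * 2 ^ j) - S (x / 2 ^ (j + 1) * 2 ^ (j + 1))|
        ≤ 2 * √(logScale n q (2 ^ j)) := by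
      have e1 : x / 2 ^ (j + 1) = x / 2 ^ j / 2 := by rw [pow_succ, Nat.div_div_eq_div_mul]
      rw [e1]
      rcases Nat.even_or_odd (x / 2 ^ j) with he | ho
      · have e2 : x / 2 ^ j / 2 * 2 ^ (j + 1) = x / 2 ^ j * 2 ^ j := by
          rw [pow_succ, mul_comm (2 ^ j) 2, ← mul_assoc, Nat.div_mul_cancel he.two_dvd]
        rw [e2, sub_self, abs_zero]
        positivity
      · obtain ⟨m, hm⟩ := ho
        have e2 : x / 2 ^ j / 2 * 2 ^ (j + 1) = 2 * m * 2 ^ j := by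
          rw [hm, show (2 * m + 1) / 2 = m by omega, pow_succ]; ring
        rw [e2, hm]
        refine h j (2 * m) ?_
        rw [← hm]
        exact (Nat.div_mul_le_self x (2 ^ j)).trans hx
    have := abs_sub_le (S x) (S (x / 2 ^ j * 2 ^ j)) (S (x / 2 ^ (j + 1) * 2 ^ (j + 1)))
    have := ih hj'
    linarith

/-- The square of each increment of `S` is at most `400` times its scale. -/
lemma DyadicBounded.sq_sub_le (h : DyadicBounded S n q) (hq : 3 ≤ q) {s t : ℕ} (hst : s < t)
    (ht : t ≤ n) : (S t - S s) ^ 2 ≤ 400 * logScale n q ((t : ℝ) - s) := by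
  obtain ⟨J, hJ⟩ : ∃ J, J = Nat.log 2 (t - s) := ⟨_, rfl⟩
  have h1 : 2 ^ J ≤ t - s := hJ ▸ Nat.pow_log_le_self 2 (by omega)
  have h2 : t - s < 2 ^ (J + 1) := hJ ▸ Nat.lt_pow_succ_log_self (by norm_num) _
  have h3 : 2 ^ J ≤ n := by omega
  have k1 := h.abs_sub_floor_le hq ht J h3
  have k2 := h.abs_sub_floor_le hq (hst.le.trans ht) J h3
  have hge : s / 2 ^ J ≤ t / 2 ^ J := Nat.div_le_div_right hst.le
  have hle : t / 2 ^ J ≤ s / 2 ^ J + 2 := by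
    calc t / 2 ^ J ≤ (s + 2 * 2 ^ J) / 2 ^ J := Nat.div_le_div_right (by rw [pow_succ] at h2; omega)
      _ = s / 2 ^ J + 2 := Nat.add_mul_div_right _ _ (by positivity)
  have htop : t / 2 ^ J * 2 ^ J ≤ n := (Nat.div_mul_le_self t (2 ^ J)).trans ht
  have k3 : |S (t / 2 ^ J * 2 ^ J) - S (s / 2 ^ J * 2 ^ J)| ≤ 4 * √(logScale n q (2 ^ J)) := by
    have h0 := Real.sqrt_nonneg (logScale n q (2 ^ J))
    obtain h4 | h4 | h4 : t / 2 ^ J = s / 2 ^ J ∨ t / 2 ^ J = s / 2 ^ J + 1 ∨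
      t / 2 ^ J = s / 2 ^ J + 1 + 1 := by omega
    · rw [h4, sub_self, abs_zero]; positivity
    · rw [h4] at htop ⊢
      linarith [h J _ htop]
    · rw [h4] at htop ⊢
      have m1 := h J _ htop
      have m2 := h J (s / 2 ^ J) (le_trans (Nat.mul_le_mul_right _ (by omega)) htop)
      have := abs_sub_le (S ((s / 2 ^ J + 1 + 1) * 2 ^ J)) (S ((s / 2 ^ J + 1) * 2 ^ J))
        (S (s / 2 ^ J * 2 ^ J))
      linarith
  -- 8 + 4 + 8: two roundings, and at most two whole blocks between the rounded points.
  have k4 : |S t - S s| ≤ 20 * √(logScale n q (2 ^ J)) := by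
    have e1 := abs_sub_le (S t) (S (t / 2 ^ J * 2 ^ J)) (S s)
    have e2 := abs_sub_le (S (t / 2 ^ J * 2 ^ J)) (S (s / 2 ^ J * 2 ^ J)) (S s)
    rw [abs_sub_comm] at k2
    linarith
  have hlen : (2 : ℝ) ^ J ≤ (t : ℝ) - s := by
    have : 2 ^ J + s ≤ t := by omega
    have : (2 : ℝ) ^ J + s ≤ t := by exact_mod_cast this
    linarith
  have hlen' : (t : ℝ) - s ≤ n := by
    have : (t : ℝ) ≤ n := by exact_mod_cast ht
    have : (0 : ℝ) ≤ s := by positivity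
    linarith
  have k5 := logScale_mono (n := n) (q := q) (by linarith) (by positivity) hlen hlen'
  have k6 : 0 ≤ logScale n q (2 ^ J) :=
    logScale_nonneg (by linarith) (by positivity) (hlen.trans hlen')
  calc (S t - S s) ^ 2 = |S t - S s| ^ 2 := (sq_abs _).symm
    _ ≤ (20 * √(logScale n q (2 ^ J))) ^ 2 := by gcongr
    _ = 400 * logScale n q (2 ^ J) := by rw [mul_pow, Real.sq_sqrt k6]; norm_num
    _ ≤ _ := by linarith

/-- Here r is the scale of an increment of length l. Changing the numerator costs |A - A₀||A +
A₀|/l, of order ηQ; changing the denominator costs a relative η on A₀²/l. -/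
lemma abs_sq_div_sub_le_of_near {A A₀ l l₀ Q η r : ℝ} (hl0 : 0 < l) (hQ : 0 ≤ Q) (hη : 0 < η)
    (hη2 : η ≤ 1 / 2) (hr : r ^ 2 = l * Q) (hr0 : 0 ≤ r) (kA : |A| ≤ 20 * r)
    (kd : |A - A₀| ≤ 60 * η * r) (kl : |l₀ - l| ≤ η ^ 2 * l) :
    |A ^ 2 / l - A₀ ^ 2 / l₀| ≤ 12500 * η * Q := by
  have kA₀ : |A₀| ≤ 50 * r := by
    have e1 := abs_sub A (A - A₀)
    rw [sub_sub_cancel] at e1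
    have : 60 * η * r ≤ 30 * r := mul_le_mul_of_nonneg_right (by linarith) hr0
    linarith
  have hηl : η ^ 2 * l ≤ 1 / 2 * η * l :=
    mul_le_mul_of_nonneg_right (by nlinarith) hl0.le
  have hηl' : 1 / 2 * η * l ≤ 1 / 2 * (1 / 2) * l := by gcongr
  have hl₀2 : l / 2 ≤ l₀ := by
    have := (abs_le.1 kl).1
    linarith
  have hl₀0 : 0 < l₀ := by linarith
  have e1 : A ^ 2 / l - A₀ ^ 2 / l₀ = (A - A₀) * (A + A₀) / l + A₀ ^ 2 * ((l₀ - l) / (l * l₀)) := by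
    field_simp
    ring
  have e2 : |(A - A₀) * (A + A₀) / l| ≤ 4200 * η * Q := by
    rw [abs_div, abs_mul, abs_of_pos hl0, div_le_iff₀ hl0]
    have e3 : |A + A₀| ≤ 70 * r := by
      have := abs_add_le A A₀
      linarith
    calc |A - A₀| * |A + A₀| ≤ (60 * η * r) * (70 * r) := by gcongr
      _ = 4200 * η * r ^ 2 := by ring
      _ = 4200 * η * Q * l := by rw [hr]; ring
  have e4 : |A₀ ^ 2 * ((l₀ - l) / (l * l₀))| ≤ 2500 * η * Q := by
    rw [abs_mul, abs_div, abs_of_nonneg (sq_nonneg A₀), abs_of_pos (mul_pos hl0 hl₀0)]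
    have e5 : A₀ ^ 2 ≤ 2500 * (l * Q) := by
      rw [← sq_abs, ← hr]
      calc |A₀| ^ 2 ≤ (50 * r) ^ 2 := by gcongr
        _ = _ := by ring
    have e6 : |l₀ - l| / (l * l₀) ≤ η / l := by
      rw [div_le_div_iff₀ (by positivity) hl0]
      have e7 : |l₀ - l| ≤ η * l₀ := by
        have := mul_le_mul_of_nonneg_left hl₀2 hη.le
        linarith
      have := mul_le_mul_of_nonneg_right e7 hl0.le
      linarith
    calc A₀ ^ 2 * (|l₀ - l| / (l * l₀)) ≤ 2500 * (l * Q) * (η / l) := by gcongr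
      _ = 2500 * η * Q := by field_simp
  rw [e1]
  refine (abs_add_le _ _).trans ?_
  have : 0 ≤ η * Q := by positivity
  linarith

/-- Stability of the normalized square `(S t - S s)² / (t - s)` under a small change of the end
points. -/
lemma abs_sq_div_sub_sq_div_le {η : ℝ} (hq : 1 ≤ q)
    (hS : ∀ s t : ℕ, s < t → t ≤ n → (S t - S s) ^ 2 ≤ 400 * logScale n q ((t : ℝ) - s))
    (hη : 0 < η) (hη2 : η ≤ 1 / 2) (hηq : Real.log ((η ^ 2)⁻¹) ≤ q) {s t s₀ t₀ : ℕ} (hst : s < t)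
    (ht : t ≤ n) (hs₀ : s₀ ≤ s) (ht₀ : t₀ ≤ t) (hs : (s : ℝ) - s₀ ≤ η ^ 2 * ((t : ℝ) - s))
    (ht' : (t : ℝ) - t₀ ≤ η ^ 2 * ((t : ℝ) - s)) :
    |(S t - S s) ^ 2 / ((t : ℝ) - s) - (S t₀ - S s₀) ^ 2 / ((t₀ : ℝ) - s₀)|
      ≤ 12500 * η * (q + Real.log (n / ((t : ℝ) - s))) := by
  obtain ⟨l, hl⟩ : ∃ l : ℝ, l = (t : ℝ) - s := ⟨_, rfl⟩
  obtain ⟨l₀, hl₀⟩ : ∃ l₀ : ℝ, l₀ = (t₀ : ℝ) - s₀ := ⟨_, rfl⟩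
  obtain ⟨Q, hQ⟩ : ∃ Q, Q = q + Real.log (n / l) := ⟨_, rfl⟩
  have hl0 : 0 < l := by rw [hl]; exact sub_pos.2 (by exact_mod_cast hst)
  have hln : l ≤ n := by
    have h1 : (t : ℝ) ≤ n := by exact_mod_cast ht
    have h2 : (0 : ℝ) ≤ s := by positivity
    rw [hl]; linarith
  have hn0 : (0 : ℝ) < n := hl0.trans_le hln
  have hQ0 : q ≤ Q := by
    have : 0 ≤ Real.log (n / l) := Real.log_nonneg (by rwa [le_div_iff₀ hl0, one_mul])
    linarith
  have hη1 : η ^ 2 ≤ 1 / 2 * η := by nlinarith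
  have hs0' : (s₀ : ℝ) ≤ s := by exact_mod_cast hs₀
  have ht0' : (t₀ : ℝ) ≤ t := by exact_mod_cast ht₀
  rw [← hl] at hs ht'
  -- Shortening the length to η²l raises the logarithm by log(η⁻²), which `hηq` lets `q` absorb.
  have hscale : logScale n q (η ^ 2 * l) ≤ 2 * (η ^ 2 * (l * Q)) := by
    have e1 : Real.log (n / (η ^ 2 * l)) = Real.log (n / l) + Real.log ((η ^ 2)⁻¹) := by
      rw [← Real.log_mul (by positivity) (by positivity)]
      congr 1
      field_simp
    unfold logScale
    rw [e1]
    have : 0 ≤ η ^ 2 * l := by positivity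
    have h2 : q + (Real.log (n / l) + Real.log ((η ^ 2)⁻¹)) ≤ 2 * Q := by linarith
    have := mul_le_mul_of_nonneg_left h2 this
    linarith
  have hr2 : √(l * Q) ^ 2 = l * Q := Real.sq_sqrt (mul_nonneg hl0.le (by linarith))
  have hr0 := Real.sqrt_nonneg (l * Q)
  have hsmall : ∀ x x₀ : ℕ, x ≤ n → x₀ ≤ x → (x : ℝ) - x₀ ≤ η ^ 2 * l →
      |S x - S x₀| ≤ 30 * η * √(l * Q) := by
    intro x x₀ hx hx₀ hxx
    rcases hx₀.eq_or_lt with rfl | hlt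
    · rw [sub_self, abs_zero]; positivity
    · apply abs_le_of_sq_le_sq _ (by positivity)
      have hpos : (0 : ℝ) < (x : ℝ) - x₀ := sub_pos.2 (by exact_mod_cast hlt)
      have e1 := logScale_mono (n := n) (q := q) hq hpos hxx (by nlinarith)
      have e2 := hS x₀ x hlt hx
      rw [mul_pow, hr2]
      have : 0 ≤ η ^ 2 * (l * Q) := by
        have : 0 ≤ Q := by linarith
        positivity
      nlinarith
  have ks := hsmall s s₀ (by omega) hs₀ hs
  have kt := hsmall t t₀ ht ht₀ ht'
  have kS : |S t - S s| ≤ 20 * √(l * Q) := by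
    apply abs_le_of_sq_le_sq _ (by positivity)
    rw [mul_pow, hr2]
    have := hS s t hst ht
    rw [← hl] at this
    unfold logScale at this
    rw [← hQ] at this
    linarith
  obtain ⟨A, hA⟩ : ∃ A, A = S t - S s := ⟨_, rfl⟩
  obtain ⟨A₀, hA₀⟩ : ∃ A₀, A₀ = S t₀ - S s₀ := ⟨_, rfl⟩
  have kd : |A - A₀| ≤ 60 * η * √(l * Q) := by
    have e1 : A - A₀ = (S t - S t₀) - (S s - S s₀) := by rw [hA, hA₀]; ring
    have e2 := abs_sub (S t - S t₀) (S s - S s₀)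
    rw [e1]
    linarith
  rw [← hA] at kS
  have kl : |l₀ - l| ≤ η ^ 2 * l := by
    rw [hl₀, abs_le]
    constructor <;> linarith
  rw [← hl, ← hl₀, ← hQ, ← hA, ← hA₀]
  exact abs_sq_div_sub_le_of_near hl0 (by linarith) hη hη2 hr2 hr0 kS kd kl

/-- The decrease of the residual sum of squares when the segment `[a, c)` is split at `b`, in terms
of the partial sums. -/
noncomputable def splitGain (S : ℕ → ℝ) (a b c : ℕ) : ℝ :=
  (S b - S a) ^ 2 / ((b : ℝ) - a) + (S c - S b) ^ 2 / ((c : ℝ) - b)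
    - (S c - S a) ^ 2 / ((c : ℝ) - a)

lemma sqThreshold_eq_sum (hn : 1 ≤ n) (q : ℝ) {a b c : ℕ} (hab : a < b) (hbc : b < c) :
    sqThreshold n q a b c
      = 2 * Real.log ((n : ℝ) / ((b : ℝ) - a) + (n : ℝ) / ((c : ℝ) - b)) + q := by
  have h1 : (0 : ℝ) < (b : ℝ) - a := sub_pos.2 (by exact_mod_cast hab)
  have h2 : (0 : ℝ) < (c : ℝ) - b := sub_pos.2 (by exact_mod_cast hbc)
  unfold sqThreshold
  congr 3
  field_simp
  ring

/-- `splitGain` consists of three normalized squares, each stable up to 12500η thresholds. The outer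
segment inherits the precision of its two parts. -/
lemma splitGain_le_add {η : ℝ} (hq : 1 ≤ q)
    (hS : ∀ s t : ℕ, s < t → t ≤ n → (S t - S s) ^ 2 ≤ 400 * logScale n q ((t : ℝ) - s))
    (hη : 0 < η) (hη2 : η ≤ 1 / 2) (hηq : Real.log ((η ^ 2)⁻¹) ≤ q) {a b c a₀ b₀ c₀ : ℕ}
    (hab : a < b) (hbc : b < c) (hc : c ≤ n) (ha₀ : a₀ ≤ a) (hb₀ : b₀ ≤ b) (hc₀ : c₀ ≤ c)
    (ha : (a : ℝ) - a₀ ≤ η ^ 2 * ((b : ℝ) - a)) (hb : (b : ℝ) - b₀ ≤ η ^ 2 * ((b : ℝ) - a))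
    (hb' : (b : ℝ) - b₀ ≤ η ^ 2 * ((c : ℝ) - b)) (hcc : (c : ℝ) - c₀ ≤ η ^ 2 * ((c : ℝ) - b)) :
    splitGain S a b c ≤ splitGain S a₀ b₀ c₀ + 37500 * η * sqThreshold n q a b c := by
  have h1 : (0 : ℝ) < (b : ℝ) - a := sub_pos.2 (by exact_mod_cast hab)
  have h2 : (0 : ℝ) < (c : ℝ) - b := sub_pos.2 (by exact_mod_cast hbc)
  have hcn : (c : ℝ) ≤ n := by exact_mod_cast hc
  have ha0 : (0 : ℝ) ≤ a := by positivity
  have hn0 : (0 : ℝ) < n := by linarith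
  have h3 : η ^ 2 * ((b : ℝ) - a) ≤ η ^ 2 * ((c : ℝ) - a) := by gcongr
  have h4 : η ^ 2 * ((c : ℝ) - b) ≤ η ^ 2 * ((c : ℝ) - a) := by gcongr
  have k1 := abs_le.1 (abs_sq_div_sub_sq_div_le hq hS hη hη2 hηq hab (by omega) ha₀ hb₀ ha hb)
  have k2 := abs_le.1 (abs_sq_div_sub_sq_div_le hq hS hη hη2 hηq hbc hc hb₀ hc₀ hb' hcc)
  have k3 := abs_le.1 (abs_sq_div_sub_sq_div_le hq hS hη hη2 hηq (hab.trans hbc) hc ha₀ hc₀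
    (by linarith) (by linarith))
  have hlog : ∀ l : ℝ, 0 < l → (n : ℝ) / l ≤ (n : ℝ) / ((b : ℝ) - a) + (n : ℝ) / ((c : ℝ) - b) →
      q + Real.log (n / l) ≤ sqThreshold n q a b c := by
    intro l hl hle
    rw [sqThreshold_eq_sum (by omega) q hab hbc]
    have e1 : Real.log (n / l) ≤ Real.log ((n : ℝ) / ((b : ℝ) - a) + (n : ℝ) / ((c : ℝ) - b)) :=
      Real.log_le_log (by positivity) hle
    have e2 : 0 ≤ Real.log ((n : ℝ) / ((b : ℝ) - a) + (n : ℝ) / ((c : ℝ) - b)) := by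
      apply Real.log_nonneg
      have : 1 ≤ (n : ℝ) / ((b : ℝ) - a) := by rw [le_div_iff₀ h1]; linarith
      have : 0 ≤ (n : ℝ) / ((c : ℝ) - b) := by positivity
      linarith
    linarith
  have p1 : 0 ≤ (n : ℝ) / ((b : ℝ) - a) := by positivity
  have p2 : 0 ≤ (n : ℝ) / ((c : ℝ) - b) := by positivity
  have l1 := hlog _ h1 (by linarith)
  have l2 := hlog _ h2 (by linarith)
  have l3 := hlog ((c : ℝ) - a) (by linarith) (by
    have : (n : ℝ) / ((c : ℝ) - a) ≤ n / ((b : ℝ) - a) := by gcongr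
    linarith)
  have hη' : 0 ≤ 12500 * η := by linarith
  have m1 := mul_le_mul_of_nonneg_left l1 hη'
  have m2 := mul_le_mul_of_nonneg_left l2 hη'
  have m3 := mul_le_mul_of_nonneg_left l3 hη'
  unfold splitGain
  linarith

/-- Shrinking both sides by at most the factor 1 - η² raises the logarithm by at most 2η, and the
threshold is at least q ≥ 1. -/
lemma sqThreshold_le_mul_of_near {η : ℝ} (hq : 1 ≤ q) (hη : 0 < η) (hη2 : η ≤ 1 / 2)
    {a b c a₀ b₀ c₀ : ℕ} (hab : a < b) (hbc : b < c) (hc : c ≤ n) (hab₀ : a₀ < b₀) (hbc₀ : b₀ < c₀)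
    (h1 : (1 - η ^ 2) * ((b : ℝ) - a) ≤ (b₀ : ℝ) - a₀)
    (h2 : (1 - η ^ 2) * ((c : ℝ) - b) ≤ (c₀ : ℝ) - b₀) :
    sqThreshold n q a₀ b₀ c₀ ≤ (1 + 4 * η) * sqThreshold n q a b c := by
  have e1 : (0 : ℝ) < (b : ℝ) - a := sub_pos.2 (by exact_mod_cast hab)
  have e2 : (0 : ℝ) < (c : ℝ) - b := sub_pos.2 (by exact_mod_cast hbc)
  have e3 : (0 : ℝ) < (b₀ : ℝ) - a₀ := sub_pos.2 (by exact_mod_cast hab₀)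
  have e4 : (0 : ℝ) < (c₀ : ℝ) - b₀ := sub_pos.2 (by exact_mod_cast hbc₀)
  have hcn : (c : ℝ) ≤ n := by exact_mod_cast hc
  have ha0 : (0 : ℝ) ≤ a := by positivity
  have hn0 : (0 : ℝ) < n := by linarith
  have hη1 : η ^ 2 ≤ 1 / 2 * η := by nlinarith
  have hδ : 0 < 1 - η ^ 2 := by linarith
  obtain ⟨X, hX⟩ : ∃ X, X = (n : ℝ) / ((b : ℝ) - a) + (n : ℝ) / ((c : ℝ) - b) := ⟨_, rfl⟩
  have hX1 : 1 ≤ X := by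
    have : 1 ≤ (n : ℝ) / ((b : ℝ) - a) := by rw [le_div_iff₀ e1]; linarith
    have : 0 ≤ (n : ℝ) / ((c : ℝ) - b) := by positivity
    linarith
  have hle : (n : ℝ) / ((b₀ : ℝ) - a₀) + (n : ℝ) / ((c₀ : ℝ) - b₀) ≤ X * (1 - η ^ 2)⁻¹ := by
    have f1 : (n : ℝ) / ((b₀ : ℝ) - a₀) ≤ n / ((1 - η ^ 2) * ((b : ℝ) - a)) := by gcongr
    have f2 : (n : ℝ) / ((c₀ : ℝ) - b₀) ≤ n / ((1 - η ^ 2) * ((c : ℝ) - b)) := by gcongr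
    have f3 : X * (1 - η ^ 2)⁻¹ = n / ((1 - η ^ 2) * ((b : ℝ) - a))
        + n / ((1 - η ^ 2) * ((c : ℝ) - b)) := by
      rw [hX]; field_simp
    linarith
  have hlog : Real.log ((n : ℝ) / ((b₀ : ℝ) - a₀) + (n : ℝ) / ((c₀ : ℝ) - b₀))
      ≤ Real.log X + 2 * η := by
    have f1 := Real.log_le_log (by positivity) hle
    rw [Real.log_mul (by positivity) (by positivity)] at f1
    have f2 : Real.log (1 - η ^ 2)⁻¹ ≤ (1 - η ^ 2)⁻¹ - 1 :=
      Real.log_le_sub_one_of_pos (by positivity)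
    have f3 : (1 - η ^ 2)⁻¹ ≤ 1 + 2 * η := by
      rw [inv_le_iff_one_le_mul₀ hδ]
      nlinarith
    linarith
  rw [sqThreshold_eq_sum (by omega) q hab₀ hbc₀, sqThreshold_eq_sum (by omega) q hab hbc, ← hX]
  have := Real.log_nonneg hX1
  nlinarith

/-- The mesh of the grid at the scale `2 ^ j` with relative precision `4⁻ᵏ`. -/
def mesh (k j : ℕ) : ℕ := 2 ^ (j - 2 * k)

lemma mesh_pos (k j : ℕ) : 0 < mesh k j := by unfold mesh; positivity

lemma mesh_mono (k : ℕ) {i j : ℕ} (h : i ≤ j) : mesh k i ≤ mesh k j :=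
  Nat.pow_le_pow_right (by norm_num) (by omega)

/-- For `j ≤ 2 * k` the truncated exponent makes the mesh 1 and the rounding exact; otherwise the
mesh is 4⁻ᵏ times 2^j. -/
lemma sub_floor_mesh_le (k x : ℕ) {j : ℕ} {h : ℝ} (hj : (2 : ℝ) ^ j ≤ h) :
    (x : ℝ) - (mesh k j * (x / mesh k j) : ℕ) ≤ ((2 ^ k : ℝ)⁻¹) ^ 2 * h := by
  have h0 : (0 : ℝ) < h := lt_of_lt_of_le (by positivity) hj
  by_cases hjk : j ≤ 2 * k
  · have : mesh k j = 1 := by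
      unfold mesh
      rw [Nat.sub_eq_zero_of_le hjk, pow_zero]
    rw [this, Nat.div_one, one_mul, sub_self]
    positivity
  · push Not at hjk
    have h1 := Nat.div_add_mod x (mesh k j)
    have h2 := Nat.mod_lt x (mesh_pos k j)
    have h3 : x ≤ mesh k j * (x / mesh k j) + mesh k j := by omega
    have h4 : (x : ℝ) ≤ (mesh k j * (x / mesh k j) : ℕ) + (mesh k j : ℕ) := by exact_mod_cast h3
    have h5 : ((mesh k j : ℕ) : ℝ) * (2 ^ k) ^ 2 = 2 ^ j := by
      unfold mesh
      push_cast
      rw [← pow_mul, ← pow_add]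
      congr 1
      omega
    have h6 : ((mesh k j : ℕ) : ℝ) ≤ ((2 ^ k : ℝ)⁻¹) ^ 2 * h := by
      rw [inv_pow, ← div_eq_inv_mul, le_div_iff₀ (by positivity), h5]
      exact hj
    linarith

/-- The increments of `S` over the triples of a multiscale grid with precision `k` are controlled. A
triple of the grid is given by the scales `2 ^ i` and `2 ^ j` of its two sides, by its middle point
`m` and by the numbers of meshes on the two sides. -/
def GridBounded (S : ℕ → ℝ) (n k : ℕ) (q M : ℝ) : Prop :=
  ∀ i ∈ Finset.range (Nat.log 2 n + 1), ∀ j ∈ Finset.range (Nat.log 2 n + 1),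
    ∀ β ∈ Finset.range (n / mesh k (min i j) + 1),
    ∀ p ∈ Finset.range (4 ^ (k + 1)) ×ˢ Finset.range (4 ^ (k + 1)),
    ∀ a b c : ℕ, b = mesh k (min i j) * β → a = mesh k i * (b / mesh k i - p.1) →
      c = mesh k j * (b / mesh k j + p.2) → a < b → b < c → c ≤ n → b ≤ a + 2 ^ (i + 2) →
      c ≤ b + 2 ^ (j + 2) → splitGain S a b c ≤ M * sqThreshold n q a b c

-- Round down each end at the scale of its own side, and the middle point at the smaller scale, so
-- that its displacement is negligible for both sides. The gain and the threshold then change by a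
-- factor 1 + O(η), η = 2⁻ᵏ.
set_option maxHeartbeats 800000 in
lemma GridBounded.splitGain_le {k : ℕ} {ξ : ℝ} (h : GridBounded S n k q (1 + ξ))
    (hd : DyadicBounded S n q) (hq : 3 ≤ q) (hk : 1 ≤ k) (hξ : 0 ≤ ξ) (hξ1 : ξ ≤ 1)
    (hkξ : 40000 * (2 ^ k : ℝ)⁻¹ ≤ ξ) (hkq : Real.log ((((2 ^ k : ℝ)⁻¹) ^ 2)⁻¹) ≤ q)
    {a b c : ℕ} (hab : a < b) (hbc : b < c) (hc : c ≤ n) :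
    splitGain S a b c ≤ (1 + 2 * ξ) * sqThreshold n q a b c := by
  obtain ⟨η, hη⟩ : ∃ η, η = (2 ^ k : ℝ)⁻¹ := ⟨_, rfl⟩
  have hη0 : 0 < η := by rw [hη]; positivity
  have hη2 : η ≤ 1 / 2 := by
    rw [hη, one_div]
    apply inv_anti₀ (by norm_num)
    calc (2 : ℝ) = 2 ^ 1 := by norm_num
      _ ≤ 2 ^ k := pow_le_pow_right₀ (by norm_num) hk
  have hη1 : η ^ 2 ≤ 1 / 2 * η := by nlinarith
  obtain ⟨i, hi⟩ : ∃ i, i = Nat.log 2 (b - a) := ⟨_, rfl⟩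
  obtain ⟨j, hj⟩ : ∃ j, j = Nat.log 2 (c - b) := ⟨_, rfl⟩
  have hi1 : 2 ^ i ≤ b - a := hi ▸ Nat.pow_log_le_self 2 (by omega)
  have hi2 : b - a < 2 ^ (i + 1) := hi ▸ Nat.lt_pow_succ_log_self (by norm_num) _
  have hj1 : 2 ^ j ≤ c - b := hj ▸ Nat.pow_log_le_self 2 (by omega)
  have hj2 : c - b < 2 ^ (j + 1) := hj ▸ Nat.lt_pow_succ_log_self (by norm_num) _
  have hin : i ∈ Finset.range (Nat.log 2 n + 1) := by
    rw [Finset.mem_range, hi]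
    exact Nat.lt_succ_of_le (Nat.log_mono_right (by omega))
  have hjn : j ∈ Finset.range (Nat.log 2 n + 1) := by
    rw [Finset.mem_range, hj]
    exact Nat.lt_succ_of_le (Nat.log_mono_right (by omega))
  have e1 : (0 : ℝ) < (b : ℝ) - a := sub_pos.2 (by exact_mod_cast hab)
  have e2 : (0 : ℝ) < (c : ℝ) - b := sub_pos.2 (by exact_mod_cast hbc)
  have hi1' : (2 : ℝ) ^ i ≤ (b : ℝ) - a := by
    have : 2 ^ i + a ≤ b := by omega
    have : (2 : ℝ) ^ i + a ≤ b := by exact_mod_cast this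
    linarith
  have hj1' : (2 : ℝ) ^ j ≤ (c : ℝ) - b := by
    have : 2 ^ j + b ≤ c := by omega
    have : (2 : ℝ) ^ j + b ≤ c := by exact_mod_cast this
    linarith
  have hm1 : (2 : ℝ) ^ (min i j) ≤ (b : ℝ) - a :=
    (pow_le_pow_right₀ (by norm_num) (min_le_left i j)).trans hi1'
  have hm2 : (2 : ℝ) ^ (min i j) ≤ (c : ℝ) - b :=
    (pow_le_pow_right₀ (by norm_num) (min_le_right i j)).trans hj1'
  obtain ⟨a₀, ha₀⟩ : ∃ a₀, a₀ = mesh k i * (a / mesh k i) := ⟨_, rfl⟩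
  obtain ⟨b₀, hb₀⟩ : ∃ b₀, b₀ = mesh k (min i j) * (b / mesh k (min i j)) := ⟨_, rfl⟩
  obtain ⟨c₀, hc₀⟩ : ∃ c₀, c₀ = mesh k j * (c / mesh k j) := ⟨_, rfl⟩
  have ha₀' : a₀ ≤ a := ha₀ ▸ Nat.mul_div_le a _
  have hb₀' : b₀ ≤ b := hb₀ ▸ Nat.mul_div_le b _
  have hc₀' : c₀ ≤ c := hc₀ ▸ Nat.mul_div_le c _
  have ra₀ : (a₀ : ℝ) ≤ a := by exact_mod_cast ha₀'
  have rb₀ : (b₀ : ℝ) ≤ b := by exact_mod_cast hb₀'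
  have rc₀ : (c₀ : ℝ) ≤ c := by exact_mod_cast hc₀'
  have fa : (a : ℝ) - a₀ ≤ η ^ 2 * ((b : ℝ) - a) := by
    rw [ha₀, hη]; exact sub_floor_mesh_le k a hi1'
  have fb : (b : ℝ) - b₀ ≤ η ^ 2 * ((b : ℝ) - a) := by
    rw [hb₀, hη]; exact sub_floor_mesh_le k b hm1
  have fb' : (b : ℝ) - b₀ ≤ η ^ 2 * ((c : ℝ) - b) := by
    rw [hb₀, hη]; exact sub_floor_mesh_le k b hm2
  have fc : (c : ℝ) - c₀ ≤ η ^ 2 * ((c : ℝ) - b) := by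
    rw [hc₀, hη]; exact sub_floor_mesh_le k c hj1'
  have g1 : (1 - η ^ 2) * ((b : ℝ) - a) ≤ (b₀ : ℝ) - a₀ := by linarith
  have g2 : (1 - η ^ 2) * ((c : ℝ) - b) ≤ (c₀ : ℝ) - b₀ := by linarith
  have hab₀ : a₀ < b₀ := by
    have : (0 : ℝ) < (b₀ : ℝ) - a₀ := lt_of_lt_of_le (mul_pos (by linarith) e1) g1
    exact_mod_cast sub_pos.1 this
  have hbc₀ : b₀ < c₀ := by
    have : (0 : ℝ) < (c₀ : ℝ) - b₀ := lt_of_lt_of_le (mul_pos (by linarith) e2) g2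
    exact_mod_cast sub_pos.1 this
  -- Rounding `a` down may lengthen the side past 2^(i+1); one further power of two leaves room.
  have hlen1 : b₀ ≤ a₀ + 2 ^ (i + 2) := by
    have s1 : (b : ℝ) < a + 2 ^ (i + 1) := by
      have : b < a + 2 ^ (i + 1) := by omega
      exact_mod_cast this
    have s2 : (b₀ : ℝ) ≤ a₀ + 2 ^ (i + 2) := by
      rw [pow_succ _ (i + 1)]
      nlinarith
    exact_mod_cast s2
  have hlen2 : c₀ ≤ b₀ + 2 ^ (j + 2) := by
    have s1 : (c : ℝ) < b + 2 ^ (j + 1) := by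
      have : c < b + 2 ^ (j + 1) := by omega
      exact_mod_cast this
    have s2 : (c₀ : ℝ) ≤ b₀ + 2 ^ (j + 2) := by
      rw [pow_succ _ (j + 1)]
      nlinarith
    exact_mod_cast s2
  have hscale : ∀ l : ℕ, 2 ^ (l + 1) ≤ mesh k l * 2 ^ (2 * k + 1) := by
    intro l
    unfold mesh
    rw [← pow_add]
    exact Nat.pow_le_pow_right (by norm_num) (by omega)
  have h4k : 4 ^ (k + 1) = 2 * 2 ^ (2 * k + 1) := by
    rw [← pow_succ', show 2 * k + 1 + 1 = 2 * (k + 1) by ring, pow_mul]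
    norm_num
  have h2k : 2 ≤ 2 ^ (2 * k + 1) := by
    calc 2 = 2 ^ 1 := by norm_num
      _ ≤ 2 ^ (2 * k + 1) := Nat.pow_le_pow_right (by norm_num) (by omega)
  have hp1 : a / mesh k i ≤ b₀ / mesh k i := by
    rw [Nat.le_div_iff_mul_le (mesh_pos k i), mul_comm, ← ha₀]
    exact hab₀.le
  have hp1' : b₀ / mesh k i ≤ a / mesh k i + 2 ^ (2 * k + 1) := by
    calc b₀ / mesh k i ≤ (a + mesh k i * 2 ^ (2 * k + 1)) / mesh k i :=
          Nat.div_le_div_right (by have := hscale i; omega)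
      _ = a / mesh k i + 2 ^ (2 * k + 1) := Nat.add_mul_div_left _ _ (mesh_pos k i)
  have hp2 : b₀ / mesh k j ≤ c / mesh k j := Nat.div_le_div_right (by omega)
  -- The extra mesh accounts for measuring from `b₀` instead of `b`.
  have hp2' : c / mesh k j ≤ b₀ / mesh k j + (2 ^ (2 * k + 1) + 1) := by
    have s1 : b < b₀ + mesh k j := by
      have s2 := Nat.div_add_mod b (mesh k (min i j))
      have s3 := Nat.mod_lt b (mesh_pos k (min i j))
      have s4 := mesh_mono k (min_le_right i j)
      omega
    calc c / mesh k j ≤ (b₀ + mesh k j * (2 ^ (2 * k + 1) + 1)) / mesh k j :=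
          Nat.div_le_div_right (by have := hscale j; rw [mul_add, mul_one]; omega)
      _ = b₀ / mesh k j + (2 ^ (2 * k + 1) + 1) := Nat.add_mul_div_left _ _ (mesh_pos k j)
  have key := h i hin j hjn (b / mesh k (min i j))
    (Finset.mem_range.2 (Nat.lt_succ_of_le (Nat.div_le_div_right (by omega))))
    (b₀ / mesh k i - a / mesh k i, c / mesh k j - b₀ / mesh k j)
    (Finset.mem_product.2 ⟨Finset.mem_range.2 (by simp only; omega),
      Finset.mem_range.2 (by simp only; omega)⟩) a₀ b₀ c₀ hb₀
    (by simp only; rw [Nat.sub_sub_self hp1]; exact ha₀)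
    (by simp only; rw [Nat.add_sub_cancel' hp2]; exact hc₀) hab₀ hbc₀ (by omega) hlen1 hlen2
  rw [← hη] at hkq hkξ
  have k1 := splitGain_le_add (S := S) (n := n) (q := q) (by linarith)
    (fun s t hst ht => hd.sq_sub_le hq hst ht) hη0 hη2 hkq hab hbc hc ha₀' hb₀' hc₀' fa fb fb' fc
  have k2 := sqThreshold_le_mul_of_near (n := n) (q := q) (by linarith) hη0 hη2 hab hbc hc hab₀ hbc₀
    g1 g2
  have k3 : 0 ≤ sqThreshold n q a b c := by
    have s1 : (n : ℝ) > 0 := by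
      have : 0 < n := by omega
      exact_mod_cast this
    have s2 : 0 ≤ Real.log ((n : ℝ) / ((b : ℝ) - a) + (n : ℝ) / ((c : ℝ) - b)) := by
      apply Real.log_nonneg
      have hcn : (c : ℝ) ≤ n := by exact_mod_cast hc
      have ha0 : (0 : ℝ) ≤ a := by positivity
      have : 1 ≤ (n : ℝ) / ((b : ℝ) - a) := by rw [le_div_iff₀ e1]; linarith
      have : 0 ≤ (n : ℝ) / ((c : ℝ) - b) := by positivity
      linarith
    rw [sqThreshold_eq_sum (by omega) q hab hbc]
    linarith
  calc splitGain S a b c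
      ≤ (1 + ξ) * ((1 + 4 * η) * sqThreshold n q a b c) + 37500 * η * sqThreshold n q a b c := by
        have := mul_le_mul_of_nonneg_left k2 (show 0 ≤ 1 + ξ by linarith)
        linarith
    _ = ((1 + ξ) * (1 + 4 * η) + 37500 * η) * sqThreshold n q a b c := by ring
    _ ≤ (1 + 2 * ξ) * sqThreshold n q a b c := by
        -- As ξ ≤ 1, the coefficient is at most 1 + ξ + 8η + 37500η, and 40000η ≤ ξ.
        refine mul_le_mul_of_nonneg_right ?_ k3
        nlinarith

end Chaining

/-! ### Sub-Gaussian tails and the union bounds. -/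

section Noise

/-- The noise as a vector. -/
noncomputable def noiseVec {Ω : Type*} {n : ℕ} (ε : Fin n → Ω → ℝ) (ω : Ω) : EuclideanSpace ℝ (Fin n) :=
  WithLp.toLp 2 fun i => ε i ω

lemma contrast_noiseVec {Ω : Type*} {n : ℕ} (ε : Fin n → Ω → ℝ) (ω : Ω) {a b c : ℕ} (ha : 1 ≤ a) (hab : a < b)
    (hbc : b < c) (hc : c ≤ n + 1) :
    contrast (noiseVec ε ω) a b c = ∑ i, splitVec n a b c i * ε i ω := by
  rw [← inner_splitVec _ ha hab hbc hc, PiLp.inner_apply]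
  refine Finset.sum_congr rfl fun i _ => ?_
  simp only [noiseVec, RCLike.inner_apply, conj_trivial]
  ring

variable {Ω : Type*} [MeasurableSpace Ω] {P : Measure Ω} {n : ℕ}
  {ε : Fin n → Ω → ℝ}

/-- A linear form of the noise is sub-Gaussian with parameter ∑ cᵢ²; the two Chernoff tails give the
factor 2. -/
lemma IsNoise.measureReal_lt_sq_le [IsProbabilityMeasure P] (hε : IsNoise ε P) (c : Fin n → ℝ)
    {v : ℝ} (hv : ∑ i, c i ^ 2 = v) (hv0 : 0 < v) {x : ℝ} (hx : 0 ≤ x) :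
    P.real {ω | v * x < (∑ i, c i * ε i ω) ^ 2} ≤ 2 * Real.exp (-x / 2) := by
  have hind : iIndepFun (fun i => fun ω => c i * ε i ω) P :=
    hε.indep.comp (fun i y => c i * y) fun i => measurable_const_mul (c i)
  have hsub := HasSubgaussianMGF.sum_of_iIndepFun (s := Finset.univ) hind
    (c := fun i => (⟨c i ^ 2, sq_nonneg _⟩ * 1 : NNReal)) fun i _ => (hε.subgaussian i).const_mul (c i)
  have hparam : ((∑ i, (⟨c i ^ 2, sq_nonneg _⟩ * 1 : NNReal) : NNReal) : ℝ) = v := by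
    push_cast
    rw [← hv]
    exact Finset.sum_congr rfl fun i _ => mul_one _
  have h0 : 0 ≤ √(v * x) := Real.sqrt_nonneg _
  have hexp : -√(v * x) ^ 2 / (2 * v) = -x / 2 := by
    rw [Real.sq_sqrt (mul_nonneg hv0.le hx)]
    field_simp
  have h1 := hsub.measure_ge_le h0
  have h2 := hsub.neg.measure_ge_le h0
  rw [hparam, hexp] at h1 h2
  have hincl : {ω | v * x < (∑ i, c i * ε i ω) ^ 2}
      ⊆ {ω | √(v * x) ≤ ∑ i, c i * ε i ω}
        ∪ {ω | √(v * x) ≤ (-fun ω => ∑ i, c i * ε i ω) ω} := by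
    intro ω hω
    have h3 : √(v * x) ≤ |∑ i, c i * ε i ω| := by
      rw [← Real.sqrt_sq_eq_abs]
      exact Real.sqrt_le_sqrt (le_of_lt hω)
    rcases le_abs.1 h3 with h4 | h4
    · exact Or.inl h4
    · exact Or.inr h4
  calc P.real {ω | v * x < (∑ i, c i * ε i ω) ^ 2} ≤ _ := measureReal_mono hincl (measure_ne_top _ _)
    _ ≤ _ := measureReal_union_le _ _
    _ ≤ _ := by linarith

/-- The sum of the first `k` coordinates. -/
noncomputable def partialSum (v : EuclideanSpace ℝ (Fin n)) (k : ℕ) : ℝ :=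
  ∑ i ∈ Finset.Ico 1 (k + 1), coord v i

lemma partialSum_sub (v : EuclideanSpace ℝ (Fin n)) {a b : ℕ} (hab : a ≤ b) :
    partialSum v b - partialSum v a = ∑ i ∈ Finset.Ico (a + 1) (b + 1), coord v i := by
  unfold partialSum
  rw [sub_eq_iff_eq_add', Finset.sum_Ico_consecutive _ (by omega) (by omega)]

/-- Between-group variance identity. The shift by one appears because the partial sum up to `a` ends
just before position `a + 1`. -/
lemma contrast_sq_eq_splitGain (v : EuclideanSpace ℝ (Fin n)) {a b c : ℕ} (hab : a < b)
    (hbc : b < c) :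
    contrast v (a + 1) (b + 1) (c + 1) ^ 2 = splitGain (partialSum v) a b c := by
  have h1 : (0 : ℝ) < (b : ℝ) - a := sub_pos.2 (by exact_mod_cast hab)
  have h2 : (0 : ℝ) < (c : ℝ) - b := sub_pos.2 (by exact_mod_cast hbc)
  have h3 : (0 : ℝ) < (c : ℝ) - a := by linarith
  rw [contrast_sq v (by omega) (by omega), segMean, segMean, ← partialSum_sub v hab.le,
    ← partialSum_sub v hbc.le, splitGain]
  push_cast
  simp only [add_sub_add_right_eq_sub]
  generalize partialSum v a = x
  generalize partialSum v b = y
  generalize partialSum v c = z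
  obtain ⟨s, hs⟩ : ∃ s : ℝ, s = (b : ℝ) - a := ⟨_, rfl⟩
  obtain ⟨t, ht⟩ : ∃ t : ℝ, t = (c : ℝ) - b := ⟨_, rfl⟩
  have hst : (c : ℝ) - a = s + t := by rw [hs, ht]; ring
  rw [hst, ← hs, ← ht]
  rw [← hs] at h1
  rw [← ht] at h2
  field_simp
  ring

lemma sqThreshold_succ (q : ℝ) (a b c : ℕ) :
    sqThreshold n q (a + 1) (b + 1) (c + 1) = sqThreshold n q a b c := by
  unfold sqThreshold
  push_cast
  simp only [add_sub_add_right_eq_sub]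

lemma contrastsBounded_of_splitGain_le {M q : ℝ} {v : EuclideanSpace ℝ (Fin n)}
    (h : ∀ a b c : ℕ, a < b → b < c → c ≤ n →
      splitGain (partialSum v) a b c ≤ M * sqThreshold n q a b c) : ContrastsBounded M q v := by
  intro a b c ha hab hbc hc
  obtain ⟨a, rfl⟩ : ∃ a', a = a' + 1 := ⟨a - 1, by omega⟩
  obtain ⟨b, rfl⟩ : ∃ b', b = b' + 1 := ⟨b - 1, by omega⟩
  obtain ⟨c, rfl⟩ : ∃ c', c = c' + 1 := ⟨c - 1, by omega⟩
  rw [contrast_sq_eq_splitGain v (by omega) (by omega), sqThreshold_succ]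
  exact h a b c (by omega) (by omega) (by omega)

lemma IsNoise.measureReal_splitGain_gt_le [IsProbabilityMeasure P] (hε : IsNoise ε P) {x : ℝ}
    (hx : 0 ≤ x) {a b c : ℕ} (hab : a < b) (hbc : b < c) (hc : c ≤ n) :
    P.real {ω | x < splitGain (partialSum (noiseVec ε ω)) a b c} ≤ 2 * Real.exp (-x / 2) := by
  have h1 : ∑ i, splitVec n (a + 1) (b + 1) (c + 1) i ^ 2 = 1 := by
    rw [← norm_splitVec_sq (n := n) (a := a + 1) (b := b + 1) (c := c + 1) (by omega) (by omega)
      (by omega) (by omega), EuclideanSpace.real_norm_sq_eq]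
  have h2 := hε.measureReal_lt_sq_le _ h1 one_pos hx
  rw [one_mul] at h2
  convert h2 using 5 with ω
  rw [← contrast_sq_eq_splitGain _ hab hbc, contrast_noiseVec ε ω (by omega) (by omega) (by omega)
    (by omega)]

lemma IsNoise.measureReal_block_gt_le [IsProbabilityMeasure P] (hε : IsNoise ε P) {x : ℝ}
    (hx : 0 ≤ x) {a b : ℕ} (hab : a < b) (hb : b ≤ n) :
    P.real {ω | ((b : ℝ) - a) * x < (partialSum (noiseVec ε ω) b - partialSum (noiseVec ε ω) a) ^ 2}
      ≤ 2 * Real.exp (-x / 2) := by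
  have hsum : ∀ v : EuclideanSpace ℝ (Fin n), partialSum v b - partialSum v a
      = ∑ i : Fin n, (if a + 1 ≤ (i : ℕ) + 1 ∧ (i : ℕ) + 1 < b + 1 then (1 : ℝ) else 0) * v i := by
    intro v
    rw [partialSum_sub v hab.le, sum_Ico_coord v (by omega) (by omega)]
    refine Finset.sum_congr rfl fun i _ => ?_
    split_ifs <;> simp
  have h1 : ∑ i : Fin n,
      (if a + 1 ≤ (i : ℕ) + 1 ∧ (i : ℕ) + 1 < b + 1 then (1 : ℝ) else 0) ^ 2 = (b : ℝ) - a := by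
    have h2 := hsum (WithLp.toLp 2 fun _ => 1)
    rw [partialSum_sub _ hab.le] at h2
    simp only [mul_one] at h2
    have h3 : ∀ i ∈ Finset.Ico (a + 1) (b + 1),
        coord (WithLp.toLp 2 fun _ : Fin n => (1 : ℝ)) i = 1 := by
      intro i hi
      rw [Finset.mem_Ico] at hi
      unfold coord
      rw [dif_pos ⟨by omega, by omega⟩]
    rw [Finset.sum_congr rfl h3, Finset.sum_const, Nat.card_Ico, Nat.add_sub_add_right,
      nsmul_eq_mul, mul_one, Nat.cast_sub hab.le] at h2
    rw [h2]
    refine Finset.sum_congr rfl fun i _ => ?_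
    split_ifs <;> simp
  have h2 := hε.measureReal_lt_sq_le _ h1 (sub_pos.2 (by exact_mod_cast hab)) hx
  simp only [hsum]
  exact h2

/-- The factor 2 in `DyadicBounded` squares to 4, so each block fails with probability at most
2e^(-2q)(2^j/n)². There are at most n/2^j blocks, and the remaining ∑ 2^j/n is at most 2. -/
lemma IsNoise.measureReal_not_dyadicBounded_le [IsProbabilityMeasure P] (hε : IsNoise ε P)
    (hn : 1 ≤ n) {q : ℝ} (hq : 0 ≤ q) :
    P.real {ω | ¬ DyadicBounded (partialSum (noiseVec ε ω)) n q} ≤ 4 * Real.exp (-(2 * q)) := by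
  have hn0 : (0 : ℝ) < n := by exact_mod_cast hn
  have hincl : {ω | ¬ DyadicBounded (partialSum (noiseVec ε ω)) n q}
      ⊆ ⋃ j ∈ Finset.range (Nat.log 2 n + 1), ⋃ β ∈ Finset.range (n / 2 ^ j),
        {ω | ((((β + 1) * 2 ^ j : ℕ) : ℝ) - (β * 2 ^ j : ℕ)) * (4 * (q + Real.log (n / 2 ^ j)))
          < (partialSum (noiseVec ε ω) ((β + 1) * 2 ^ j)
            - partialSum (noiseVec ε ω) (β * 2 ^ j)) ^ 2} := by
    intro ω hω
    simp only [DyadicBounded, Set.mem_ofPred_eq, not_forall] at hω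
    obtain ⟨j, β, hβ, hlt⟩ := hω
    have hj : 2 ^ j ≤ n := le_trans (Nat.le_mul_of_pos_left _ (by omega)) hβ
    simp only [Set.mem_iUnion, Finset.mem_range]
    refine ⟨j, Nat.lt_succ_of_le (Nat.le_log_of_pow_le (by norm_num) hj), β,
      (Nat.le_div_iff_mul_le (by positivity)).2 hβ, ?_⟩
    by_contra hcon
    simp only [Set.mem_ofPred_eq, not_lt] at hcon
    refine hlt (abs_le_of_sq_le_sq ?_ (by positivity))
    have hjR : (2 : ℝ) ^ j ≤ n := by exact_mod_cast hj
    rw [mul_pow, Real.sq_sqrt (logScale_nonneg hq (by positivity) hjR), logScale]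
    refine hcon.trans_eq ?_
    push_cast
    ring
  have hterm : ∀ j ∈ Finset.range (Nat.log 2 n + 1), ∀ β ∈ Finset.range (n / 2 ^ j),
      P.real {ω | ((((β + 1) * 2 ^ j : ℕ) : ℝ) - (β * 2 ^ j : ℕ)) * (4 * (q + Real.log (n / 2 ^ j)))
          < (partialSum (noiseVec ε ω) ((β + 1) * 2 ^ j)
            - partialSum (noiseVec ε ω) (β * 2 ^ j)) ^ 2}
        ≤ 2 * (Real.exp (-(2 * q)) * (2 ^ j / n) ^ 2) := by
    intro j hj β hβ
    have hj' : 2 ^ j ≤ n :=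
      Nat.pow_le_of_le_log (by omega) (Nat.lt_succ_iff.1 (Finset.mem_range.1 hj))
    have hjR : (2 : ℝ) ^ j ≤ n := by exact_mod_cast hj'
    have hlog : 0 ≤ Real.log ((n : ℝ) / 2 ^ j) :=
      Real.log_nonneg (by rwa [le_div_iff₀ (by positivity), one_mul])
    refine (hε.measureReal_block_gt_le (by positivity)
      (Nat.mul_lt_mul_of_pos_right (Nat.lt_succ_self β) (by positivity))
      ((Nat.le_div_iff_mul_le (by positivity)).1 (Finset.mem_range.1 hβ))).trans_eq ?_
    rw [show -(4 * (q + Real.log ((n : ℝ) / 2 ^ j))) / 2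
      = -(2 * q) + -(Real.log ((n : ℝ) / 2 ^ j) + Real.log ((n : ℝ) / 2 ^ j)) by ring, Real.exp_add,
      Real.exp_neg (_ + _), Real.exp_add, Real.exp_log (by positivity)]
    congr 2
    field_simp
  calc _ ≤ _ := measureReal_mono hincl (measure_ne_top _ _)
    _ ≤ ∑ j ∈ Finset.range (Nat.log 2 n + 1), ∑ β ∈ Finset.range (n / 2 ^ j),
        2 * (Real.exp (-(2 * q)) * (2 ^ j / n) ^ 2) := by
      refine (measureReal_biUnion_finset_le _ _).trans (Finset.sum_le_sum fun j hj => ?_)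
      exact (measureReal_biUnion_finset_le _ _).trans (Finset.sum_le_sum fun β hβ => hterm j hj β hβ)
    _ ≤ ∑ j ∈ Finset.range (Nat.log 2 n + 1), 2 * Real.exp (-(2 * q)) / n * 2 ^ j := by
      refine Finset.sum_le_sum fun j _ => ?_
      rw [Finset.sum_const, Finset.card_range, nsmul_eq_mul]
      have h1 : ((n / 2 ^ j : ℕ) : ℝ) ≤ n / 2 ^ j := by
        have := Nat.cast_div_le (m := n) (n := 2 ^ j) (α := ℝ)
        exact_mod_cast this
      calc ((n / 2 ^ j : ℕ) : ℝ) * (2 * (Real.exp (-(2 * q)) * (2 ^ j / n) ^ 2))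
          ≤ n / 2 ^ j * (2 * (Real.exp (-(2 * q)) * (2 ^ j / n) ^ 2)) := by gcongr
        _ = _ := by field_simp
    _ ≤ 4 * Real.exp (-(2 * q)) := by
      rw [← Finset.mul_sum]
      have h1 : ∑ j ∈ Finset.range (Nat.log 2 n + 1), (2 : ℝ) ^ j ≤ 2 * n := by
        rw [geom_sum_eq (by norm_num)]
        have h2 : 2 ^ (Nat.log 2 n) ≤ n := Nat.pow_log_le_self 2 (by omega)
        have h3 : (2 : ℝ) ^ (Nat.log 2 n) ≤ n := by exact_mod_cast h2
        rw [pow_succ]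
        norm_num
        linarith
      calc _ ≤ 2 * Real.exp (-(2 * q)) / n * (2 * n) := by gcongr
        _ = _ := by field_simp; ring

/-- The part 1 of the factor 1 + ξ yields 2^(min i j)/n, which balances the number of middle points.
The part ξ yields decay in the scales, because log(n/2^m) ≥ (J - m)/2 ≥ ((J - i) + (J - j))/4 for m
= min i j. The loss of log 4 costs 4^(1+ξ) ≤ 16. -/
lemma exp_neg_sqThreshold_le {q ξ : ℝ} (hq : 0 ≤ q) (hξ : 0 ≤ ξ) (hξ1 : ξ ≤ 1) {a b c i j J : ℕ}
    (hab : a < b) (hbc : b < c) (hc : c ≤ n) (hi : b ≤ a + 2 ^ (i + 2)) (hj : c ≤ b + 2 ^ (j + 2))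
    (hiJ : i ≤ J) (hjJ : j ≤ J) (hJ : 2 ^ J ≤ n) :
    Real.exp (-((1 + ξ) * sqThreshold n q a b c) / 2)
      ≤ 16 * Real.exp (-(q / 2)) * (2 ^ (min i j) / n) * Real.exp (-(ξ / 4)) ^ (J - i)
        * Real.exp (-(ξ / 4)) ^ (J - j) := by
  have e1 : (0 : ℝ) < (b : ℝ) - a := sub_pos.2 (by exact_mod_cast hab)
  have e2 : (0 : ℝ) < (c : ℝ) - b := sub_pos.2 (by exact_mod_cast hbc)
  have hcn : (c : ℝ) ≤ n := by exact_mod_cast hc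
  have ha0 : (0 : ℝ) ≤ a := by positivity
  have hn0 : (0 : ℝ) < n := by linarith
  have hi' : (b : ℝ) - a ≤ 2 ^ (i + 2) := by
    have : (b : ℝ) ≤ a + 2 ^ (i + 2) := by exact_mod_cast hi
    linarith
  have hj' : (c : ℝ) - b ≤ 2 ^ (j + 2) := by
    have : (c : ℝ) ≤ b + 2 ^ (j + 2) := by exact_mod_cast hj
    linarith
  obtain ⟨X, hX⟩ : ∃ X, X = (n : ℝ) / ((b : ℝ) - a) + (n : ℝ) / ((c : ℝ) - b) := ⟨_, rfl⟩
  have p1 : 0 ≤ (n : ℝ) / ((b : ℝ) - a) := by positivity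
  have p2 : 0 ≤ (n : ℝ) / ((c : ℝ) - b) := by positivity
  have hX1 : 1 ≤ X := by
    have : 1 ≤ (n : ℝ) / ((b : ℝ) - a) := by rw [le_div_iff₀ e1]; linarith
    linarith
  obtain ⟨m, hm⟩ : ∃ m, m = min i j := ⟨_, rfl⟩
  have hXm : (n : ℝ) / 2 ^ (m + 2) ≤ X := by
    rcases min_choice i j with h | h
    · have : (n : ℝ) / 2 ^ (m + 2) ≤ n / ((b : ℝ) - a) := by rw [hm, h]; gcongr
      linarith
    · have : (n : ℝ) / 2 ^ (m + 2) ≤ n / ((c : ℝ) - b) := by rw [hm, h]; gcongr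
      linarith
  have hJR : (2 : ℝ) ^ J ≤ n := by exact_mod_cast hJ
  have hlogm : Real.log ((n : ℝ) / 2 ^ (m + 2)) = Real.log ((n : ℝ) / 2 ^ m) - Real.log 4 := by
    rw [← Real.log_div (by positivity) (by norm_num)]
    congr 1
    rw [pow_add]
    field_simp
    norm_num
  have hlogX : Real.log ((n : ℝ) / 2 ^ m) - Real.log 4 ≤ Real.log X := by
    rw [← hlogm]; exact Real.log_le_log (by positivity) hXm
  have hmJ : m ≤ J := by omega
  have hΛ : ((J : ℝ) - m) / 2 ≤ Real.log ((n : ℝ) / 2 ^ m) := by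
    have h1 : Real.log ((2 : ℝ) ^ (J - m)) ≤ Real.log ((n : ℝ) / 2 ^ m) := by
      apply Real.log_le_log (by positivity)
      rw [le_div_iff₀ (by positivity), ← pow_add, Nat.sub_add_cancel hmJ]
      exact hJR
    rw [Real.log_pow, Nat.cast_sub hmJ] at h1
    have h2 := Real.log_two_gt_d9
    have h3 : (0 : ℝ) ≤ (J : ℝ) - m := sub_nonneg.2 (by exact_mod_cast hmJ)
    nlinarith
  have hΛ' : ((J - i : ℕ) : ℝ) + ((J - j : ℕ) : ℝ) ≤ 2 * ((J : ℝ) - m) := by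
    have h1 : (J - i) + (J - j) + 2 * m ≤ 2 * J := by omega
    have h2 : ((J - i : ℕ) : ℝ) + ((J - j : ℕ) : ℝ) + 2 * m ≤ 2 * J := by exact_mod_cast h1
    linarith
  have h4 : 0 ≤ Real.log 4 := Real.log_nonneg (by norm_num)
  have hexp : -((1 + ξ) * sqThreshold n q a b c) / 2
      ≤ Real.log 16 + -(q / 2) + -Real.log ((n : ℝ) / 2 ^ m) + ((J - i : ℕ) : ℝ) * (-(ξ / 4))
        + ((J - j : ℕ) : ℝ) * (-(ξ / 4)) := by
    rw [sqThreshold_eq_sum (by omega) q hab hbc, ← hX, show (16 : ℝ) = 4 ^ 2 by norm_num,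
      Real.log_pow]
    push_cast
    have h5 : ξ * (((J - i : ℕ) : ℝ) + ((J - j : ℕ) : ℝ)) / 4
        ≤ ξ * Real.log ((n : ℝ) / 2 ^ m) := by
      have := mul_le_mul_of_nonneg_left (show (((J - i : ℕ) : ℝ) + ((J - j : ℕ) : ℝ)) / 4
        ≤ Real.log ((n : ℝ) / 2 ^ m) by linarith) hξ
      linarith
    have h6 : ξ * Real.log ((n : ℝ) / 2 ^ m) - Real.log 4 ≤ ξ * Real.log X := by
      have := mul_le_mul_of_nonneg_left hlogX hξ
      nlinarith
    have h7 : 0 ≤ ξ * q := mul_nonneg hξ hq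
    linarith
  refine (Real.exp_le_exp.2 hexp).trans_eq ?_
  rw [Real.exp_add, Real.exp_add, Real.exp_add, Real.exp_add, Real.exp_log (by norm_num),
    Real.exp_neg (Real.log _), Real.exp_log (by positivity), Real.exp_nat_mul, Real.exp_nat_mul,
    inv_div, hm]

lemma sum_exp_pow_le {ξ : ℝ} (hξ : 0 < ξ) (hξ1 : ξ ≤ 1) (J : ℕ) :
    ∑ i ∈ Finset.range (J + 1), Real.exp (-(ξ / 4)) ^ (J - i) ≤ 8 / ξ := by
  have h1 := Finset.sum_range_reflect (fun i => Real.exp (-(ξ / 4)) ^ i) (J + 1)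
  simp only [Nat.add_sub_cancel] at h1
  rw [h1]
  have hy0 : 0 < Real.exp (-(ξ / 4)) := Real.exp_pos _
  have hy : ξ / 8 ≤ 1 - Real.exp (-(ξ / 4)) := by
    have h2 : ξ / 4 + 1 ≤ Real.exp (ξ / 4) := Real.add_one_le_exp _
    have h3 : Real.exp (-(ξ / 4)) ≤ (ξ / 4 + 1)⁻¹ := by
      rw [Real.exp_neg]
      exact inv_anti₀ (by linarith) h2
    have h4 : (ξ / 4 + 1)⁻¹ ≤ 1 - ξ / 8 := by
      rw [inv_le_iff_one_le_mul₀ (by linarith)]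
      nlinarith
    linarith
  have h2 := mul_neg_geom_sum (Real.exp (-(ξ / 4))) (J + 1)
  have h3 : 0 ≤ ∑ i ∈ Finset.range (J + 1), Real.exp (-(ξ / 4)) ^ i :=
    Finset.sum_nonneg fun i _ => by positivity
  rw [le_div_iff₀ hξ]
  have h4 : 0 ≤ Real.exp (-(ξ / 4)) ^ (J + 1) := by positivity
  have h5 := mul_le_mul_of_nonneg_right hy h3
  linarith

/-- The 2·4ᵏ from the middle points, the 16·16ᵏ pairs of offsets and the 32 of each tail make
1024·64ᵏ; the two geometric sums over scales contribute (8/ξ)². -/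
lemma IsNoise.measureReal_not_gridBounded_le [IsProbabilityMeasure P] (hε : IsNoise ε P)
    (hn : 1 ≤ n) (k : ℕ) {q ξ : ℝ} (hq : 0 ≤ q) (hξ : 0 < ξ) (hξ1 : ξ ≤ 1) :
    P.real {ω | ¬ GridBounded (partialSum (noiseVec ε ω)) n k q (1 + ξ)}
      ≤ 65536 * 64 ^ k / ξ ^ 2 * Real.exp (-(q / 2)) := by
  have hn0 : (0 : ℝ) < n := by exact_mod_cast hn
  obtain ⟨J, hJ⟩ : ∃ J, J = Nat.log 2 n := ⟨_, rfl⟩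
  have hJn : 2 ^ J ≤ n := hJ ▸ Nat.pow_log_le_self 2 (by omega)
  obtain ⟨y, hy⟩ : ∃ y, y = Real.exp (-(ξ / 4)) := ⟨_, rfl⟩
  have hy0 : 0 < y := hy ▸ Real.exp_pos _
  -- The indices determine the triple, so each set is empty or contained in a single deviation
  -- event.
  let bad : ℕ → ℕ → ℕ → ℕ × ℕ → Set Ω := fun i j β p => {ω | ∃ a b c : ℕ,
      b = mesh k (min i j) * β ∧ a = mesh k i * (b / mesh k i - p.1) ∧
      c = mesh k j * (b / mesh k j + p.2) ∧ a < b ∧ b < c ∧ c ≤ n ∧ b ≤ a + 2 ^ (i + 2) ∧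
      c ≤ b + 2 ^ (j + 2) ∧
      (1 + ξ) * sqThreshold n q a b c < splitGain (partialSum (noiseVec ε ω)) a b c}
  have hincl : {ω | ¬ GridBounded (partialSum (noiseVec ε ω)) n k q (1 + ξ)}
      ⊆ ⋃ i ∈ Finset.range (J + 1), ⋃ j ∈ Finset.range (J + 1),
        ⋃ β ∈ Finset.range (n / mesh k (min i j) + 1),
        ⋃ p ∈ Finset.range (4 ^ (k + 1)) ×ˢ Finset.range (4 ^ (k + 1)), bad i j β p := by
    intro ω hω
    simp only [GridBounded, Set.mem_ofPred_eq, not_forall, ← hJ] at hω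
    obtain ⟨i, hi, j, hj, β, hβ, p, hp, a, b, c, h1, h2, h3, h4, h5, h6, h7, h8, h9⟩ := hω
    simp only [Set.mem_iUnion]
    exact ⟨i, hi, j, hj, β, hβ, p, hp, a, b, c, h1, h2, h3, h4, h5, h6, h7, h8, not_le.1 h9⟩
  have hterm : ∀ i ∈ Finset.range (J + 1), ∀ j ∈ Finset.range (J + 1), ∀ β p,
      P.real (bad i j β p)
        ≤ 32 * Real.exp (-(q / 2)) * (2 ^ (min i j) / n) * y ^ (J - i) * y ^ (J - j) := by
    intro i hi j hj β p
    have hiJ := Nat.lt_succ_iff.1 (Finset.mem_range.1 hi)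
    have hjJ := Nat.lt_succ_iff.1 (Finset.mem_range.1 hj)
    by_cases hne : (bad i j β p).Nonempty
    · obtain ⟨-, a, b, c, h1, h2, h3, h4, h5, h6, h7, h8, -⟩ := hne
      have hsub : bad i j β p ⊆
          {ω | (1 + ξ) * sqThreshold n q a b c < splitGain (partialSum (noiseVec ε ω)) a b c} := by
        rintro ω ⟨a', b', c', h1', h2', h3', -, -, -, -, -, h9⟩
        obtain rfl : b' = b := h1'.trans h1.symm
        obtain rfl : a' = a := h2'.trans h2.symm
        obtain rfl : c' = c := h3'.trans h3.symm
        exact h9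
      have hthr : 0 ≤ sqThreshold n q a b c := by
        rw [← sqThreshold_succ]
        exact hq.trans (le_sqThreshold q (by omega) (by omega) (by omega) (by omega))
      have k1 := exp_neg_sqThreshold_le hq hξ.le hξ1 h4 h5 h6 h7 h8 hiJ hjJ hJn
      rw [← hy] at k1
      calc _ ≤ _ := measureReal_mono hsub (measure_ne_top _ _)
        _ ≤ _ := hε.measureReal_splitGain_gt_le (by positivity) h4 h5 h6
        _ ≤ _ := by linarith
    · rw [Set.not_nonempty_iff_eq_empty.1 hne, measureReal_empty]
      positivity
  have hcard : ∀ i ∈ Finset.range (J + 1), ∀ j ∈ Finset.range (J + 1),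
      ((n / mesh k (min i j) + 1 : ℕ) : ℝ) * (2 ^ (min i j) / n) ≤ 2 * 4 ^ k := by
    intro i hi j hj
    have hmJ : min i j ≤ J := by
      rw [Finset.mem_range] at hi
      omega
    have h1 : mesh k (min i j) ≤ n :=
      (Nat.pow_le_pow_right (by norm_num) (by omega)).trans hJn
    have h2 : (2 : ℝ) ^ (min i j) ≤ mesh k (min i j) * 4 ^ k := by
      have : 2 ^ (min i j) ≤ mesh k (min i j) * 4 ^ k := by
        unfold mesh
        rw [show 4 = 2 ^ 2 by norm_num, ← pow_mul, ← pow_add]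
        exact Nat.pow_le_pow_right (by norm_num) (by omega)
      exact_mod_cast this
    have h3 : (0 : ℝ) < mesh k (min i j) := by exact_mod_cast mesh_pos k _
    have h4 : ((n / mesh k (min i j) + 1 : ℕ) : ℝ) ≤ 2 * (n / mesh k (min i j)) := by
      have h5 : ((n / mesh k (min i j) : ℕ) : ℝ) ≤ n / mesh k (min i j) := Nat.cast_div_le
      have h6 : (1 : ℝ) ≤ n / mesh k (min i j) := by
        rw [le_div_iff₀ h3, one_mul]
        exact_mod_cast h1
      push_cast
      linarith
    calc _ ≤ 2 * ((n : ℝ) / mesh k (min i j)) * (mesh k (min i j) * 4 ^ k / n) := by gcongr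
      _ = 2 * 4 ^ k := by field_simp
  calc _ ≤ _ := measureReal_mono hincl (measure_ne_top _ _)
    _ ≤ ∑ i ∈ Finset.range (J + 1), ∑ j ∈ Finset.range (J + 1),
        ∑ β ∈ Finset.range (n / mesh k (min i j) + 1),
        ∑ p ∈ Finset.range (4 ^ (k + 1)) ×ˢ Finset.range (4 ^ (k + 1)),
          32 * Real.exp (-(q / 2)) * (2 ^ (min i j) / n) * y ^ (J - i) * y ^ (J - j) := by
      refine (measureReal_biUnion_finset_le _ _).trans (Finset.sum_le_sum fun i hi => ?_)
      refine (measureReal_biUnion_finset_le _ _).trans (Finset.sum_le_sum fun j hj => ?_)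
      refine (measureReal_biUnion_finset_le _ _).trans (Finset.sum_le_sum fun β _ => ?_)
      exact (measureReal_biUnion_finset_le _ _).trans
        (Finset.sum_le_sum fun p _ => hterm i hi j hj β p)
    _ ≤ ∑ i ∈ Finset.range (J + 1), ∑ j ∈ Finset.range (J + 1),
        1024 * 64 ^ k * Real.exp (-(q / 2)) * (y ^ (J - i) * y ^ (J - j)) := by
      refine Finset.sum_le_sum fun i hi => Finset.sum_le_sum fun j hj => ?_
      rw [Finset.sum_const, Finset.sum_const, Finset.card_product, Finset.card_range,
        Finset.card_range, nsmul_eq_mul, nsmul_eq_mul]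
      have h1 := hcard i hi j hj
      have h2 : (64 : ℝ) ^ k = 4 ^ k * (4 ^ k * 4 ^ k) := by
        rw [← mul_pow, ← mul_pow]; norm_num
      have h3 := mul_le_mul_of_nonneg_right h1
        (show 0 ≤ (16 * (4 ^ k * 4 ^ k)) * (32 * Real.exp (-(q / 2)) * (y ^ (J - i) * y ^ (J - j)))
          by positivity)
      calc _ = ((n / mesh k (min i j) + 1 : ℕ) : ℝ) * (2 ^ (min i j) / n) *
            ((16 * (4 ^ k * 4 ^ k)) * (32 * Real.exp (-(q / 2)) * (y ^ (J - i) * y ^ (J - j)))) := by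
            push_cast
            ring
        _ ≤ _ := h3
        _ = _ := by rw [h2]; ring
    _ = 1024 * 64 ^ k * Real.exp (-(q / 2)) * ((∑ i ∈ Finset.range (J + 1), y ^ (J - i))
          * ∑ j ∈ Finset.range (J + 1), y ^ (J - j)) := by
      rw [Finset.sum_mul_sum, Finset.mul_sum]
      exact Finset.sum_congr rfl fun i _ => (Finset.mul_sum _ _ _).symm
    _ ≤ 1024 * 64 ^ k * Real.exp (-(q / 2)) * ((8 / ξ) * (8 / ξ)) := by
      have h1 := sum_exp_pow_le hξ hξ1 J
      rw [← hy] at h1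
      have h2 : 0 ≤ ∑ i ∈ Finset.range (J + 1), y ^ (J - i) :=
        Finset.sum_nonneg fun i _ => by positivity
      gcongr
    _ = _ := by field_simp; ring

lemma IsNoise.measurableSet_contrastsBounded (hε : IsNoise ε P) (M q : ℝ) :
    MeasurableSet {ω | ContrastsBounded M q (noiseVec ε ω)} := by
  simp only [ContrastsBounded, Set.ofPred_forall]
  refine MeasurableSet.iInter fun a => MeasurableSet.iInter fun b => MeasurableSet.iInter fun c =>
    MeasurableSet.iInter fun h1 => MeasurableSet.iInter fun h2 => MeasurableSet.iInter fun h3 =>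
    MeasurableSet.iInter fun h4 => ?_
  simp only [contrast_noiseVec ε _ h1 h2 h3 h4]
  exact measurableSet_le
    ((Finset.measurable_sum _ fun i _ => (hε.measurable i).const_mul _).pow_const 2)
    measurable_const

/-- Uniform deviation inequality for the contrasts of the noise. -/
theorem IsNoise.measureReal_contrastsBounded_ge [IsProbabilityMeasure P] (hε : IsNoise ε P)
    (hn : 1 ≤ n) {q ξ : ℝ} (hξ : 0 < ξ) (hξ1 : ξ ≤ 1) (hq : 30 + 32 * Real.log ξ⁻¹ ≤ q) :
    1 - (65536 * 80000 ^ 6 + 4) * Real.exp (-(1 / 4 * q))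
      ≤ P.real {ω | ContrastsBounded (1 + 2 * ξ) q (noiseVec ε ω)} := by
  have hlogξ : 0 ≤ Real.log ξ⁻¹ := Real.log_nonneg ((one_le_inv₀ hξ).2 hξ1)
  have hq3 : 3 ≤ q := by linarith
  -- The precision `k + 1` is the least power that makes 40000η ≤ ξ; minimality keeps 2^(k+1) ≤
  -- 80000/ξ, which bounds the size of the grid.
  obtain ⟨k, hk1, hk2⟩ := exists_nat_pow_near (x := 40000 / ξ) (y := 2)
    (by rw [le_div_iff₀ hξ]; linarith) (by norm_num)
  have hk3 : (2 : ℝ) ^ (k + 1) ≤ 80000 / ξ := by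
    rw [pow_succ]
    calc (2 : ℝ) ^ k * 2 ≤ 40000 / ξ * 2 := by gcongr
      _ = 80000 / ξ := by ring
  have hkξ : 40000 * ((2 : ℝ) ^ (k + 1))⁻¹ ≤ ξ := by
    rw [← div_eq_mul_inv, div_le_iff₀ (by positivity), mul_comm]
    rw [div_lt_iff₀ hξ] at hk2
    exact hk2.le
  have hkq : Real.log ((((2 : ℝ) ^ (k + 1))⁻¹ ^ 2)⁻¹) ≤ q := by
    rw [inv_pow, inv_inv, Real.log_pow]
    have h1 : Real.log ((2 : ℝ) ^ (k + 1)) ≤ Real.log 80000 + Real.log ξ⁻¹ := by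
      rw [← Real.log_mul (by norm_num) (by positivity), ← div_eq_mul_inv]
      exact Real.log_le_log (by positivity) hk3
    have h2 : Real.log 80000 ≤ 12 := by
      have h3 : Real.log 80000 ≤ Real.log (2 ^ 17) := Real.log_le_log (by norm_num) (by norm_num)
      rw [Real.log_pow] at h3
      have := Real.log_two_lt_d9
      push_cast at h3
      linarith
    push_cast
    linarith
  have hincl : {ω | ContrastsBounded (1 + 2 * ξ) q (noiseVec ε ω)}ᶜ
      ⊆ {ω | ¬ DyadicBounded (partialSum (noiseVec ε ω)) n q}
        ∪ {ω | ¬ GridBounded (partialSum (noiseVec ε ω)) n (k + 1) q (1 + ξ)} := by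
    intro ω hω
    by_contra hcon
    simp only [Set.mem_union, Set.mem_ofPred_eq, not_or, not_not] at hcon
    exact hω (contrastsBounded_of_splitGain_le fun a b c hab hbc hc =>
      hcon.2.splitGain_le hcon.1 hq3 (by omega) hξ.le hξ1 hkξ hkq hab hbc hc)
  have h1 := probReal_compl_eq_one_sub (μ := P) (hε.measurableSet_contrastsBounded (1 + 2 * ξ) q)
  have h2 := (measureReal_mono (μ := P) hincl).trans (measureReal_union_le _ _)
  have h3 := hε.measureReal_not_dyadicBounded_le hn (show 0 ≤ q by linarith)
  have h4 := hε.measureReal_not_gridBounded_le hn (k + 1) (show 0 ≤ q by linarith) hξ hξ1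
  have h5 : Real.exp (-(2 * q)) ≤ Real.exp (-(1 / 4 * q)) := Real.exp_le_exp.2 (by linarith)
  have h6 : 65536 * 64 ^ (k + 1) / ξ ^ 2 * Real.exp (-(q / 2))
      ≤ 65536 * 80000 ^ 6 * Real.exp (-(1 / 4 * q)) := by
    have e1 : (64 : ℝ) ^ (k + 1) ≤ 80000 ^ 6 * (ξ⁻¹) ^ 6 := by
      calc (64 : ℝ) ^ (k + 1) = (2 ^ (k + 1)) ^ 6 := by
            rw [← pow_mul, mul_comm, pow_mul]; norm_num
        _ ≤ (80000 / ξ) ^ 6 := by gcongr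
        _ = _ := by rw [div_eq_mul_inv, mul_pow]
    -- Six powers come from 64^(k+1) and two from ξ⁻²; 8 log ξ⁻¹ ≤ q/4 is where the 32 in `hq` is
    -- needed. Half of the exponent q/2 is spent here.
    have e2 : (ξ⁻¹) ^ 8 ≤ Real.exp (1 / 4 * q) := by
      rw [← Real.exp_log (show 0 < ξ⁻¹ by positivity), ← Real.exp_nat_mul]
      apply Real.exp_le_exp.2
      push_cast
      linarith
    have e3 : Real.exp (1 / 4 * q) * Real.exp (-(q / 2)) = Real.exp (-(1 / 4 * q)) := by
      rw [← Real.exp_add]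
      congr 1
      ring
    calc 65536 * 64 ^ (k + 1) / ξ ^ 2 * Real.exp (-(q / 2))
        ≤ 65536 * (80000 ^ 6 * (ξ⁻¹) ^ 6) / ξ ^ 2 * Real.exp (-(q / 2)) := by gcongr
      _ = 65536 * 80000 ^ 6 * ((ξ⁻¹) ^ 8 * Real.exp (-(q / 2))) := by
          rw [div_eq_mul_inv, ← inv_pow]; ring
      _ ≤ 65536 * 80000 ^ 6 * (Real.exp (1 / 4 * q) * Real.exp (-(q / 2))) := by gcongr
      _ = _ := by rw [e3]
  linarith

end Noise

/-! ### Choice of the noise level and of the constants. -/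

section Assembly

variable {n : ℕ} {q : ℝ} {e : EuclideanSpace ℝ (Fin n)}

lemma ContrastsBounded.mono {M M' : ℝ} (h : ContrastsBounded M q e) (hM : M ≤ M') (hq : 0 ≤ q) :
    ContrastsBounded M' q e := fun a b c ha hab hbc hc =>
  (h a b c ha hab hbc hc).trans
    (mul_le_mul_of_nonneg_right hM (hq.trans (le_sqThreshold q hab hbc ha hc)))

/-- For u = min L 2 - 1 one has √L ≥ 1 + 2u/5, hence 0.1√L + 0.9 ≥ 1 + u/25. This allows the
precision ξ = u/25. -/
lemma noise_level_le {L : ℝ} (hL : 1 < L) :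
    1 + 2 * ((min L 2 - 1) / 25) ≤ (1.1 * √L + 0.9 - √L) ^ 2 ∧ (1.1 * √L + 0.9 - √L) ^ 2 ≤ L := by
  have hs1 : 1 < √L := Real.lt_sqrt_of_sq_lt (by simpa using hL)
  have hsL : √L ^ 2 = L := Real.sq_sqrt (by linarith)
  obtain ⟨u, hu⟩ : ∃ u, u = min L 2 - 1 := ⟨_, rfl⟩
  have hu0 : 0 < u := by
    have : 1 < min L 2 := lt_min hL (by norm_num)
    linarith
  have hu1 : u ≤ 1 := by
    have := min_le_right L 2
    linarith
  have hs2 : 1 + 2 / 5 * u ≤ √L := by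
    apply Real.le_sqrt_of_sq_le
    have := min_le_left L 2
    nlinarith
  rw [← hu]
  constructor
  · nlinarith
  · nlinarith

/-- Dividing by 25 adds at most 32 · 7/2 = 112 to 30, within the 150. -/
lemma log_inv_precision_le {L q : ℝ} (hL : 1 < L)
    (hq : 150 + (65536 * 80000 ^ 6 + 4) * Real.log ((min L 2 - 1)⁻¹) < q) :
    30 + 32 * Real.log ((min L 2 - 1) / 25)⁻¹ ≤ q ∧ 3 ≤ q := by
  have hu0 : 0 < min L 2 - 1 := sub_pos.2 (lt_min hL (by norm_num))
  have hu1 : min L 2 - 1 ≤ 1 := by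
    have := min_le_right L 2
    linarith
  have h1 : 0 ≤ Real.log ((min L 2 - 1)⁻¹) := Real.log_nonneg ((one_le_inv₀ hu0).2 hu1)
  have h2 : Real.log ((min L 2 - 1) / 25)⁻¹ = Real.log 25 + Real.log ((min L 2 - 1)⁻¹) := by
    rw [← Real.log_mul (by norm_num) (by positivity), inv_div, div_eq_mul_inv]
  have h3 : Real.log 25 ≤ 7 / 2 := by
    have h4 : Real.log 25 ≤ Real.log (2 ^ 5) := Real.log_le_log (by norm_num) (by norm_num)
    rw [Real.log_pow] at h4
    have := Real.log_two_lt_d9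
    push_cast at h4
    linarith
  have h5 : 32 * Real.log ((min L 2 - 1)⁻¹)
      ≤ (65536 * 80000 ^ 6 + 4) * Real.log ((min L 2 - 1)⁻¹) :=
    mul_le_mul_of_nonneg_right (by norm_num) h1
  rw [h2]
  constructor <;> linarith

end Assembly

end ChangePoint

theorem proposition9 :
    ∃ q₀ c₁ c₂ : ℝ, 0 < q₀ ∧ 0 < c₁ ∧ 0 < c₂ ∧
    ∀ L : ℝ, 1 < L →
    ∃ κ η : ℝ, 1 < κ ∧ 0 < η ∧ η < 1 ∧
    ∀ q : ℝ, q₀ + c₁ * Real.log ((min L 2 - 1)⁻¹) < q →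
    ∀ n : ℕ, 1 ≤ n →
    ∀ (Ω : Type*) [MeasurableSpace Ω] (P : MeasureTheory.Measure Ω)
      [MeasureTheory.IsProbabilityMeasure P] (ε : Fin n → Ω → ℝ), IsNoise ε P →
    ∃ A : Set Ω, MeasurableSet A ∧ 1 - c₁ * Real.exp (-(c₂ * q)) ≤ P.real A ∧
    ∀ (θ : EuclideanSpace ℝ (Fin n)) (ω : Ω), ω ∈ A →
    ∀ T : Finset ℕ, IsPLSE L q (observation θ ε ω) T →
      FewChangePoints θ η T ∧
      Detec θ κ q κ T ∧
      UnselectedLowEnergy θ (1.1 * Real.sqrt L + 0.9) q T := by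
  -- The large constant comes from the probability bound and also serves as the coefficient of the
  -- logarithm, where 32 would suffice. The event depends only on the noise, so it is fixed before
  -- θ.
  refine ⟨150, 65536 * 80000 ^ 6 + 4, 1 / 4, by norm_num, by norm_num, by norm_num,
    fun L hL => ⟨64 * L, endRatio L, by linarith, endRatio_pos hL,
      (endRatio_le hL).trans_lt (by norm_num), fun q hq n hn Ω _ P _ ε hε => ?_⟩⟩
  obtain ⟨hq1, hq3⟩ := log_inv_precision_le hL hq
  obtain ⟨hB1, hB2⟩ := noise_level_le hL
  have hu0 : 0 < min L 2 - 1 := sub_pos.2 (lt_min hL (by norm_num))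
  have hu1 : min L 2 ≤ 2 := min_le_right L 2
  refine ⟨_, hε.measurableSet_contrastsBounded _ q,
    hε.measureReal_contrastsBounded_ge hn (by positivity) (by linarith) hq1,
    fun θ ω hω T hT => ?_⟩
  have hB : ContrastsBounded ((1.1 * √L + 0.9 - √L) ^ 2) q (noiseVec ε ω) :=
    ContrastsBounded.mono hω hB1 (by linarith)
  exact ⟨IsPLSE.fewChangePoints hT hn hL (by linarith) hB,
    IsPLSE.detec hT hL hq3 (hB.mono hB2 (by linarith)),
    IsPLSE.unselectedLowEnergy hT hL (by linarith) hB⟩
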